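/- Let $M$ be a smooth manifold (Hausdorff, second countable) of dimension $n\ge 2$, let $\xi$ be a smooth real line bundle over $M$, let $k\ge 3$, and let $A$ be a linear differential operator of order $\le k$ acting on smooth sections of $\xi$. Denote by $\sigma=\mathrm{smbl}_k(A)\in C^\infty(S^kTM)$ its principal symbol; symmetric $k$-vectors at a point are identified with homogeneous polynomials of degree $k$ on the cotangent space. *Regular forms and constant type.* Let $h$ be a homogeneous polynomial of degree $k$ on an $n$-dimensional real vector space $V$, and put $\Theta_l=\frac1{l!}D^lh$. The form $h$ is called regular if there is a point $v\in V$ such that: (i) $h(v)\ne 0$ and $\Theta_2$ is nondegenerate at $v$; (ii) if $\Theta_2^0,\Theta_3^0$ are the restrictions of $\Theta_2,\Theta_3$ to $\ker dh_v$, if $\lambda$ is the covector obtained by contracting $\Theta_3^0$ with the inverse of $\Theta_2^0$, if $\hat\lambda$ is its $\Theta_2^0$-dual vector, and if $\Phi$ is given by $\Theta_3^0(\hat\lambda,X,Y)=\Theta_2^0(\Phi X,Y)$, then $\hat\lambda,\Phi\hat\lambda,\dots,\Phi^{n-2}\hat\lambda$ are linearly independent; (iii) there are rational $\mathrm{GL}(V)$-invariant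 functions $J_1,\dots,J_{n-1}$ of the 3-jets of forms of degree $k$, defined at the 3-jet of $h$ at $v$, such that the differentials at $v$ of the functions $J_1(j_3h),\dots,J_{n-1}(j_3h)$ and $h$ are linearly independent. Suppose that $A$ has constant regular type, i.e. there is a $\mathrm{GL}_n(\mathbb R)$-orbit $\varpi\subset S^k\mathbb R^n$ of a regular form such that $\phi_*(\sigma_q)\in\varpi$ for every $q\in M$ and every linear isomorphism $\phi:T_qM\to\mathbb R^n$. Then there is a unique smooth connection $\nabla^\sigma$ on $M$ (in $TM$) with $\nabla^\sigma_X\sigma=0$ for all vector fields $X$, the Wagner connection of $\sigma$. Let $T^\sigma$ be its torsion tensor and $\theta^\sigma(X)=\mathrm{Tr}\,(Y\mapsto T^\sigma(X,Y))$ its torsion form. *Subsymbol.* Given a connection $\nabla$ in $\xi$, let $d^s$ be the derivation of the module of $\xi$-valued symmetric differential forms, of degree one, which is the covariant differential of $\nabla$ on sections of $\xi$, the differential on functions, and the symmetrized covariant differential of $\nabla^\sigma$ on 1-forms. Let $Q_{\nabla,\nabla^\sigma}(\sigma)$ be the operator $s\mapsto\frac1{k!}\langle\sigma,(d^s)^k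 s\rangle$ on sections of $\xi$, and let $\sigma_{k-1,\nabla}=\mathrm{smbl}_{k-1}\big(A-Q_{\nabla,\nabla^\sigma}(\sigma)\big)$, a symmetric $(k-1)$-vector field. Suppose moreover that $\sigma$ is Wagner regular: the quadratic symbol $g_W=(\theta^\sigma)^{k-2}\rfloor\sigma$ is nondegenerate at every point. Then there exists a unique smooth linear connection $\nabla^A$ in $\xi$ such that $$(\theta^\sigma)^{k-2}\rfloor\sigma_{k-1,\nabla^A}=0 .$$ -/

import Mathlib

open scoped Manifold ContDiff Bundle
open Bundle

noncomputable section

/-! ## Homogeneous forms, their differential invariants and regularity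

Here `V` is a finite-dimensional real vector space and a form of degree `k` is a homogeneous
polynomial function of degree `k` on `V`. -/

section Forms

variable {V : Type*} [NormedAddCommGroup V] [NormedSpace ℝ V]

/-- `h` is a homogeneous polynomial function of degree `k` on `V`. -/
def IsForm (k : ℕ) (h : V → ℝ) : Prop :=
  ∃ H : MultilinearMap ℝ (fun _ : Fin k => V) ℝ, ∀ v, h v = H (fun _ => v)

/-- The quadratic form `Θ₂ = D²h / 2!` at `v`, as a bilinear form. -/
def theta2 (h : V → ℝ) (v X Y : V) : ℝ :=
  (1 / 2 : ℝ) * iteratedFDeriv ℝ 2 h v ![X, Y]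

/-- The cubic form `Θ₃ = D³h / 3!` at `v`, as a trilinear form. -/
def theta3 (h : V → ℝ) (v X Y Z : V) : ℝ :=
  (1 / 6 : ℝ) * iteratedFDeriv ℝ 3 h v ![X, Y, Z]

/-- Regularity of the 2-jet of `h` at `v`: `h(v) ≠ 0` and `Θ₂` is nondegenerate at `v`. -/
def IsRegularJet2 (h : V → ℝ) (v : V) : Prop :=
  h v ≠ 0 ∧ ∀ X : V, (∀ Y : V, theta2 h v X Y = 0) → X = 0

/-- Regularity of the 3-jet of `h` at `v`. On `K = ker Θ₁ = ker (dh)_v` let `Θ₂⁰`, `Θ₃⁰` be the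
restrictions of `Θ₂`, `Θ₃`. Then `Ψ` is the map with `Θ₃⁰(X, Y, Z) = Θ₂⁰(Ψ_X Y, Z)`, so that
`X ↦ Tr Ψ_X` is the contraction `λ` of `Θ₃⁰` with the inverse of `Θ₂⁰`, the vector `l` is dual to
`λ` with respect to `Θ₂⁰`, and `Φ = Ψ_l`. The vectors `l, Φ l, …, Φ^{n-2} l`, `n = dim V`, have to
be linearly independent. -/
def IsRegularJet3 (h : V → ℝ) (v : V) : Prop :=
  IsRegularJet2 h v ∧
    ∃ (Ψ : LinearMap.ker (fderiv ℝ h v : V →ₗ[ℝ] ℝ) →ₗ[ℝ]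
          Module.End ℝ (LinearMap.ker (fderiv ℝ h v : V →ₗ[ℝ] ℝ)))
      (l : LinearMap.ker (fderiv ℝ h v : V →ₗ[ℝ] ℝ)),
      (∀ X Y Z : LinearMap.ker (fderiv ℝ h v : V →ₗ[ℝ] ℝ),
        theta3 h v X Y Z = theta2 h v (Ψ X Y) Z) ∧
      (∀ X : LinearMap.ker (fderiv ℝ h v : V →ₗ[ℝ] ℝ),
        theta2 h v l X = LinearMap.trace ℝ _ (Ψ X)) ∧
      LinearIndependent ℝ (fun j : Fin (Module.finrank ℝ V - 1) => ((Ψ l) ^ (j : ℕ)) l)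

variable (V) in
/-- The space of 3-jets of functions on `V`: a point and the derivatives of orders `0, 1, 2, 3`. -/
abbrev Jet3 : Type _ := V × ((l : Fin 4) → ContinuousMultilinearMap ℝ (fun _ : Fin l => V) ℝ)

/-- The 3-jet of `h` at `v`. -/
def jet3 (h : V → ℝ) (v : V) : Jet3 V :=
  (v, fun l => iteratedFDeriv ℝ l h v)

/-- Polynomial functions on a vector space: the algebra generated by the linear functionals. -/
def IsPolynomialFun {W : Type*} [AddCommGroup W] [Module ℝ W] (P : W → ℝ) : Prop :=
  P ∈ Algebra.adjoin ℝ (Set.range fun (l : W →ₗ[ℝ] ℝ) (w : W) => l w)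

/-- The rational function `P / Q` of 3-jets is a differential `GL(V)`-invariant (of order `≤ 3`) of
forms of degree `k`: `(P/Q)(j₃(g^* h)(v)) = (P/Q)(j₃(h)(g v))`, wherever defined. -/
def IsRationalInvariant (k : ℕ) (P Q : Jet3 V → ℝ) : Prop :=
  IsPolynomialFun P ∧ IsPolynomialFun Q ∧
    ∀ (h : V → ℝ) (g : V ≃L[ℝ] V) (v : V), IsForm k h → v ≠ 0 →
      Q (jet3 (h ∘ g) v) ≠ 0 → Q (jet3 h (g v)) ≠ 0 →
        P (jet3 (h ∘ g) v) / Q (jet3 (h ∘ g) v) = P (jet3 h (g v)) / Q (jet3 h (g v))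

/-- Regularity of the 4-jet of `h` at `v`: the 3-jet is regular and there are rational invariants
`J₁, …, J_{n-1}` of order `≤ 3` which together with `Θ₀ = h` have independent differentials
at `v`. -/
def IsRegularJet4 (k : ℕ) (h : V → ℝ) (v : V) : Prop :=
  IsRegularJet3 h v ∧
    ∃ P Q : Fin (Module.finrank ℝ V - 1) → Jet3 V → ℝ,
      (∀ i, IsRationalInvariant k (P i) (Q i) ∧ Q i (jet3 h v) ≠ 0) ∧
      LinearIndependent ℝ
        (Fin.cons (fderiv ℝ h v)
          (fun i => fderiv ℝ (fun w => P i (jet3 h w) / Q i (jet3 h w)) v) :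
            Fin (Module.finrank ℝ V - 1 + 1) → (V →L[ℝ] ℝ))

/-- A form of degree `k` is regular if its 4-jet is regular at some point. -/
def IsRegularForm (k : ℕ) (h : V → ℝ) : Prop :=
  IsForm k h ∧ ∃ v : V, IsRegularJet4 k h v

end Forms

/-- The image of `h ∈ SᵏT`, viewed as a function on `T^*`, under a linear isomorphism
`φ : T ≃ T'`. -/
def pushForm {T T' : Type*} [AddCommGroup T] [Module ℝ T] [TopologicalSpace T]
    [AddCommGroup T'] [Module ℝ T'] [TopologicalSpace T'] (φ : T ≃L[ℝ] T')
    (h : (T →L[ℝ] ℝ) → ℝ) : (T' →L[ℝ] ℝ) → ℝ :=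
  fun α => h (α.comp (φ : T →L[ℝ] T'))

/-- `ϖ` is a regular `GL(E)`-orbit in `SᵏE`, the orbit of a regular form; elements of `SᵏE` are
forms of degree `k` on `E^*`. -/
def IsRegularOrbit {E : Type*} [NormedAddCommGroup E] [NormedSpace ℝ E] (k : ℕ)
    (ϖ : Set ((E →L[ℝ] ℝ) → ℝ)) : Prop :=
  ∃ h : (E →L[ℝ] ℝ) → ℝ, IsRegularForm k h ∧ ϖ = {h' | ∃ g : E ≃L[ℝ] E, h' = pushForm g h}

/-! ## Symbols, the Wagner connection and the torsion form -/

section Tensors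

variable {n : ℕ} {M : Type*} [TopologicalSpace M] [ChartedSpace (EuclideanSpace ℝ (Fin n)) M]

/-- Cotangent space. -/
abbrev Cotangent (n : ℕ) {M : Type*} [TopologicalSpace M]
    [ChartedSpace (EuclideanSpace ℝ (Fin n)) M] (x : M) : Type _ :=
  TangentSpace (𝓡 n) x →L[ℝ] ℝ

variable (n M) in
/-- Fields of `k`-vectors, viewed as multilinear forms on the cotangent spaces. A symmetric
`k`-vector `X₁ ⋯ X_k` is the multilinear form
`(α₁, …, α_k) ↦ (1/k!) ∑_π α₁(X_{π 1}) ⋯ α_k(X_{π k})`, so that its value at `(α, …, α)` is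
the value at `α` of the homogeneous polynomial `∏ α(X_i)`. -/
abbrev TensorField (k : ℕ) : Type _ :=
  (x : M) → MultilinearMap ℝ (fun _ : Fin k => Cotangent n x) ℝ

variable (n M) in
/-- Covariant derivatives on the tangent bundle. -/
abbrev AffineConnection [IsManifold (𝓡 n) ∞ M] : Type _ :=
  CovariantDerivative (𝓡 n) (EuclideanSpace ℝ (Fin n)) (TangentSpace (𝓡 n) : M → Type _)

/-- The symbol `σ` of degree `k` has constant type `ϖ`. -/
def HasConstantType {k : ℕ} (ϖ : Set ((EuclideanSpace ℝ (Fin n) →L[ℝ] ℝ) → ℝ))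
    (σ : TensorField n M k) : Prop :=
  ∀ (x : M) (φ : TangentSpace (𝓡 n) x ≃L[ℝ] EuclideanSpace ℝ (Fin n)),
    pushForm φ (fun α : Cotangent n x => σ x (fun _ => α)) ∈ ϖ

/-- The contraction `θ^{k-r} ⌋ τ` of a `k`-vector `τ` with a power of a covector `θ`, an `r`-vector
(for `r ≤ k`). -/
def hookPow {x : M} {k : ℕ} (r : ℕ) (θ : Cotangent n x)
    (τ : MultilinearMap ℝ (fun _ : Fin k => Cotangent n x) ℝ) (α : Fin r → Cotangent n x) : ℝ :=
  τ fun i => if hi : (i : ℕ) < r then α ⟨i, hi⟩ else θ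

variable [IsManifold (𝓡 n) ∞ M]

variable (n M) in
/-- Smooth vector fields. -/
abbrev VectorFields : Type _ :=
  ContMDiffSection (𝓡 n) (EuclideanSpace ℝ (Fin n)) ∞ (TangentSpace (𝓡 n) : M → Type _)

variable (n M) in
/-- Smooth differential 1-forms. -/
abbrev OneForms : Type _ :=
  ContMDiffSection (𝓡 n) (EuclideanSpace ℝ (Fin n) →L[ℝ] ℝ) ∞
    (fun x : M => TangentSpace (𝓡 n) x →L[ℝ] Bundle.Trivial M ℝ x)

/-- `η = ∇_X θ` for the dual connection on 1-forms:
`η(Y) = X(θ(Y)) - θ(∇_X Y)` for all vector fields `Y`. -/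
def IsCovDerivForm (W : AffineConnection n M) (X : VectorFields n M) (θ η : OneForms n M) : Prop :=
  ∀ (Y : VectorFields n M) (x : M),
    η x (Y x) = mvfderiv (𝓡 n) (fun y => θ y (Y y)) x (X x) - θ x (W Y x (X x))

/-- `∇_X σ = 0` for all vector fields `X`, that is,
`X(σ(θ₁, …, θ_k)) = ∑ i, σ(θ₁, …, ∇_X θ_i, …, θ_k)` for all 1-forms `θ_i`. -/
def IsParallel {k : ℕ} (W : AffineConnection n M) (σ : TensorField n M k) : Prop :=
  ∀ (X : VectorFields n M) (θ η : Fin k → OneForms n M),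
    (∀ i, IsCovDerivForm W X (θ i) (η i)) → ∀ x : M,
      mvfderiv (𝓡 n) (fun y => σ y (fun j => θ j y)) x (X x) =
        ∑ i, σ x (Function.update (fun j => θ j x) i (η i x))

/-- `W` is a Wagner connection of the symbol `σ`: a smooth connection on `M` preserving `σ`. -/
def IsWagnerConnection {k : ℕ} (σ : TensorField n M k) (W : AffineConnection n M) : Prop :=
  W.ContMDiffCovariantDerivative ∞ ∧ IsParallel W σ

/-- The torsion form `θ(X) = Tr(Y ↦ T(X, Y))`. -/
def torsionForm (W : AffineConnection n M) (x : M) : Cotangent n x :=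
  haveI : FiniteDimensional ℝ (TangentSpace (𝓡 n) x) :=
    inferInstanceAs (FiniteDimensional ℝ (EuclideanSpace ℝ (Fin n)))
  haveI : T2Space (TangentSpace (𝓡 n) x) := inferInstanceAs (T2Space (EuclideanSpace ℝ (Fin n)))
  LinearMap.toContinuousLinearMap
    (LinearMap.trace ℝ (TangentSpace (𝓡 n) x) ∘ₗ ContinuousLinearMap.coeLM ℝ ∘ₗ
      (W.torsion x).toLinearMap)

/-- `σ` is Wagner regular (with respect to its Wagner connection `W`): the quadratic symbol
`g_W = θ^{k-2} ⌋ σ` is nondegenerate at every point. -/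
def IsWagnerRegular {k : ℕ} (σ : TensorField n M k) (W : AffineConnection n M) : Prop :=
  ∀ (x : M) (α : Cotangent n x),
    (∀ β : Cotangent n x, hookPow 2 (torsionForm W x) (σ x) ![α, β] = 0) → α = 0

end Tensors

/-! ## Differential operators in a line bundle, their symbols, and quantization -/

section Operators

variable {n : ℕ} {M : Type*} [TopologicalSpace M] [ChartedSpace (EuclideanSpace ℝ (Fin n)) M]
  {ξ : M → Type*} [TopologicalSpace (TotalSpace ℝ ξ)]
  [∀ x, AddCommGroup (ξ x)] [∀ x, Module ℝ (ξ x)] [∀ x, TopologicalSpace (ξ x)]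
  [FiberBundle ℝ ξ] [VectorBundle ℝ ℝ ξ]

variable (n ξ) in
/-- Smooth sections of `ξ`. -/
abbrev Sections : Type _ := ContMDiffSection (𝓡 n) ℝ ∞ ξ

variable (n ξ) in
/-- Maps from smooth sections of `ξ` to (a priori arbitrary) sections of `ξ`. -/
abbrev SectionMap : Type _ := Sections n ξ → (x : M) → ξ x

/-- The product of a smooth section with a smooth function. -/
def smulSection (f : C^∞⟮𝓡 n, M; ℝ⟯) (h : Sections n ξ) : Sections n ξ :=
  ⟨fun x => f x • h x, f.contMDiff.smul_section h.contMDiff⟩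

/-- The commutator `[B, f]` with the multiplication by the function `f`. -/
def bracketFn (B : SectionMap n ξ) (f : C^∞⟮𝓡 n, M; ℝ⟯) : SectionMap n ξ :=
  fun h x => B (smulSection f h) x - f x • B h x

/-- The iterated commutator `[…[[B, f₁], f₂], …, f_j]`. -/
def iterCommutator : (j : ℕ) → SectionMap n ξ → (Fin j → C^∞⟮𝓡 n, M; ℝ⟯) → SectionMap n ξ
  | 0, B, _ => B
  | j + 1, B, f => iterCommutator j (bracketFn B (f 0)) (Fin.tail f)

/-- `A` is a linear differential operator of order `≤ k` in `ξ`: all `(k+1)`-fold commutators with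
smooth functions vanish. -/
def IsDiffOp (k : ℕ) (A : Sections n ξ →ₗ[ℝ] Sections n ξ) : Prop :=
  ∀ (f : Fin (k + 1) → C^∞⟮𝓡 n, M; ℝ⟯) (h : Sections n ξ) (x : M),
    iterCommutator (k + 1) (fun s => A s) f h x = 0

/-- `σ` is the symbol of degree `j` of the operator `B`:
`[…[B, f₁], …, f_j] = j! σ(df₁, …, df_j)`, as a multiplication operator. -/
def IsSymbolOf (j : ℕ) (B : SectionMap n ξ) (σ : TensorField n M j) : Prop :=
  ∀ (f : Fin j → C^∞⟮𝓡 n, M; ℝ⟯) (h : Sections n ξ) (x : M),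
    iterCommutator j B f h x =
      ((j.factorial : ℝ) * σ x (fun i => mvfderiv (𝓡 n) (f i) x)) • h x

/-- The symbol `smbl_j(B)` of an operator of order `≤ j` (there is exactly one, it is symmetric and
smooth). -/
def smbl (j : ℕ) (B : SectionMap n ξ) : TensorField n M j :=
  Classical.epsilon (IsSymbolOf j B)

variable [IsManifold (𝓡 n) ∞ M]
  [∀ x, IsTopologicalAddGroup (ξ x)] [∀ x, ContinuousSMul ℝ (ξ x)]

/-- The derivation `d^s` on symmetric forms with values in `ξ`, given by the connections `W` on `M`
and `D` in `ξ`. A `ξ`-valued symmetric form of degree `k` is regarded as a multilinear map from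
`k`-tuples of vector fields to sections, the product of 1-forms being
`(θ₁ ⋯ θ_k)(X₁, …, X_k) = ∑_π θ₁(X_{π 1}) ⋯ θ_k(X_{π k})`; then
`(d^s Ω)(X₀, …, X_k) = ∑ i, (∇_{X_i} Ω)(X₀, …, X̂_i, …, X_k)`. -/
def symDeriv (W : AffineConnection n M) (D : CovariantDerivative (𝓡 n) ℝ ξ) {k : ℕ}
    (Ω : (Fin k → (x : M) → TangentSpace (𝓡 n) x) → (x : M) → ξ x) :
    (Fin (k + 1) → (x : M) → TangentSpace (𝓡 n) x) → (x : M) → ξ x :=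
  fun X x => ∑ i : Fin (k + 1),
    (D (Ω (i.removeNth X)) x (X i x) -
      ∑ j : Fin k,
        Ω (Function.update (i.removeNth X) j (fun y => W (i.removeNth X j) y (X i y))) x)

/-- `(d^s)^k h` for a section `h` of `ξ`. -/
def symDerivIter (W : AffineConnection n M) (D : CovariantDerivative (𝓡 n) ℝ ξ)
    (h : (x : M) → ξ x) :
    (k : ℕ) → (Fin k → (x : M) → TangentSpace (𝓡 n) x) → (x : M) → ξ x
  | 0 => fun _ => h
  | k + 1 => symDeriv W D (symDerivIter W D h k)

/-- The natural pairing at `x` of a symmetric `k`-vector with a `ξ`-valued symmetric `k`-form,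
`⟨X₁ ⋯ X_k, Ω⟩ = Ω(X₁, …, X_k)`, computed as a full contraction in a basis of the tangent space;
the form is evaluated on local extensions of the basis vectors. -/
def pairing {k : ℕ} (x : M) (τ : MultilinearMap ℝ (fun _ : Fin k => Cotangent n x) ℝ)
    (Ω : (Fin k → (x : M) → TangentSpace (𝓡 n) x) → (x : M) → ξ x) : ξ x :=
  ∑ I : Fin k → Fin n,
    τ (fun j => (EuclideanSpace.proj (I j) : EuclideanSpace ℝ (Fin n) →L[ℝ] ℝ)) •
      Ω (fun j => FiberBundle.extend (EuclideanSpace ℝ (Fin n)) (x := x)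
        (EuclideanSpace.single (I j) (1 : ℝ) : TangentSpace (𝓡 n) x)) x

/-- The quantization `Q_{D,W}(σ) h = (1/k!) ⟨σ, (d^s)^k h⟩`. -/
def quantization (W : AffineConnection n M) (D : CovariantDerivative (𝓡 n) ℝ ξ) {k : ℕ}
    (σ : TensorField n M k) : SectionMap n ξ :=
  fun h x => (1 / (k.factorial : ℝ)) • pairing x (σ x) (symDerivIter W D h k)

/-- The subsymbol `σ_{k-1,D} = smbl_{k-1}(A - Q_{D,W}(smbl_k(A)))`. -/
def subsymbol (k : ℕ) (A : Sections n ξ →ₗ[ℝ] Sections n ξ) (W : AffineConnection n M)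
    (D : CovariantDerivative (𝓡 n) ℝ ξ) : TensorField n M (k - 1) :=
  smbl (k - 1) fun h x => A h x - quantization W D (smbl k fun s => A s) h x

end Operators

/-- Two covariant derivatives are the same connection if they agree on all sections, at the points
where these are differentiable. (At other points the values carry no information.) -/
def SameConnection {n : ℕ} {M : Type*} [TopologicalSpace M]
    [ChartedSpace (EuclideanSpace ℝ (Fin n)) M] {F : Type*} [NormedAddCommGroup F]
    [NormedSpace ℝ F] {ζ : M → Type*} [TopologicalSpace (TotalSpace F ζ)]
    [∀ x, AddCommGroup (ζ x)] [∀ x, Module ℝ (ζ x)] [∀ x, TopologicalSpace (ζ x)]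
    [∀ x, IsTopologicalAddGroup (ζ x)] [∀ x, ContinuousSMul ℝ (ζ x)] [FiberBundle F ζ]
    (D D' : CovariantDerivative (𝓡 n) F ζ) : Prop :=
  ∀ (s : (x : M) → ζ x) (x : M),
    MDifferentiableAt (𝓡 n) ((𝓡 n).prod 𝓘(ℝ, F)) (fun y => TotalSpace.mk' F y (s y)) x →
      D s x = D' s x

end

/-! The theorem rests on two linear equations with unique solutions: one for the Wagner connection,
and one for the connection in the line bundle.

Wagner connection. A regular form `h` has no infinitesimal linear symmetries
(`IsRegularForm.hasTrivialIsotropy`). If `dh_w(Lw) = 0` for all `w`, the flow `exp(tL)` preserves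
`h` and hence every rational invariant of its 3-jets. So `Lw` is annihilated by `dh` and by the
differentials of the `J_i`; these span the dual space for `w` near the regular point, and therefore
`L = 0`. Consequently the infinitesimal action of `gl_n` on the tensor `σ_x` is injective. Constant
type means that the coordinates of `σ` in any frame stay in one orbit, and so their derivatives are
tangent to the orbit, i.e. lie in the image of this action (`exists_tensorAction_eq_of_orbit`). For
an arbitrary smooth connection `∇`, the equation `U_X · σ = -∇_X σ` thus has exactly one solution
`U_X` in the endomorphisms, and it depends smoothly on the point. The connection `∇ + U` is the
Wagner connection, and injectivity also gives uniqueness.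

The tangency needs no structure theory of orbits. The group elements `G(t)` that move the base form
to the point at time `t` are chosen arbitrarily. The group is second countable and an interval is
uncountable, so at some time `t₀` the values `G(t)` accumulate at `G(t₀)`. Comparing the curve with
the derivative of the action at the identity gives tangency at `t₀`. Such times occur arbitrarily
near `0`, and because the action map is injective there, tangency passes to the limit.

Subsymbol. Symbols are computed with iterated commutators with functions. For an operator of order
`≤ j` the `j`-fold commutator is a multiplication operator and a derivation in each function, so by
Hadamard's lemma it depends on differentials only (`exists_isSymbolOf`). The commutator of `d^s`
with `f` is multiplication by `df`, and induction gives the leading commutators of `(d^s)^k`. It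
follows that `Q(σ)` has symbol `σ`, and that replacing `∇` by `∇ + η` in the line bundle changes the
`(k-1)`-fold commutator by a multiple of `η · df^{k-1}` (`diagComm_symIter_addForm`). After
normalization `σ_{k-1}` changes by `-k η ⌋ σ` (`subsymbol_sub`). Contracting with `θ^{k-2}` leaves
`-k g_W(η, ·)`. Connections in a line bundle form an affine space over the 1-forms, and `g_W` is
nondegenerate, so exactly one `η` makes the contraction vanish. -/

noncomputable section

set_option linter.unusedSectionVars false

/-! ### Cut-offs, global sections with prescribed germs, and local frames. -/

section Geometry

open Filter Topology

variable {n : ℕ} {M : Type*} [TopologicalSpace M] [ChartedSpace (EuclideanSpace ℝ (Fin n)) M]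
  {F : Type*} [NormedAddCommGroup F] [NormedSpace ℝ F]
  {V : M → Type*} [TopologicalSpace (TotalSpace F V)]
  [∀ x, AddCommGroup (V x)] [∀ x, Module ℝ (V x)] [∀ x, TopologicalSpace (V x)]
  [FiberBundle F V] [VectorBundle ℝ F V]

/-- Smooth sections form a module over the smooth functions. -/
instance ContMDiffSection.instModuleContMDiffMap :
    Module C^∞⟮𝓡 n, M; ℝ⟯ (ContMDiffSection (𝓡 n) F ∞ V) where
  smul f s := ⟨fun x => f x • s x, f.contMDiff.smul_section s.contMDiff⟩
  one_smul s := by ext x; exact one_smul ℝ (s x)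
  mul_smul f g s := by ext x; exact mul_smul (f x) (g x) (s x)
  smul_zero f := by ext x; exact smul_zero (f x)
  smul_add f s t := by ext x; exact smul_add (f x) (s x) (t x)
  add_smul f g s := by ext x; exact add_smul (f x) (g x) (s x)
  zero_smul s := by ext x; exact zero_smul ℝ (s x)

@[simp] lemma ContMDiffSection.fn_smul_apply (f : C^∞⟮𝓡 n, M; ℝ⟯)
    (s : ContMDiffSection (𝓡 n) F ∞ V) (x : M) : (f • s) x = f x • s x := rfl

@[simp] lemma ContMDiffSection.add_apply' (s t : ContMDiffSection (𝓡 n) F ∞ V) (x : M) :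
    (s + t) x = s x + t x := rfl

@[simp] lemma ContMDiffSection.sub_apply' (s t : ContMDiffSection (𝓡 n) F ∞ V) (x : M) :
    (s - t) x = s x - t x := rfl

/-- Evaluation of sections at a point, as an additive map. -/
def ContMDiffSection.evalAddHom (x : M) : ContMDiffSection (𝓡 n) F ∞ V →+ V x where
  toFun s := s x
  map_zero' := rfl
  map_add' _ _ := rfl

@[simp] lemma ContMDiffSection.sum_apply {ι : Type*} (t : Finset ι)
    (s : ι → ContMDiffSection (𝓡 n) F ∞ V) (x : M) : (∑ i ∈ t, s i) x = ∑ i ∈ t, s i x :=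
  map_sum (ContMDiffSection.evalAddHom x) s t

@[simp] lemma ContMDiffMap.sum_apply_real {ι : Type*} (t : Finset ι)
    (s : ι → C^∞⟮𝓡 n, M; ℝ⟯) (x : M) : (∑ i ∈ t, s i) x = ∑ i ∈ t, s i x :=
  map_sum (ContMDiffMap.evalRingHom x : C^∞⟮𝓡 n, M; ℝ⟯ →+* ℝ) s t

@[simp] lemma ContMDiffMap.add_apply_real (f g : C^∞⟮𝓡 n, M; ℝ⟯) (x : M) :
    (f + g) x = f x + g x := rfl

@[simp] lemma ContMDiffMap.mul_apply_real (f g : C^∞⟮𝓡 n, M; ℝ⟯) (x : M) :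
    (f * g) x = f x * g x := rfl


lemma contMDiff_bump_smul {u : Set M} {χ : C^∞⟮𝓡 n, M; ℝ⟯} (hu : IsOpen u)
    (hχ : tsupport χ ⊆ u) {E : Type*} [NormedAddCommGroup E] [NormedSpace ℝ E] {f : M → E}
    (hf : ContMDiffOn (𝓡 n) 𝓘(ℝ, E) ∞ f u) :
    ContMDiff (𝓡 n) 𝓘(ℝ, E) ∞ (fun y => χ y • f y) := by
  refine contMDiff_of_tsupport fun y hy => ?_
  have hyu : y ∈ u := hχ (tsupport_smul_subset_left _ _ hy)
  exact χ.contMDiff.contMDiffAt.smul ((hf y hyu).contMDiffAt (hu.mem_nhds hyu))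

variable [IsManifold (𝓡 n) ∞ M] [T2Space M]

lemma exists_bump {x : M} {u : Set M} (hu : u ∈ 𝓝 x) :
    ∃ χ : C^∞⟮𝓡 n, M; ℝ⟯, (∀ᶠ y in 𝓝 x, χ y = 1) ∧ tsupport χ ⊆ u := by
  obtain ⟨φ, hφ⟩ := ((SmoothBumpFunction.nhds_basis_support (I := 𝓡 n) hu).ex_mem)
  exact ⟨⟨φ, φ.contMDiff⟩, φ.eventuallyEq_one, hφ⟩

/-- A cut-off replaces a local section by a global one with the same germ. Since operators are only
defined on global sections, every local computation below passes through this. -/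
lemma exists_section_eventuallyEq {x : M} {u : Set M} (hu : u ∈ 𝓝 x) {s : Π x, V x}
    (hs : ContMDiffOn (𝓡 n) ((𝓡 n).prod 𝓘(ℝ, F)) ∞ (fun y => TotalSpace.mk' F y (s y)) u) :
    ∃ S : ContMDiffSection (𝓡 n) F ∞ V, ∀ᶠ y in 𝓝 x, S y = s y := by
  obtain ⟨χ, h1, h2⟩ := exists_bump (n := n) (interior_mem_nhds.2 hu)
  refine ⟨⟨(χ : M → ℝ) • s, ContMDiffOn.smul_section_of_tsupport χ.contMDiff.contMDiffOn
    isOpen_interior h2 (hs.mono interior_subset)⟩, ?_⟩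
  filter_upwards [h1] with y hy
  change χ y • s y = s y
  rw [hy, one_smul]

lemma exists_function_eventuallyEq {x : M} {u : Set M} (hu : u ∈ 𝓝 x) {f : M → ℝ}
    (hf : ContMDiffOn (𝓡 n) 𝓘(ℝ, ℝ) ∞ f u) : ∃ g : C^∞⟮𝓡 n, M; ℝ⟯, ∀ᶠ y in 𝓝 x, g y = f y := by
  obtain ⟨χ, h1, h2⟩ := exists_bump (n := n) (interior_mem_nhds.2 hu)
  refine ⟨⟨_, contMDiff_bump_smul isOpen_interior h2 (hf.mono interior_subset)⟩, ?_⟩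
  filter_upwards [h1] with y hy
  change χ y • f y = f y
  rw [hy, one_smul]

/-- Near every point the module of smooth sections is generated by a frame. -/
lemma exists_section_frame [FiniteDimensional ℝ F] [ContMDiffVectorBundle ∞ F V (𝓡 n)] (x : M)
    {ι : Type*} [Fintype ι] (b : Module.Basis ι ℝ F) :
    ∃ (Z : ι → ContMDiffSection (𝓡 n) F ∞ V) (f : C^∞⟮𝓡 n, M; ℝ⟯), (∀ᶠ y in 𝓝 x, f y = 1) ∧
      (∀ᶠ y in 𝓝 x, ∀ i, Z i y = (trivializationAt F V x).localFrame b i y) ∧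
      ∀ s : ContMDiffSection (𝓡 n) F ∞ V, ∃ g : ι → C^∞⟮𝓡 n, M; ℝ⟯, f • s = ∑ i, g i • Z i := by
  have : ContMDiffVectorBundle 1 F V (𝓡 n) := ContMDiffVectorBundle.of_le (n := ∞) (by norm_num)
  set t := trivializationAt F V x
  have ht : t.baseSet ∈ 𝓝 x := t.open_baseSet.mem_nhds (FiberBundle.mem_baseSet_trivializationAt' x)
  obtain ⟨χ, h1, h2⟩ := exists_bump (n := n) ht
  have hfr := t.isLocalFrameOn_localFrame_baseSet (𝓡 n) ∞ b
  -- The frame and the coefficients are both defined only on the trivializing set, so each needs its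
  -- own factor `χ`; this is why the multiplier is `χ * χ`.
  refine ⟨fun i => ⟨(χ : M → ℝ) • t.localFrame b i,
    ContMDiffOn.smul_section_of_tsupport χ.contMDiff.contMDiffOn t.open_baseSet h2
      (hfr.contMDiffOn i)⟩, χ * χ, ?_, ?_, fun s => ?_⟩
  · filter_upwards [h1] with y hy
    simp [hy]
  · filter_upwards [h1] with y hy i
    change χ y • t.localFrame b i y = t.localFrame b i y
    rw [hy, one_smul]
  · refine ⟨fun i => ⟨_, contMDiff_bump_smul t.open_baseSet h2
      (contMDiffOn_localFrameCoeff (I := 𝓡 n) (e := t) b t.open_baseSet le_rfl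
        (s.contMDiff.contMDiffOn (s := t.baseSet)) i)⟩, ?_⟩
    ext y
    rw [ContMDiffSection.sum_apply]
    change (χ y * χ y) • s y = ∑ i, (χ y • (t.localFrameCoeff (𝓡 n) b i y (s y))) •
      (χ y • t.localFrame b i y)
    by_cases hy : y ∈ t.baseSet
    · conv_lhs => rw [t.eq_sum_localFrameCoeff_smul (I := 𝓡 n) (b := b) (s := s) hy]
      rw [Finset.smul_sum]
      refine Finset.sum_congr rfl fun i _ => ?_
      rw [smul_smul, smul_smul, smul_eq_mul]
      congr 1
      ring
    · have : χ y = 0 := image_eq_zero_of_notMem_tsupport fun h => hy (h2 h)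
      simp [this]

end Geometry

/-! ### Differentials of functions and dual frames. -/

section Frames

open Filter Topology

variable {n : ℕ} {M : Type*} [TopologicalSpace M] [ChartedSpace (EuclideanSpace ℝ (Fin n)) M] [IsManifold (𝓡 n) ∞ M]

lemma contMDiff_mvfderiv (f : C^∞⟮𝓡 n, M; ℝ⟯) :
    ContMDiff (𝓡 n) ((𝓡 n).prod 𝓘(ℝ, EuclideanSpace ℝ (Fin n) →L[ℝ] ℝ)) ∞
      (fun x => TotalSpace.mk' (EuclideanSpace ℝ (Fin n) →L[ℝ] ℝ)
        (E := fun x : M => TangentSpace (𝓡 n) x →L[ℝ] Bundle.Trivial M ℝ x) x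
        (mvfderiv (𝓡 n) f x)) := by
  intro x
  rw [contMDiffAt_hom_bundle]
  refine ⟨contMDiffAt_id, ?_⟩
  have := (f.contMDiff.contMDiffAt (x := x)).mfderiv_const (m := ∞) (by simp)
  refine this.congr_of_eventuallyEq ?_
  have h : (chartAt (EuclideanSpace ℝ (Fin n)) x).source ∈ 𝓝 x := chart_source_mem_nhds _ x
  filter_upwards [h] with y hy
  simp only [inTangentCoordinates, id]
  ext v
  have hfy : f y ∈ (trivializationAt ℝ (TangentSpace 𝓘(ℝ, ℝ)) (f x)).baseSet := by
    simp [chartAt_self_eq]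
  have key : ∀ z : TangentSpace 𝓘(ℝ, ℝ) (f y),
      Bundle.Trivialization.continuousLinearMapAt ℝ
        (trivializationAt ℝ (TangentSpace 𝓘(ℝ, ℝ)) (f x)) (f y) z = z := fun z => by
    rw [TangentBundle.continuousLinearMapAt_model_space]
    rfl
  rw [ContinuousLinearMap.inCoordinates_eq hy (by simp),
    ContinuousLinearMap.inCoordinates_eq hy hfy]
  simp [mvfderiv]
  rfl

lemma contMDiff_oneForm_apply (θ : OneForms n M) (Y : VectorFields n M) :
    ContMDiff (𝓡 n) 𝓘(ℝ, ℝ) ∞ (fun y => θ y (Y y)) := by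
  have := θ.contMDiff.clm_bundle_apply Y.contMDiff
  intro x
  have := this x
  rw [contMDiffAt_section] at this
  exact this

/-- The differential of a smooth function. -/
def dForm (f : C^∞⟮𝓡 n, M; ℝ⟯) : OneForms n M := ⟨mvfderiv (𝓡 n) f, contMDiff_mvfderiv f⟩

@[simp] lemma dForm_apply (f : C^∞⟮𝓡 n, M; ℝ⟯) (x : M) : dForm f x = mvfderiv (𝓡 n) f x := rfl

/-- The function `θ(Y)`. -/
def OneForms.pair (θ : OneForms n M) (Y : VectorFields n M) : C^∞⟮𝓡 n, M; ℝ⟯ :=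
  ⟨_, contMDiff_oneForm_apply θ Y⟩

@[simp] lemma OneForms.pair_apply (θ : OneForms n M) (Y : VectorFields n M) (x : M) :
    OneForms.pair θ Y x = θ x (Y x) := rfl

instance (x : M) : FiniteDimensional ℝ (TangentSpace (𝓡 n) x) :=
  inferInstanceAs (FiniteDimensional ℝ (EuclideanSpace ℝ (Fin n)))

/-- Functions `f a` and fields `Z a` whose differentials, resp. values, form dual bases on `u`. -/
structure IsDualFrame (f : Fin n → C^∞⟮𝓡 n, M; ℝ⟯) (Z : Fin n → VectorFields n M) (x : M) :
    Prop where
  apply (a b : Fin n) : mvfderiv (𝓡 n) (f a) x (Z b x) = if a = b then 1 else 0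

namespace IsDualFrame

variable {f : Fin n → C^∞⟮𝓡 n, M; ℝ⟯} {Z : Fin n → VectorFields n M} {x : M}

lemma linearIndependent (h : IsDualFrame f Z x) : LinearIndependent ℝ fun a => Z a x := by
  rw [Fintype.linearIndependent_iff]
  intro g hg b
  have := congrArg (mvfderiv (𝓡 n) (f b) x) hg
  simpa [h.apply] using this

lemma sum_smul (h : IsDualFrame f Z x) (v : TangentSpace (𝓡 n) x) :
    v = ∑ a, mvfderiv (𝓡 n) (f a) x v • Z a x := by
  have hfr : Module.finrank ℝ (TangentSpace (𝓡 n) x) = n :=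
    (finrank_euclideanSpace_fin : Module.finrank ℝ (EuclideanSpace ℝ (Fin n)) = n)
  let b := basisOfLinearIndependentOfCardEqFinrank' (K := ℝ) (fun a => Z a x) h.linearIndependent (by simpa using hfr.symm)
  have hb : ∀ a, b a = Z a x := fun a => by simp [b]
  have h1 := b.sum_repr v
  have h2 : ∀ a, mvfderiv (𝓡 n) (f a) x v = b.repr v a := fun a => by
    conv_lhs => rw [← h1]
    simp [hb, h.apply]
  simp_rw [h2, ← hb, h1]

lemma sum_smul_dual (h : IsDualFrame f Z x) (α : Cotangent n x) :
    α = ∑ a, α (Z a x) • mvfderiv (𝓡 n) (f a) x := by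
  ext v
  conv_lhs => rw [h.sum_smul v]
  simp [mul_comm]

end IsDualFrame

lemma contMDiffAt_mvfderiv_apply (f : C^∞⟮𝓡 n, M; ℝ⟯) {Y : Π x : M, TangentSpace (𝓡 n) x} {x : M}
    (hY : ContMDiffAt (𝓡 n) ((𝓡 n).prod 𝓘(ℝ, EuclideanSpace ℝ (Fin n))) ∞
      (fun y => TotalSpace.mk' (EuclideanSpace ℝ (Fin n)) y (Y y)) x) :
    ContMDiffAt (𝓡 n) 𝓘(ℝ, ℝ) ∞ (fun y => mvfderiv (𝓡 n) f y (Y y)) x := by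
  have := ((contMDiff_mvfderiv f).contMDiffAt (x := x)).clm_bundle_apply hY
  rw [contMDiffAt_section] at this
  exact this

variable [T2Space M]

/-- Chart coordinates and the coordinate fields, cut off to global objects, are dual near `x`. All
later tensor calculations are made in such frames. -/
lemma exists_isDualFrame (x : M) :
    ∃ (f : Fin n → C^∞⟮𝓡 n, M; ℝ⟯) (Z : Fin n → VectorFields n M),
      ∀ᶠ y in 𝓝 x, IsDualFrame f Z y := by
  have hsrc : (chartAt (EuclideanSpace ℝ (Fin n)) x).source ∈ 𝓝 x := chart_source_mem_nhds _ x
  obtain ⟨Z, -, -, hZ, -⟩ := exists_section_frame (n := n) (V := (TangentSpace (𝓡 n) : M → Type _)) x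
    (EuclideanSpace.basisFun (Fin n) ℝ).toBasis
  have hf : ∀ a : Fin n, ∃ g : C^∞⟮𝓡 n, M; ℝ⟯, ∀ᶠ y in 𝓝 x, g y = extChartAt (𝓡 n) x y a := by
    intro a
    refine exists_function_eventuallyEq hsrc ?_
    exact (EuclideanSpace.proj a : EuclideanSpace ℝ (Fin n) →L[ℝ] ℝ).contDiff.contMDiff.comp_contMDiffOn
      (contMDiffOn_extChartAt (I := 𝓡 n) (n := ∞) (x := x))
  choose f hf using hf
  refine ⟨f, Z, ?_⟩
  filter_upwards [(Filter.eventually_all.2 fun a => hf a).eventually_nhds, hZ, hsrc] with y hfy hZy hy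
  refine ⟨fun a b => ?_⟩
  have h1 : (f a : M → ℝ) =ᶠ[𝓝 y] fun z => extChartAt (𝓡 n) x z a := by
    filter_upwards [hfy] with z hz
    exact hz a
  have h2 : HasMFDerivAt (𝓡 n) 𝓘(ℝ, ℝ) (f a) y ((EuclideanSpace.proj a :
      EuclideanSpace ℝ (Fin n) →L[ℝ] ℝ) ∘L mfderiv (𝓡 n) (𝓡 n) (extChartAt (𝓡 n) x) y) := by
    refine HasMFDerivAt.congr_of_eventuallyEq (f := fun z => extChartAt (𝓡 n) x z a) ?_ h1
    exact HasMFDerivAt.comp (I' := 𝓡 n) y ((EuclideanSpace.proj a : EuclideanSpace ℝ (Fin n) →L[ℝ] ℝ).hasMFDerivAt)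
      (mdifferentiableAt_extChartAt hy).hasMFDerivAt
  have hyb : y ∈ (trivializationAt (EuclideanSpace ℝ (Fin n))
    (TangentSpace (𝓡 n) : M → Type _) x).baseSet := hy
  rw [hZy b, mvfderiv, h2.mfderiv, ← TangentBundle.continuousLinearMapAt_trivializationAt hy,
    Trivialization.localFrame_apply_of_mem_baseSet _ _ hyb]
  have h3 : (trivializationAt (EuclideanSpace ℝ (Fin n))
    (TangentSpace (𝓡 n) : M → Type _) x).continuousLinearMapAt ℝ y ((trivializationAt (EuclideanSpace ℝ (Fin n))
    (TangentSpace (𝓡 n) : M → Type _) x).basisAt (EuclideanSpace.basisFun (Fin n) ℝ).toBasis hyb b) = EuclideanSpace.single b 1 := by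
    rw [Trivialization.basisAt, Module.Basis.map_apply, OrthonormalBasis.coe_toBasis,
      EuclideanSpace.basisFun_apply]
    rw [Trivialization.continuousLinearMapAt_apply, Trivialization.linearMapAt_def_of_mem _ hyb]
    exact LinearEquiv.apply_symm_apply _ _
  change (EuclideanSpace.proj a : EuclideanSpace ℝ (Fin n) →L[ℝ] ℝ) ((trivializationAt
    (EuclideanSpace ℝ (Fin n)) (TangentSpace (𝓡 n) : M → Type _) x).continuousLinearMapAt ℝ y
    ((trivializationAt (EuclideanSpace ℝ (Fin n)) (TangentSpace (𝓡 n) : M → Type _) x).basisAt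
      (EuclideanSpace.basisFun (Fin n) ℝ).toBasis hyb b)) = _
  rw [h3]
  simp

/-- A field of homomorphisms from the tangent spaces is smooth if its values on smooth vector
fields are. -/
lemma contMDiff_hom_of_apply {F : Type*} [NormedAddCommGroup F] [NormedSpace ℝ F]
    {V : M → Type*} [TopologicalSpace (TotalSpace F V)]
    [∀ x, AddCommGroup (V x)] [∀ x, Module ℝ (V x)] [∀ x, TopologicalSpace (V x)]
    [∀ x, IsTopologicalAddGroup (V x)] [∀ x, ContinuousSMul ℝ (V x)]
    [FiberBundle F V] [VectorBundle ℝ F V] [ContMDiffVectorBundle ∞ F V (𝓡 n)]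
    (η : (x : M) → TangentSpace (𝓡 n) x →L[ℝ] V x)
    (h : ∀ Y : VectorFields n M, ContMDiff (𝓡 n) ((𝓡 n).prod 𝓘(ℝ, F)) ∞
      fun x => TotalSpace.mk' F x (η x (Y x))) :
    ContMDiff (𝓡 n) ((𝓡 n).prod 𝓘(ℝ, EuclideanSpace ℝ (Fin n) →L[ℝ] F)) ∞
      (fun x => TotalSpace.mk' (EuclideanSpace ℝ (Fin n) →L[ℝ] F)
        (E := fun x : M => TangentSpace (𝓡 n) x →L[ℝ] V x) x (η x)) := by
  intro x
  rw [contMDiffAt_hom_bundle]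
  refine ⟨contMDiffAt_id, ?_⟩
  obtain ⟨Z, -, -, hZ, -⟩ := exists_section_frame (n := n)
    (V := (TangentSpace (𝓡 n) : M → Type _)) x (EuclideanSpace.basisFun (Fin n) ℝ).toBasis
  set t := trivializationAt (EuclideanSpace ℝ (Fin n)) (TangentSpace (𝓡 n) : M → Type _) x
  set t' := trivializationAt F V x
  have key : ContMDiffAt (𝓡 n) 𝓘(ℝ, EuclideanSpace ℝ (Fin n) →L[ℝ] F) ∞
      (fun y => ∑ a, ContinuousLinearMap.smulRightL ℝ (EuclideanSpace ℝ (Fin n)) F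
        (EuclideanSpace.proj a) (t' ⟨y, η y (Z a y)⟩).2) x := by
    refine ContMDiffAt.sum fun a _ => ?_
    have := (contMDiffAt_section (IB := 𝓡 n) x).1 (h (Z a) x)
    exact (ContinuousLinearMap.smulRightL ℝ (EuclideanSpace ℝ (Fin n)) F
        (EuclideanSpace.proj a)).contMDiff.contMDiffAt.comp x this
  refine key.congr_of_eventuallyEq ?_
  have h1 : t.baseSet ∈ 𝓝 x := t.open_baseSet.mem_nhds (mem_baseSet_trivializationAt _ _ x)
  have h2 : t'.baseSet ∈ 𝓝 x := t'.open_baseSet.mem_nhds (mem_baseSet_trivializationAt _ _ x)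
  filter_upwards [hZ, h1, h2] with y hy hy1 hy2
  ext v
  rw [ContinuousLinearMap.inCoordinates_eq hy1 hy2]
  have h3 : (t.continuousLinearEquivAt ℝ y hy1).symm v = ∑ a, v a • Z a y := by
    conv_lhs => rw [← (EuclideanSpace.basisFun (Fin n) ℝ).toBasis.sum_repr v]
    rw [map_sum]
    refine Finset.sum_congr rfl fun a _ => ?_
    rw [map_smul, hy a, Trivialization.localFrame_apply_of_mem_baseSet _ _ hy1,
      Trivialization.basisAt, Module.Basis.map_apply]
    rfl
  have h4 : ∀ w : V y, (t' ⟨y, w⟩).2 = t'.continuousLinearEquivAt ℝ y hy2 w := fun w => by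
    simp
  simp only [ContinuousLinearMap.coe_comp, Function.comp_apply, ContinuousLinearEquiv.coe_coe, h4]
  change t'.continuousLinearEquivAt ℝ y hy2 (η y ((t.continuousLinearEquivAt ℝ y hy1).symm v)) = _
  rw [h3]
  simp

/-- A field of covectors is smooth if its values on smooth vector fields are. -/
lemma contMDiff_oneForm_of_apply (η : (x : M) → TangentSpace (𝓡 n) x →L[ℝ] ℝ)
    (h : ∀ Y : VectorFields n M, ContMDiff (𝓡 n) 𝓘(ℝ, ℝ) ∞ fun x => η x (Y x)) :
    ContMDiff (𝓡 n) ((𝓡 n).prod 𝓘(ℝ, EuclideanSpace ℝ (Fin n) →L[ℝ] ℝ)) ∞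
      (fun x => TotalSpace.mk' (EuclideanSpace ℝ (Fin n) →L[ℝ] ℝ)
        (E := fun x : M => TangentSpace (𝓡 n) x →L[ℝ] Bundle.Trivial M ℝ x) x (η x)) := by
  refine contMDiff_hom_of_apply (V := Bundle.Trivial M ℝ) η fun Y x => ?_
  rw [contMDiffAt_section]
  exact h Y x

end Frames

/-! ### Hadamard's lemma and derivations at a point. -/

section Hadamard

open Filter Topology MeasureTheory

/-- Differentiation under the integral gives a parametric integral of the same kind. Its values lie
in a different space, so the induction on `m` has to run over all targets `G` at once. -/
lemma contDiff_nat_parametric_integral {E : Type} [NormedAddCommGroup E] [NormedSpace ℝ E]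
    [FiniteDimensional ℝ E] (m : ℕ) : ∀ {G : Type} [NormedAddCommGroup G] [NormedSpace ℝ G]
    [CompleteSpace G] {Φ : E × ℝ → G}, ContDiff ℝ ∞ Φ →
    ContDiff ℝ m fun z => ∫ t in (0 : ℝ)..1, Φ (z, t) := by
  have hderiv : ∀ {G : Type} [NormedAddCommGroup G] [NormedSpace ℝ G]
      [CompleteSpace G] {Φ : E × ℝ → G}, ContDiff ℝ ∞ Φ → ∀ z,
      HasFDerivAt (fun z => ∫ t in (0 : ℝ)..1, Φ (z, t))
        (∫ t in (0 : ℝ)..1, fderiv ℝ Φ (z, t) ∘L ContinuousLinearMap.inl ℝ E ℝ) z := by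
    intro G _ _ _ Φ hΦ z
    have hc : Continuous fun p : E × ℝ => fderiv ℝ Φ p ∘L ContinuousLinearMap.inl ℝ E ℝ :=
      (hΦ.continuous_fderiv (by simp)).clm_comp continuous_const
    obtain ⟨C, hC⟩ := ((isCompact_closedBall z 1).prod (isCompact_Icc (a := (0 : ℝ)) (b := 1))
      ).exists_bound_of_continuousOn hc.continuousOn
    refine intervalIntegral.hasFDerivAt_integral_of_dominated_of_fderiv_le
      (F' := fun z t => fderiv ℝ Φ (z, t) ∘L ContinuousLinearMap.inl ℝ E ℝ) (bound := fun _ => C)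
      (Metric.closedBall_mem_nhds z one_pos) ?_ ?_ ?_ ?_ ?_ ?_
    · exact Eventually.of_forall fun y => (hΦ.continuous.comp (by fun_prop)).aestronglyMeasurable
    · exact (hΦ.continuous.comp (by fun_prop : Continuous fun t : ℝ => (z, t))).intervalIntegrable _ _
    · exact (hc.comp (by fun_prop : Continuous fun t : ℝ => (z, t))).aestronglyMeasurable
    · refine Eventually.of_forall fun t ht y hy => hC (y, t) ⟨hy, ?_⟩
      rw [Set.uIoc_of_le zero_le_one] at ht
      exact ⟨ht.1.le, ht.2⟩
    · exact intervalIntegrable_const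
    · refine Eventually.of_forall fun t ht y hy => ?_
      have h1 := ((hΦ.differentiable (by simp)) (y, t)).hasFDerivAt
      exact h1.comp y (hasFDerivAt_prodMk_left y t)
  induction m with
  | zero =>
    intro G _ _ _ Φ hΦ
    rw [Nat.cast_zero, contDiff_zero]
    exact continuous_iff_continuousAt.2 fun z => (hderiv hΦ z).continuousAt
  | succ m ih =>
    intro G _ _ _ Φ hΦ
    rw [Nat.cast_succ, contDiff_succ_iff_hasFDerivAt]
    refine ⟨_, ?_, hderiv hΦ⟩
    exact ih (Φ := fun p => fderiv ℝ Φ p ∘L ContinuousLinearMap.inl ℝ E ℝ)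
      ((hΦ.fderiv_right (m := ∞) (by simp)).clm_comp contDiff_const)

lemma contDiff_parametric_integral {E : Type} [NormedAddCommGroup E] [NormedSpace ℝ E]
    [FiniteDimensional ℝ E] {G : Type} [NormedAddCommGroup G] [NormedSpace ℝ G]
    [CompleteSpace G] {Φ : E × ℝ → G} (hΦ : ContDiff ℝ ∞ Φ) :
    ContDiff ℝ ∞ fun z => ∫ t in (0 : ℝ)..1, Φ (z, t) :=
  contDiff_infty.2 fun m => contDiff_nat_parametric_integral m hΦ

/-- Hadamard's lemma. -/
lemma exists_hadamard_decomposition {n : ℕ} {f : EuclideanSpace ℝ (Fin n) → ℝ}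
    (hf : ContDiff ℝ ∞ f) (x : EuclideanSpace ℝ (Fin n)) :
    ∃ g : Fin n → EuclideanSpace ℝ (Fin n) → ℝ, (∀ a, ContDiff ℝ ∞ (g a)) ∧
      (∀ z, f z = f x + ∑ a, (z a - x a) * g a z) ∧
      ∀ a, g a x = fderiv ℝ f x (EuclideanSpace.single a 1) := by
  -- The factors are the integrals over `[0,1]` of the partial derivatives along the segment from
  -- `x` to `z`.
  have hd := hf.fderiv_right (m := ∞) (by simp)
  refine ⟨fun a z => ∫ t in (0 : ℝ)..1, fderiv ℝ f (x + t • (z - x)) (EuclideanSpace.single a 1),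
    fun a => ?_, fun z => ?_, fun a => ?_⟩
  · refine contDiff_parametric_integral (Φ := fun p : EuclideanSpace ℝ (Fin n) × ℝ =>
      fderiv ℝ f (x + p.2 • (p.1 - x)) (EuclideanSpace.single a 1)) ?_
    refine ContDiff.clm_apply (hd.comp ?_) contDiff_const
    fun_prop
  · have hpath : ∀ t : ℝ, HasDerivAt (fun t : ℝ => f (x + t • (z - x)))
        (fderiv ℝ f (x + t • (z - x)) (z - x)) t := by
      intro t
      have h1 := ((hf.differentiable (by simp)) (x + t • (z - x))).hasFDerivAt
      have h2 : HasDerivAt (fun t : ℝ => x + t • (z - x)) (z - x) t := by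
        simpa using ((hasDerivAt_id t).smul_const (z - x)).const_add x
      exact h1.comp_hasDerivAt t h2
    have hcont : ∀ v, Continuous fun t : ℝ => fderiv ℝ f (x + t • (z - x)) v := fun v =>
      (hd.continuous.comp (by fun_prop)).clm_apply continuous_const
    have h3 := intervalIntegral.integral_eq_sub_of_hasDerivAt (fun t _ => hpath t)
      ((hcont (z - x)).intervalIntegrable 0 1)
    have h4 : z - x = ∑ a, (z a - x a) • EuclideanSpace.single a (1 : ℝ) := by
      conv_lhs => rw [← (EuclideanSpace.basisFun (Fin n) ℝ).toBasis.sum_repr (z - x)]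
      simp
    have h5 : ∀ t : ℝ, fderiv ℝ f (x + t • (z - x)) (z - x) =
        ∑ a, (z a - x a) * fderiv ℝ f (x + t • (z - x)) (EuclideanSpace.single a 1) := by
      intro t
      generalize fderiv ℝ f (x + t • (z - x)) = L
      conv_lhs => rw [h4]
      simp
    simp_rw [h5] at h3
    rw [intervalIntegral.integral_finsetSum] at h3
    · simp only [intervalIntegral.integral_const_mul] at h3
      simp only [one_smul, zero_smul, add_zero, add_sub_cancel] at h3
      simp only [h3]
      ring
    · intro a _
      exact (continuous_const.mul (hcont _)).intervalIntegrable _ _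
  · simp

variable {n : ℕ} {M : Type*} [TopologicalSpace M] [ChartedSpace (EuclideanSpace ℝ (Fin n)) M]
  [IsManifold (𝓡 n) ∞ M] [T2Space M]

/-- A function vanishing to second order is locally a combination of products of functions
vanishing to first order. -/
lemma exists_sum_mul_of_mvfderiv_eq_zero (f : C^∞⟮𝓡 n, M; ℝ⟯) (x : M) (hx : f x = 0)
    (hd : mvfderiv (𝓡 n) f x = 0) :
    ∃ p q : Fin n → C^∞⟮𝓡 n, M; ℝ⟯, (∀ a, p a x = 0) ∧ (∀ a, q a x = 0) ∧
      ∀ᶠ y in 𝓝 x, f y = ∑ a, p a y * q a y := by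
  set φ := extChartAt (𝓡 n) x with hφ
  obtain ⟨ψ⟩ : Nonempty (SmoothBumpFunction (𝓡 n) x) := inferInstance
  have hψ : tsupport ψ.toContDiffBump ⊆ φ.target := by
    rw [ψ.toContDiffBump.tsupport_eq]
    simpa [hφ] using ψ.closedBall_subset
  have hopen : IsOpen φ.target := isOpen_extChartAt_target x
  -- The chart target need not be star-shaped, so `f` is cut off and extended by zero to the whole
  -- Euclidean space before Hadamard's lemma is applied.
  let Fn : EuclideanSpace ℝ (Fin n) → ℝ := fun z => ψ.toContDiffBump z • f (φ.symm z)
  have hF : ContDiff ℝ ∞ Fn := by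
    rw [← contMDiff_iff_contDiff]
    refine contMDiff_of_tsupport fun z hz => ?_
    have hz' : z ∈ φ.target := hψ (tsupport_smul_subset_left _ _ hz)
    refine ψ.toContDiffBump.contDiff.contMDiff.contMDiffAt.smul ?_
    exact f.contMDiff.contMDiffAt.comp z
      ((contMDiffOn_extChartAt_symm x).contMDiffAt (hopen.mem_nhds hz'))
  have hsrc : φ.source ∈ 𝓝 x := extChartAt_source_mem_nhds x
  have hfF : (f : M → ℝ) =ᶠ[𝓝 x] Fn ∘ φ := by
    have : ∀ᶠ y in 𝓝 x, ψ.toContDiffBump (φ y) = 1 :=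
      (continuousAt_extChartAt (I := 𝓡 n) x).eventually ψ.toContDiffBump.eventuallyEq_one
    filter_upwards [hsrc, this] with y hy hy1
    simp only [Fn, Function.comp_apply, hy1, one_smul]
    rw [φ.left_inv hy]
  have hdF : fderiv ℝ Fn (φ x) = 0 := by
    have h1 : HasMFDerivAt (𝓡 n) 𝓘(ℝ, ℝ) f x
        (fderiv ℝ Fn (φ x) ∘L mfderiv (𝓡 n) (𝓡 n) φ x) := by
      refine HasMFDerivAt.congr_of_eventuallyEq (f := Fn ∘ φ) ?_ hfF
      exact HasMFDerivAt.comp (I' := 𝓡 n) x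
        ((hF.differentiable (by simp)) (φ x)).hasFDerivAt.hasMFDerivAt
        (mdifferentiableAt_extChartAt (mem_chart_source _ x)).hasMFDerivAt
    have h2 : fderiv ℝ Fn (φ x) ∘L mfderiv (𝓡 n) (𝓡 n) φ x = 0 := by
      rw [mvfderiv, h1.mfderiv] at hd
      exact hd
    rw [hφ, mfderiv_extChartAt_self] at h2
    exact h2
  obtain ⟨g, hg, hfg, hgx⟩ := exists_hadamard_decomposition hF (φ x)
  have hFx : Fn (φ x) = 0 := by
    rw [← hx]; exact hfF.eq_of_nhds.symm
  have hp : ∀ a : Fin n, ∃ p : C^∞⟮𝓡 n, M; ℝ⟯, ∀ᶠ y in 𝓝 x, p y = φ y a - φ x a := fun a => by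
    refine exists_function_eventuallyEq (f := fun y => φ y a - φ x a)
      (chart_source_mem_nhds (EuclideanSpace ℝ (Fin n)) x) ?_
    exact ((EuclideanSpace.proj a : EuclideanSpace ℝ (Fin n) →L[ℝ] ℝ).contDiff.sub
      contDiff_const).contMDiff.comp_contMDiffOn (contMDiffOn_extChartAt (I := 𝓡 n) (n := ∞) (x := x))
  have hq : ∀ a : Fin n, ∃ q : C^∞⟮𝓡 n, M; ℝ⟯, ∀ᶠ y in 𝓝 x, q y = g a (φ y) := fun a =>
    exists_function_eventuallyEq (chart_source_mem_nhds _ x)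
      ((hg a).contMDiff.comp_contMDiffOn (contMDiffOn_extChartAt (I := 𝓡 n) (n := ∞) (x := x)))
  choose p hp using hp
  choose q hq using hq
  refine ⟨p, q, fun a => ?_, fun a => ?_, ?_⟩
  · simpa using (hp a).self_of_nhds
  · rw [(hq a).self_of_nhds, hgx, hdF]; rfl
  · filter_upwards [hfF, eventually_all.2 hp, eventually_all.2 hq] with y h1 h2 h3
    rw [h1, Function.comp_apply, hfg, hFx, zero_add]
    simp [h2, h3]

/-- A derivation at `x` kills the functions whose differential vanishes at `x`. -/
lemma derivationAt_eq_zero {x : M} (c : C^∞⟮𝓡 n, M; ℝ⟯ →ₗ[ℝ] ℝ)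
    (hc : ∀ f g, c (f * g) = f x * c g + g x * c f) (f : C^∞⟮𝓡 n, M; ℝ⟯)
    (hd : mvfderiv (𝓡 n) f x = 0) : c f = 0 := by
  have h1 : c 1 = 0 := by
    have := hc 1 1
    simp at this
    linarith
  -- A derivation is local: with a bump `χ` supported where `g` vanishes, `0 = c(χ g) = χ(x) c(g) +
  -- g(x) c(χ) = c(g)`.
  have hloc : ∀ g : C^∞⟮𝓡 n, M; ℝ⟯, (∀ᶠ y in 𝓝 x, g y = 0) → c g = 0 := by
    intro g hg
    obtain ⟨χ, hχ, hs⟩ := exists_bump (n := n) hg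
    have h0 : χ * g = 0 := by
      ext y
      by_cases hy : y ∈ tsupport χ
      · have : g y = 0 := hs hy
        simp [this]
      · simp [image_eq_zero_of_notMem_tsupport hy]
    have := hc χ g
    rw [h0, map_zero, hχ.self_of_nhds, hg.self_of_nhds] at this
    linarith
  let f₀ : C^∞⟮𝓡 n, M; ℝ⟯ := f - f x • 1
  have hf₀ : c f = c f₀ := by simp [f₀, h1]
  have hf₀x : f₀ x = 0 := by
    change f x - f x * 1 = 0
    ring
  have hdf₀ : mvfderiv (𝓡 n) f₀ x = 0 := by
    have : mvfderiv (𝓡 n) (fun y => f y - f x * 1) x = 0 := by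
      have h2 := mvfderiv_sub (I := 𝓡 n) (f.mdifferentiableAt (x := x))
        (mdifferentiableAt_const (c := f x * 1))
      rw [mvfderiv_const, hd, sub_zero] at h2
      exact h2
    exact this
  obtain ⟨p, q, hp, hq, hpq⟩ := exists_sum_mul_of_mvfderiv_eq_zero f₀ x hf₀x hdf₀
  have h3 : c (f₀ - ∑ a, p a * q a) = 0 := by
    refine hloc _ ?_
    filter_upwards [hpq] with y hy
    change f₀ y - (∑ a, p a * q a) y = 0
    rw [hy]; simp
  rw [map_sub, map_sum] at h3
  rw [hf₀]
  simpa [hc, hp, hq] using h3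

end Hadamard

/-! ### Polarization of symmetric multilinear maps. -/

section Polarization

variable {V W : Type*} [AddCommGroup V] [Module ℝ V] [AddCommGroup W] [Module ℝ W]

/-- The function `t ↦ T(tw + v, …, tw + v)` is a polynomial in `t` which vanishes identically. By
symmetry its linear coefficient is `k + 1` times the value in question. -/
lemma MultilinearMap.cons_eq_zero_of_diag {k : ℕ}
    (T : MultilinearMap ℝ (fun _ : Fin (k + 1) => V) ℝ)
    (hs : ∀ (σ : Equiv.Perm (Fin (k + 1))) v, T (v ∘ σ) = T v) (hd : ∀ v, T (fun _ => v) = 0)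
    (w v : V) : T (Fin.cons w fun _ => v) = 0 := by
  classical
  let c : Finset (Fin (k + 1)) → ℝ := fun s => T (s.piecewise (fun _ => w) fun _ => v)
  let p : Polynomial ℝ := ∑ s : Finset (Fin (k + 1)), Polynomial.C (c s) * Polynomial.X ^ s.card
  have hp : p = 0 := by
    refine Polynomial.funext fun t => ?_
    have h1 : T ((fun _ => t • w) + fun _ => v) = 0 := hd (t • w + v)
    rw [T.map_add_univ] at h1
    rw [Polynomial.eval_zero, ← h1, Polynomial.eval_finsetSum]
    refine Finset.sum_congr rfl fun s _ => ?_
    have h2 := T.map_piecewise_smul (fun _ => t) (s.piecewise (fun _ => w) fun _ => v) s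
    have h3 : (s.piecewise (fun i => t • s.piecewise (fun _ => w) (fun _ => v) i)
        (s.piecewise (fun _ => w) fun _ => v) : Fin (k + 1) → V) =
        s.piecewise (fun _ => t • w) fun _ => v := by
      ext i
      by_cases hi : i ∈ s <;> simp [hi]
    rw [h3] at h2
    rw [h2]
    simp only [c, Polynomial.eval_mul, Polynomial.eval_C, Polynomial.eval_pow, Polynomial.eval_X,
      Finset.prod_const, smul_eq_mul]
    ring
  have h1 : p.coeff 1 = ∑ i : Fin (k + 1), c {i} := by
    simp only [p, Polynomial.finsetSum_coeff, Polynomial.coeff_C_mul, Polynomial.coeff_X_pow]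
    simp only [mul_ite, mul_one, mul_zero]
    rw [← Finset.sum_filter]
    refine (Finset.sum_nbij (fun i => {i}) ?_ ?_ ?_ ?_).symm
    · simp
    · intro i _ j _ h; simpa using h
    · intro s hs
      obtain ⟨i, rfl⟩ := Finset.card_eq_one.1 (by simpa using hs : 1 = s.card).symm
      exact ⟨i, by simp⟩
    · simp
  have h2 : ∀ i, c {i} = T (Fin.cons w fun _ => v) := by
    intro i
    rw [← hs (Equiv.swap 0 i)]
    simp only [c]
    congr 1
    ext j
    by_cases hj : j = i
    · subst hj; simp
    · have : Equiv.swap 0 i j ≠ 0 := by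
        intro h
        apply hj
        rw [Equiv.swap_apply_eq_iff, Equiv.swap_apply_left] at h
        exact h
      obtain ⟨l, hl⟩ := Fin.exists_succ_eq.2 this
      simp [hj, ← hl]
  rw [hp, Polynomial.coeff_zero] at h1
  simp_rw [h2] at h1
  simp at h1
  exact h1.resolve_left (by positivity)

/-- Freezing the first argument gives a symmetric form in one variable fewer, which vanishes on the
diagonal by the preceding lemma; then induction on `k`. -/
lemma MultilinearMap.eq_zero_of_diag_real {k : ℕ} : ∀ (T : MultilinearMap ℝ (fun _ : Fin k => V) ℝ),
    (∀ (σ : Equiv.Perm (Fin k)) v, T (v ∘ σ) = T v) → (∀ v, T (fun _ => v) = 0) → T = 0 := by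
  induction k with
  | zero =>
    intro T _ hd
    ext v
    rw [Subsingleton.elim v fun _ => 0]
    exact hd 0
  | succ k ih =>
    intro T hs hd
    ext m
    have := ih (T.curryLeft (m 0)) (fun σ v => ?_) (fun v => T.cons_eq_zero_of_diag hs hd _ v)
    · have h2 := congrArg (fun T => T (Fin.tail m)) this
      simpa using h2
    · simp only [MultilinearMap.curryLeft_apply]
      -- A permutation of the remaining arguments, extended by fixing the index `0`.
      rw [← hs (Equiv.Perm.decomposeFin.symm (0, σ)) (Fin.cons (m 0) v)]
      congr 1
      ext j
      refine Fin.cases ?_ (fun j => ?_) j <;> simp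

/-- A symmetric multilinear map is determined by its values on the diagonal. -/
lemma MultilinearMap.eq_of_diag {k : ℕ} (T T' : MultilinearMap ℝ (fun _ : Fin k => V) W)
    (hs : ∀ (σ : Equiv.Perm (Fin k)) v, T (v ∘ σ) = T v)
    (hs' : ∀ (σ : Equiv.Perm (Fin k)) v, T' (v ∘ σ) = T' v)
    (hd : ∀ v, T (fun _ => v) = T' (fun _ => v)) : T = T' := by
  ext v
  rw [← sub_eq_zero, ← Module.forall_dual_apply_eq_zero_iff ℝ]
  intro φ
  have := MultilinearMap.eq_zero_of_diag_real (φ.compMultilinearMap (T - T'))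
    (fun σ v => by simp [hs, hs']) (fun v => by simp [hd])
  simpa using congrArg (fun T => T v) this

/-- The infinitesimal action of a linear operator on a multilinear form. -/
lemma MultilinearMap.exists_sum_update {k : ℕ} {V : Type*} [AddCommGroup V] [Module ℝ V]
    (T : MultilinearMap ℝ (fun _ : Fin k => V) ℝ) (B : V →ₗ[ℝ] V) :
    ∃ T' : MultilinearMap ℝ (fun _ : Fin k => V) ℝ,
      ∀ w, T' w = ∑ m, T (Function.update w m (B (w m))) := by
  refine ⟨∑ m, T.compLinearMap (Function.update (fun _ => LinearMap.id) m B), fun w => ?_⟩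
  simp only [sum_apply, MultilinearMap.compLinearMap_apply]
  refine Finset.sum_congr rfl fun m _ => congrArg _ (funext fun j => ?_)
  by_cases h : j = m
  · subst h; simp
  · simp [h]

end Polarization

/-! ### Iterated commutators with multiplication operators. -/

section Commutators

variable {R S : Type*} [CommRing R] [Algebra ℝ R] [AddCommGroup S] [Module ℝ S] [Module R S]
  [IsScalarTower ℝ R S] [SMulCommClass R ℝ S]

/-- The commutator `[B, f]` of an operator with a multiplication operator. -/
def adEnd : R →ₗ[ℝ] Module.End ℝ S →ₗ[ℝ] Module.End ℝ S :=
  ((LinearMap.mul ℝ (Module.End ℝ S)).flip - LinearMap.mul ℝ (Module.End ℝ S)) ∘ₗ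
    (Algebra.lsmul ℝ ℝ S : R →ₐ[ℝ] Module.End ℝ S).toLinearMap

@[simp] lemma adEnd_apply (f : R) (B : Module.End ℝ S) (s : S) :
    adEnd f B s = B (f • s) - f • B s := rfl

lemma adEnd_comm (f g : R) (B : Module.End ℝ S) :
    adEnd f (adEnd g B) = adEnd g (adEnd f B) := by
  ext s
  simp only [adEnd_apply, smul_sub, smul_smul, mul_comm f g]
  abel

/-- The iterated commutator, as a multilinear map. -/
def commMap : (j : ℕ) →
    Module.End ℝ S →ₗ[ℝ] MultilinearMap ℝ (fun _ : Fin j => R) (Module.End ℝ S)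
  | 0 => (MultilinearMap.constLinearEquivOfIsEmpty ℝ ℝ (fun _ : Fin 0 => R) _).toLinearMap
  | j + 1 =>
    { toFun := fun B => (multilinearCurryLeftEquiv ℝ (fun _ : Fin (j + 1) => R) _).symm
        (commMap j ∘ₗ adEnd.flip B)
      map_add' := fun B B' => by rw [map_add, LinearMap.comp_add, map_add]
      map_smul' := fun c B => by rw [map_smul, LinearMap.comp_smul, map_smul]; rfl }

@[simp] lemma commMap_zero (B : Module.End ℝ S) (f : Fin 0 → R) : commMap 0 B f = B := rfl

lemma commMap_succ (j : ℕ) (B : Module.End ℝ S) (f : Fin (j + 1) → R) :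
    commMap (j + 1) B f = commMap j (adEnd (f 0) B) (Fin.tail f) := rfl

lemma commMap_eq_foldl (j : ℕ) (B : Module.End ℝ S) (f : Fin j → R) :
    commMap j B f = (List.ofFn f).foldl (fun B g => adEnd g B) B := by
  induction j generalizing B with
  | zero => simp
  | succ j ih => rw [commMap_succ, ih, List.ofFn_succ, List.foldl_cons]; rfl

/-- The operators `ad f` commute because `R` is commutative. This is the source of the symmetry of
symbols. -/
lemma commMap_comp_perm (j : ℕ) (B : Module.End ℝ S) (f : Fin j → R) (σ : Equiv.Perm (Fin j)) :
    commMap j B (f ∘ σ) = commMap j B f := by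
  have : RightCommutative fun (B : Module.End ℝ S) (g : R) => adEnd g B :=
    ⟨fun B f g => adEnd_comm g f B⟩
  rw [commMap_eq_foldl, commMap_eq_foldl]
  exact (Equiv.Perm.ofFn_comp_perm σ f).foldl_eq B

lemma commMap_adEnd (j : ℕ) (B : Module.End ℝ S) (g : R) (f : Fin j → R) :
    commMap j (adEnd g B) f = adEnd g (commMap j B f) := by
  induction j generalizing B with
  | zero => rfl
  | succ j ih => rw [commMap_succ, commMap_succ, adEnd_comm, ih]

lemma commMap_cons (j : ℕ) (B : Module.End ℝ S) (g : R) (f : Fin j → R) :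
    commMap (j + 1) B (Fin.cons g f) = adEnd g (commMap j B f) := by
  rw [commMap_succ, Fin.cons_zero, Fin.tail_cons, commMap_adEnd]

/-- One more commutator being zero says precisely that the `j`-fold commutator commutes with
functions. -/
lemma commMap_smul_of_succ_eq_zero {j : ℕ} {B : Module.End ℝ S}
    (hB : commMap (R := R) (j + 1) B = 0) (f : Fin j → R) (g : R) (s : S) :
    commMap j B f (g • s) = g • commMap j B f s := by
  have := congrArg (fun T => T (Fin.cons g f) s) hB
  simp only [commMap_cons, adEnd_apply, zero_apply, LinearMap.zero_apply] at this
  exact sub_eq_zero.1 this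

/-- For any operator `T`, `[T, g g'] = g [T, g'] + [T, g] g'`. Here `[T, g]` is a top commutator, so
the last factor `g'` may be moved to the left, and the commutator becomes a derivation in this
argument. -/
lemma commMap_cons_mul_of_succ_eq_zero {j : ℕ} {B : Module.End ℝ S}
    (hB : commMap (R := R) (j + 2) B = 0) (f : Fin j → R) (g g' : R) (s : S) :
    commMap (j + 1) B (Fin.cons (g * g') f) s =
      g • commMap (j + 1) B (Fin.cons g' f) s + g' • commMap (j + 1) B (Fin.cons g f) s := by
  have := commMap_smul_of_succ_eq_zero hB (Fin.cons g f) g' s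
  rw [← this]
  simp only [commMap_cons, adEnd_apply, smul_smul, smul_sub, mul_comm g g']
  abel

/-- All iterated commutators vanish if the diagonal ones do. -/
lemma commMap_eq_of_diag {j : ℕ} {B B' : Module.End ℝ S}
    (h : ∀ f : R, commMap j B (fun _ => f) = commMap j B' (fun _ => f)) :
    commMap (R := R) j B = commMap j B' :=
  MultilinearMap.eq_of_diag _ _ (fun σ v => commMap_comp_perm j B v σ)
    (fun σ v => commMap_comp_perm j B' v σ) h

lemma commMap_diag_succ (j : ℕ) (B : Module.End ℝ S) (f : R) (s : S) :
    commMap (j + 1) B (fun _ => f) s =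
      commMap j B (fun _ => f) (f • s) - f • commMap j B (fun _ => f) s := by
  have h : (fun _ : Fin (j + 1) => f) = Fin.cons f fun _ => f := by
    ext i; refine Fin.cases rfl (fun _ => rfl) i
  rw [h, commMap_cons, adEnd_apply]

/-- A multilinear map vanishing whenever one argument is in the kernel of `q` only depends on the
images of the arguments under `q`. -/
lemma MultilinearMap.eq_of_forall_map_eq {k : ℕ} {N : Type*} [AddCommGroup N] [Module ℝ N]
    (T : MultilinearMap ℝ (fun _ : Fin k => R) ℝ) (q : R →ₗ[ℝ] N)
    (h : ∀ m i r, q r = 0 → T (Function.update m i r) = 0) (m m' : Fin k → R)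
    (hm : ∀ i, q (m i) = q (m' i)) : T m = T m' := by
  classical
  have key : ∀ s : Finset (Fin k), T (s.piecewise m' m) = T m := by
    intro s
    induction s using Finset.induction_on with
    | empty => simp
    | insert i s his ih =>
      rw [Finset.piecewise_insert, ← sub_eq_zero, ← ih]
      have h1 : s.piecewise m' m = Function.update (s.piecewise m' m) i (m i) := by
        rw [eq_comm, Function.update_eq_self_iff]
        simp [his]
      conv_lhs => rw [h1]
      rw [Function.update_idem, ← T.map_update_sub]
      exact h _ _ _ (by simp [hm i])
  have := key Finset.univ
  rw [Finset.piecewise_univ] at this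
  exact this.symm

end Commutators

/-! ### The differential as a surjective linear map at a point. -/

section Differential

open Filter Topology

variable {n : ℕ} {M : Type*} [TopologicalSpace M] [ChartedSpace (EuclideanSpace ℝ (Fin n)) M]

/-- The differential at a point. -/
def diffAt (x : M) : C^∞⟮𝓡 n, M; ℝ⟯ →ₗ[ℝ] Cotangent n x where
  toFun f := mvfderiv (𝓡 n) f x
  map_add' f g := mvfderiv_add f.mdifferentiableAt g.mdifferentiableAt
  map_smul' c f := by
    have h := mvfderiv_mul (I := 𝓡 n) (mdifferentiableAt_const (c := c) (x := x))
      (f.mdifferentiableAt (x := x))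
    rw [mvfderiv_const, smul_zero, add_zero] at h
    exact h

@[simp] lemma diffAt_apply (x : M) (f : C^∞⟮𝓡 n, M; ℝ⟯) : diffAt x f = mvfderiv (𝓡 n) f x := rfl

lemma mvfderiv_fn_mul (f g : C^∞⟮𝓡 n, M; ℝ⟯) (x : M) :
    mvfderiv (𝓡 n) (f * g : C^∞⟮𝓡 n, M; ℝ⟯) x =
      f x • mvfderiv (𝓡 n) g x + g x • mvfderiv (𝓡 n) f x :=
  mvfderiv_mul f.mdifferentiableAt g.mdifferentiableAt

/-- Evaluation of covectors. -/
def evalCotangent {x : M} (v : TangentSpace (𝓡 n) x) : Cotangent n x →ₗ[ℝ] ℝ where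
  toFun α := α v
  map_add' _ _ := rfl
  map_smul' _ _ := rfl

lemma exists_diffAt_rightInverse [IsManifold (𝓡 n) ∞ M] [T2Space M] (x : M) :
    ∃ L : Cotangent n x →ₗ[ℝ] C^∞⟮𝓡 n, M; ℝ⟯, ∀ α, mvfderiv (𝓡 n) (L α) x = α := by
  obtain ⟨f, Z, hfZ⟩ := exists_isDualFrame (n := n) x
  have h := hfZ.self_of_nhds
  refine ⟨∑ a, LinearMap.smulRight (evalCotangent (Z a x)) (f a), fun α => ?_⟩
  rw [← diffAt_apply, LinearMap.sum_apply, map_sum]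
  simp only [LinearMap.smulRight_apply, map_smul]
  exact (h.sum_smul_dual α).symm

end Differential

/-! ### Existence, symmetry and smoothness of symbols. -/

section Symbols

open Filter Topology

variable {n : ℕ} {M : Type*} [TopologicalSpace M] [ChartedSpace (EuclideanSpace ℝ (Fin n)) M]
  {ξ : M → Type*} [TopologicalSpace (TotalSpace ℝ ξ)]
  [∀ x, AddCommGroup (ξ x)] [∀ x, Module ℝ (ξ x)] [∀ x, TopologicalSpace (ξ x)]
  [FiberBundle ℝ ξ] [VectorBundle ℝ ℝ ξ]

instance : IsScalarTower ℝ C^∞⟮𝓡 n, M; ℝ⟯ (Sections n ξ) :=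
  ⟨fun c f s => by ext x; exact mul_smul c (f x) (s x)⟩

instance : SMulCommClass C^∞⟮𝓡 n, M; ℝ⟯ ℝ (Sections n ξ) :=
  ⟨fun f c s => by ext x; exact smul_comm (f x) c (s x)⟩

lemma iterCommutator_eq_commMap (j : ℕ) (B : Module.End ℝ (Sections n ξ))
    (f : Fin j → C^∞⟮𝓡 n, M; ℝ⟯) (h : Sections n ξ) (x : M) :
    iterCommutator j (fun s => B s) f h x = commMap j B f h x := by
  induction j generalizing B with
  | zero => rfl
  | succ j ih => exact ih (adEnd (f 0) B) (Fin.tail f)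

lemma isDiffOp_iff (k : ℕ) (A : Sections n ξ →ₗ[ℝ] Sections n ξ) :
    IsDiffOp k A ↔ commMap (R := C^∞⟮𝓡 n, M; ℝ⟯) (k + 1) A = 0 := by
  simp only [IsDiffOp, iterCommutator_eq_commMap]
  refine ⟨fun h => ?_, fun h f s x => by rw [h]; rfl⟩
  ext f s x
  exact h f s x

lemma exists_fiber_eq_smul {x : M} {v : ξ x} (hv : v ≠ 0) (w : ξ x) : ∃ c : ℝ, w = c • v := by
  let e := (trivializationAt ℝ ξ x).linearEquivAt ℝ x (FiberBundle.mem_baseSet_trivializationAt' x)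
  have h : e v ≠ 0 := by rwa [Ne, LinearEquiv.map_eq_zero_iff]
  refine ⟨e w / e v, e.injective ?_⟩
  rw [map_smul, smul_eq_mul, div_mul_cancel₀ _ h]

/-- A function which multiplies a nonvanishing smooth section to a smooth section is smooth. -/
lemma contMDiffAt_of_smul_section {x : M} {u : M → ℝ} {e s : Π x, ξ x}
    (he : ContMDiffAt (𝓡 n) ((𝓡 n).prod 𝓘(ℝ, ℝ)) ∞ (fun y => TotalSpace.mk' ℝ y (e y)) x)
    (hs : ContMDiffAt (𝓡 n) ((𝓡 n).prod 𝓘(ℝ, ℝ)) ∞ (fun y => TotalSpace.mk' ℝ y (s y)) x)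
    (hex : e x ≠ 0) (h : ∀ᶠ y in 𝓝 x, s y = u y • e y) :
    ContMDiffAt (𝓡 n) 𝓘(ℝ, ℝ) ∞ u x := by
  rw [contMDiffAt_section] at he hs
  set t := trivializationAt ℝ ξ x
  have hx : x ∈ t.baseSet := FiberBundle.mem_baseSet_trivializationAt' x
  have hne : (t ⟨x, e x⟩).2 ≠ 0 := by
    change t.linearEquivAt ℝ x hx (e x) ≠ 0
    rwa [Ne, LinearEquiv.map_eq_zero_iff]
  refine (hs.div₀ he hne).congr_of_eventuallyEq ?_
  filter_upwards [h, t.open_baseSet.mem_nhds hx, he.continuousAt.eventually_ne hne] with y hy hyt hy0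
  have : (t ⟨y, s y⟩).2 = u y * (t ⟨y, e y⟩).2 := by
    change t.linearEquivAt ℝ y hyt (s y) = u y * t.linearEquivAt ℝ y hyt (e y)
    rw [hy, map_smul, smul_eq_mul]
  change u y = (t ⟨y, s y⟩).2 / (t ⟨y, e y⟩).2
  rw [this, mul_div_cancel_right₀ _ hy0]

variable [IsManifold (𝓡 n) ∞ M] [T2Space M] [ContMDiffVectorBundle ∞ ℝ ξ (𝓡 n)]

lemma exists_section_ne_zero (x : M) :
    ∃ (e : Sections n ξ) (f : C^∞⟮𝓡 n, M; ℝ⟯), (∀ᶠ y in 𝓝 x, f y = 1) ∧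
      (∀ᶠ y in 𝓝 x, e y ≠ 0) ∧ ∀ s : Sections n ξ, ∃ g : C^∞⟮𝓡 n, M; ℝ⟯, f • s = g • e := by
  obtain ⟨Z, f, h1, h2, h3⟩ := exists_section_frame (n := n) (V := ξ) x
    (Module.Basis.singleton Unit ℝ)
  refine ⟨Z (), f, h1, ?_, fun s => ?_⟩
  · have hx := (trivializationAt ℝ ξ x).open_baseSet.mem_nhds
      (FiberBundle.mem_baseSet_trivializationAt' x)
    filter_upwards [h2, hx] with y hy hyt
    rw [hy, Trivialization.localFrame_apply_of_mem_baseSet _ _ hyt]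
    exact Module.Basis.ne_zero _ _
  · obtain ⟨g, hg⟩ := h3 s
    exact ⟨g (), by simpa using hg⟩

/-- An operator commuting with functions acts pointwise. -/
lemma apply_eq_smul_of_commute (E : Module.End ℝ (Sections n ξ))
    (hE : ∀ (g : C^∞⟮𝓡 n, M; ℝ⟯) (s : Sections n ξ), E (g • s) = g • E s) {x : M}
    {e s : Sections n ξ} {c : ℝ} (he : e x ≠ 0) (hc : E e x = c • e x) : E s x = c • s x := by
  obtain ⟨e', f, hf, he', hg⟩ := exists_section_ne_zero (n := n) (ξ := ξ) x
  have hf' := hf.self_of_nhds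
  have key : ∀ s : Sections n ξ, ∃ a : ℝ, s x = a • e' x ∧ E s x = a • E e' x := by
    intro s
    obtain ⟨g, hg⟩ := hg s
    have h1 := congrArg (fun t => t x) hg
    have h2 := congrArg (fun t => E t x) hg
    simp only [hE, ContMDiffSection.fn_smul_apply, hf', one_smul] at h1 h2
    exact ⟨g x, h1, h2⟩
  obtain ⟨a, h1, h2⟩ := key e
  obtain ⟨b, h3, h4⟩ := key s
  have ha : a ≠ 0 := by rintro rfl; simp [h1] at he
  have h5 : E e' x = c • e' x := by
    rw [h2, h1, smul_comm c a] at hc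
    exact smul_right_injective _ ha hc
  rw [h4, h3, h5, smul_comm]

/-- At each point the top commutator acts on the one-dimensional fibre by a scalar `c(f)`,
multilinear and symmetric in `f`. It is a derivation in each slot, hence only depends on the
differentials at the point. -/
theorem exists_isSymbolOf (j : ℕ) (B : Module.End ℝ (Sections n ξ))
    (hB : commMap (R := C^∞⟮𝓡 n, M; ℝ⟯) (j + 1) B = 0) :
    ∃ σ : TensorField n M j, IsSymbolOf j (fun s => B s) σ := by
  have key : ∀ x : M, ∃ τ : MultilinearMap ℝ (fun _ : Fin j => Cotangent n x) ℝ,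
      ∀ (f : Fin j → C^∞⟮𝓡 n, M; ℝ⟯) (h : Sections n ξ), commMap j B f h x =
        ((j.factorial : ℝ) * τ (fun i => mvfderiv (𝓡 n) (f i) x)) • h x := by
    intro x
    obtain ⟨e, -, -, he, -⟩ := exists_section_ne_zero (n := n) (ξ := ξ) x
    have he' := he.self_of_nhds
    have hfin : Module.finrank ℝ (ξ x) = 1 := by
      let e := (trivializationAt ℝ ξ x).linearEquivAt ℝ x
        (FiberBundle.mem_baseSet_trivializationAt' x)
      rw [e.finrank_eq, Module.finrank_self]
    obtain ⟨φ, hφ⟩ : ∃ φ : Module.Dual ℝ (ξ x), φ (e x) = 1 := by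
      obtain ⟨φ, hφ⟩ : ∃ φ : Module.Dual ℝ (ξ x), φ (e x) ≠ 0 := by
        by_contra! h
        exact he' ((Module.forall_dual_apply_eq_zero_iff ℝ _).1 h)
      exact ⟨(φ (e x))⁻¹ • φ, by simp [hφ]⟩
    let ev : Module.End ℝ (Sections n ξ) →ₗ[ℝ] ℝ :=
      { toFun := fun E => φ (E e x)
        map_add' := fun E E' => by simp
        map_smul' := fun c E => by
          change φ (c • E e x) = c • φ (E e x)
          rw [map_smul] }
    let c : MultilinearMap ℝ (fun _ : Fin j => C^∞⟮𝓡 n, M; ℝ⟯) ℝ :=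
      ev.compMultilinearMap (commMap j B)
    have hcE : ∀ f h, commMap j B f h x = c f • h x := by
      intro f h
      refine apply_eq_smul_of_commute (commMap j B f)
        (fun g s => commMap_smul_of_succ_eq_zero hB f g s) he' ?_
      obtain ⟨a, ha⟩ := exists_fiber_eq_smul he' (commMap j B f e x)
      have : c f = a := by
        change φ (commMap j B f e x) = a
        rw [ha, map_smul, hφ, smul_eq_mul, mul_one]
      rw [this, ha]
    obtain ⟨L, hL⟩ := exists_diffAt_rightInverse (n := n) x
    -- The value on covectors is obtained by lifting them to functions with `L`; the choice of lifts
    -- is immaterial.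
    refine ⟨(j.factorial : ℝ)⁻¹ • c.compLinearMap fun _ => L, fun f h => ?_⟩
    rw [hcE]
    congr 1
    rw [smul_apply, MultilinearMap.compLinearMap_apply, smul_eq_mul,
      mul_inv_cancel_left₀ (by positivity)]
    refine c.eq_of_forall_map_eq (diffAt x) ?_ _ _ fun i => by simp [hL]
    intro m i r hr
    rcases j with _ | j
    · exact i.elim0
    -- Symmetry moves the argument `r` to the first slot, where the derivation property is
    -- available.
    have hsym : c (Function.update m i r) =
        c (Fin.cons r (Fin.tail (Function.update m i r ∘ Equiv.swap 0 i))) := by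
      have h1 : c (Function.update m i r ∘ Equiv.swap 0 i) = c (Function.update m i r) :=
        congrArg ev (commMap_comp_perm _ B _ _)
      rw [← h1]
      congr 1
      conv_lhs => rw [← Fin.cons_self_tail (Function.update m i r ∘ Equiv.swap 0 i)]
      simp
    rw [hsym]
    generalize Fin.tail (Function.update m i r ∘ Equiv.swap 0 i) = m'
    let c' : C^∞⟮𝓡 n, M; ℝ⟯ →ₗ[ℝ] ℝ :=
      { toFun := fun g => c (Fin.cons g m')
        map_add' := fun g g' => c.cons_add m' g g'
        map_smul' := fun a g => c.cons_smul m' a g }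
    refine derivationAt_eq_zero c' (fun f g => ?_) r hr
    have h1 := congrArg (fun s => φ (s x)) (commMap_cons_mul_of_succ_eq_zero hB m' f g e)
    simp only [ContMDiffSection.fn_smul_apply, ContMDiffSection.add_apply', map_add, map_smul,
      smul_eq_mul] at h1
    exact h1
  choose σ hσ using key
  exact ⟨σ, fun f h x => by rw [iterCommutator_eq_commMap]; exact hσ x f h⟩

/-- The choice made in `smbl` is meaningful only when a symbol exists; this is where existence
enters. -/
lemma smbl_spec (j : ℕ) (B : Module.End ℝ (Sections n ξ))
    (hB : commMap (R := C^∞⟮𝓡 n, M; ℝ⟯) (j + 1) B = 0) :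
    IsSymbolOf j (fun s => B s) (smbl j fun s => B s) :=
  Classical.epsilon_spec (exists_isSymbolOf j B hB)

lemma IsSymbolOf.comp_perm {j : ℕ} {B : Module.End ℝ (Sections n ξ)} {σ : TensorField n M j}
    (h : IsSymbolOf j (fun s => B s) σ) (x : M) (τ : Equiv.Perm (Fin j))
    (α : Fin j → Cotangent n x) : σ x (α ∘ τ) = σ x α := by
  obtain ⟨L, hL⟩ := exists_diffAt_rightInverse (n := n) x
  obtain ⟨e, -, -, he, -⟩ := exists_section_ne_zero (n := n) (ξ := ξ) x
  have h1 := h ((fun i => L (α i)) ∘ τ) e x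
  have h2 := h (fun i => L (α i)) e x
  rw [iterCommutator_eq_commMap] at h1 h2
  rw [commMap_comp_perm, h2] at h1
  have h3 := smul_left_injective ℝ he.self_of_nhds h1
  simp only [hL, Function.comp_apply] at h3
  exact (mul_left_cancel₀ (by positivity) h3).symm

lemma IsSymbolOf.contMDiff {j : ℕ} {B : Module.End ℝ (Sections n ξ)} {σ : TensorField n M j}
    (h : IsSymbolOf j (fun s => B s) σ) (f : Fin j → C^∞⟮𝓡 n, M; ℝ⟯) :
    ContMDiff (𝓡 n) 𝓘(ℝ, ℝ) ∞ fun y => σ y fun i => mvfderiv (𝓡 n) (f i) y := by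
  intro x
  obtain ⟨e, -, -, he, -⟩ := exists_section_ne_zero (n := n) (ξ := ξ) x
  have h1 : ContMDiffAt (𝓡 n) 𝓘(ℝ, ℝ) ∞
      (fun y => (j.factorial : ℝ) * σ y fun i => mvfderiv (𝓡 n) (f i) y) x :=
    contMDiffAt_of_smul_section (e.contMDiff x) ((commMap j B f e).contMDiff x) he.self_of_nhds
      (.of_forall fun y => by rw [← iterCommutator_eq_commMap]; exact h f e y)
  have h2 : ContMDiffAt (𝓡 n) 𝓘(ℝ, ℝ) ∞ (fun y => (j.factorial : ℝ)⁻¹ *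
      ((j.factorial : ℝ) * σ y fun i => mvfderiv (𝓡 n) (f i) y)) x := contMDiffAt_const.mul h1
  refine h2.congr_of_eventuallyEq (.of_forall fun y => ?_)
  simp [Nat.factorial_ne_zero]

end Symbols

/-! ### Algebraic connections, symmetrized derivatives and their commutators. -/

section Koszul

variable {R 𝔛 S : Type*} [CommRing R] [AddCommGroup 𝔛] [Module R 𝔛] [AddCommGroup S] [Module R S]

variable (S) in
/-- A connection in the module `S`, for the action `δ` of `𝔛` on the ring `R`. -/
structure KoszulConnection (δ : 𝔛 → R → R) where
  /-- The covariant derivative. -/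
  toHom : 𝔛 →ₗ[R] S →+ S
  leibniz : ∀ X f s, toHom X (f • s) = f • toHom X s + δ X f • s

namespace KoszulConnection

variable {δ : 𝔛 → R → R}

/-- The extra term at `j = i` is the one that cancels the Leibniz term of `D` in `covDeriv`, which
makes the covariant derivative of a multilinear map multilinear again. -/
lemma map_update_smul {𝔜 : Type*} [AddCommGroup 𝔜] [Module R 𝔜] (W : KoszulConnection 𝔜 δ) {k : ℕ}
    (Ω : MultilinearMap R (fun _ : Fin k => 𝔜) S) (X : 𝔛) (Y : Fin k → 𝔜) (i j : Fin k) (c : R)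
    (y : 𝔜) :
    Ω (Function.update (Function.update Y i (c • y)) j
        (W.toHom X (Function.update Y i (c • y) j))) =
      c • Ω (Function.update (Function.update Y i y) j (W.toHom X (Function.update Y i y j))) +
        if j = i then δ X c • Ω (Function.update Y i y) else 0 := by
  by_cases h : j = i
  · subst h
    simp [W.leibniz, MultilinearMap.map_update_add, MultilinearMap.map_update_smul]
  · simp only [Function.update_of_ne h, if_neg h, add_zero]
    rw [Function.update_comm (Ne.symm h), Function.update_comm (Ne.symm h),
      MultilinearMap.map_update_smul]

lemma map_update_add {𝔜 : Type*} [AddCommGroup 𝔜] [Module R 𝔜] (W : KoszulConnection 𝔜 δ) {k : ℕ}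
    (Ω : MultilinearMap R (fun _ : Fin k => 𝔜) S) (X : 𝔛) (Y : Fin k → 𝔜) (i j : Fin k)
    (y z : 𝔜) :
    Ω (Function.update (Function.update Y i (y + z)) j
        (W.toHom X (Function.update Y i (y + z) j))) =
      Ω (Function.update (Function.update Y i y) j (W.toHom X (Function.update Y i y j))) +
      Ω (Function.update (Function.update Y i z) j (W.toHom X (Function.update Y i z j))) := by
  by_cases h : j = i
  · subst h
    simp [MultilinearMap.map_update_add]
  · simp only [Function.update_of_ne h]
    rw [Function.update_comm (Ne.symm h), Function.update_comm (Ne.symm h),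
      Function.update_comm (Ne.symm h), MultilinearMap.map_update_add]

/-- The covariant derivative of a multilinear map, for connections in its source and target. -/
def covDeriv {𝔜 : Type*} [AddCommGroup 𝔜] [Module R 𝔜] (W : KoszulConnection 𝔜 δ)
    (D : KoszulConnection S δ) {k : ℕ} (Ω : MultilinearMap R (fun _ : Fin k => 𝔜) S) :
    𝔛 →ₗ[R] MultilinearMap R (fun _ : Fin k => 𝔜) S where
  toFun X := MultilinearMap.mk' (fun Y => D.toHom X (Ω Y) -
      ∑ j, Ω (Function.update Y j (W.toHom X (Y j))))
    (fun Y i y z => by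
      simp only [W.map_update_add, MultilinearMap.map_update_add, map_add, Finset.sum_add_distrib]
      abel)
    (fun Y i c y => by
      simp only [W.map_update_smul, MultilinearMap.map_update_smul, D.leibniz,
        Finset.sum_add_distrib, Finset.sum_ite_eq', Finset.mem_univ, if_true, smul_sub,
        Finset.smul_sum]
      abel)
  map_add' X X' := by
    ext Y
    change D.toHom (X + X') (Ω Y) - ∑ j, Ω (Function.update Y j (W.toHom (X + X') (Y j))) =
      (D.toHom X (Ω Y) - ∑ j, Ω (Function.update Y j (W.toHom X (Y j)))) +
      (D.toHom X' (Ω Y) - ∑ j, Ω (Function.update Y j (W.toHom X' (Y j))))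
    simp only [map_add, AddMonoidHom.add_apply,
      MultilinearMap.map_update_add, Finset.sum_add_distrib]
    abel
  map_smul' c X := by
    ext Y
    change D.toHom (c • X) (Ω Y) - ∑ j, Ω (Function.update Y j (W.toHom (c • X) (Y j))) =
      c • (D.toHom X (Ω Y) - ∑ j, Ω (Function.update Y j (W.toHom X (Y j))))
    simp only [map_smul, AddMonoidHom.smul_apply,
      MultilinearMap.map_update_smul, smul_sub, Finset.smul_sum]

lemma covDeriv_apply {𝔜 : Type*} [AddCommGroup 𝔜] [Module R 𝔜] (W : KoszulConnection 𝔜 δ)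
    (D : KoszulConnection S δ) {k : ℕ} (Ω : MultilinearMap R (fun _ : Fin k => 𝔜) S) (X : 𝔛)
    (Y : Fin k → 𝔜) : W.covDeriv D Ω X Y = D.toHom X (Ω Y) -
      ∑ j, Ω (Function.update Y j (W.toHom X (Y j))) := rfl

/-- The symmetrized covariant differential. -/
def symCovDeriv (W : KoszulConnection 𝔛 δ) (D : KoszulConnection S δ) {k : ℕ} :
    MultilinearMap R (fun _ : Fin k => 𝔛) S →+ MultilinearMap R (fun _ : Fin (k + 1) => 𝔛) S where
  toFun Ω := ∑ i, LinearMap.uncurryMid i (W.covDeriv D Ω)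
  map_zero' := by ext X; simp [covDeriv_apply]
  map_add' Ω Ω' := by
    ext X
    simp only [sum_apply, LinearMap.uncurryMid_apply, covDeriv_apply, map_add,
      add_apply, Finset.sum_add_distrib, Finset.sum_sub_distrib]
    abel

lemma symCovDeriv_apply (W : KoszulConnection 𝔛 δ) (D : KoszulConnection S δ) {k : ℕ}
    (Ω : MultilinearMap R (fun _ : Fin k => 𝔛) S) (X : Fin (k + 1) → 𝔛) :
    W.symCovDeriv D Ω X = ∑ i : Fin (k + 1), (D.toHom (X i) (Ω (i.removeNth X)) -
      ∑ j, Ω (Function.update (i.removeNth X) j (W.toHom (X i) (i.removeNth X j)))) := by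
  simp [symCovDeriv, covDeriv_apply]

/-- The symmetric product with a 1-form. -/
def symMul (η : 𝔛 →ₗ[R] R) {k : ℕ} :
    MultilinearMap R (fun _ : Fin k => 𝔛) S →ₗ[R] MultilinearMap R (fun _ : Fin (k + 1) => 𝔛) S where
  toFun Ω := ∑ i, LinearMap.uncurryMid i (η.smulRight Ω)
  map_add' Ω Ω' := by ext X; simp [Finset.sum_add_distrib]
  map_smul' c Ω := by ext X; simp [Finset.smul_sum, smul_comm c]

lemma symMul_apply (η : 𝔛 →ₗ[R] R) {k : ℕ} (Ω : MultilinearMap R (fun _ : Fin k => 𝔛) S)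
    (X : Fin (k + 1) → 𝔛) : symMul η Ω X = ∑ i : Fin (k + 1), η (X i) • Ω (i.removeNth X) := by
  simp [symMul]

/-- In other words, the commutator of `d^s` with `f` is the symmetric product with `df`; this is all
that the commutator calculations below use about `d^s`. -/
lemma symCovDeriv_smul (W : KoszulConnection 𝔛 δ) (D : KoszulConnection S δ) {k : ℕ} (f : R)
    (df : 𝔛 →ₗ[R] R) (hf : ∀ X, df X = δ X f) (Ω : MultilinearMap R (fun _ : Fin k => 𝔛) S) :
    W.symCovDeriv D (f • Ω) = f • W.symCovDeriv D Ω + symMul df Ω := by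
  ext X
  simp only [symCovDeriv_apply, symMul_apply, smul_apply, D.leibniz, hf,
    add_apply, Finset.smul_sum, smul_sub, ← Finset.sum_add_distrib]
  exact Finset.sum_congr rfl fun _ _ => by abel

/-- The iterated symmetrized covariant differential. -/
def symIter (W : KoszulConnection 𝔛 δ) (D : KoszulConnection S δ) (s : S) :
    (k : ℕ) → MultilinearMap R (fun _ : Fin k => 𝔛) S
  | 0 => MultilinearMap.constOfIsEmpty R _ s
  | k + 1 => W.symCovDeriv D (symIter W D s k)

/-- The connection `D + η`. -/
def addForm (D : KoszulConnection S δ) (η : 𝔛 →ₗ[R] R) : KoszulConnection S δ where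
  toHom := D.toHom +
    { toFun := fun X => DistribSMul.toAddMonoidHom S (η X)
      map_add' := fun X Y => by ext s; simp [add_smul]
      map_smul' := fun c X => by ext s; simp [mul_smul] }
  leibniz X f s := by
    simp only [LinearMap.add_apply, AddMonoidHom.add_apply, D.leibniz, LinearMap.coe_mk,
      AddHom.coe_mk, DistribSMul.toAddMonoidHom_apply, smul_add, smul_comm f (η X)]
    abel

lemma addForm_apply (D : KoszulConnection S δ) (η : 𝔛 →ₗ[R] R) (X : 𝔛) (s : S) :
    (D.addForm η).toHom X s = D.toHom X s + η X • s := rfl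

lemma symCovDeriv_addForm (W : KoszulConnection 𝔛 δ) (D : KoszulConnection S δ) (η : 𝔛 →ₗ[R] R)
    {k : ℕ} (Ω : MultilinearMap R (fun _ : Fin k => 𝔛) S) :
    W.symCovDeriv (D.addForm η) Ω = W.symCovDeriv D Ω + symMul η Ω := by
  ext X
  simp only [symCovDeriv_apply, symMul_apply, addForm_apply,
    add_apply, ← Finset.sum_add_distrib]
  exact Finset.sum_congr rfl fun _ _ => by abel

end KoszulConnection

/-- Double counting: each term `q i * ∏ p` arises once for every `l ≠ i`. -/
lemma Finset.sum_sum_erase_mul_prod {ι : Type*} [DecidableEq ι] (s : Finset ι) (p q : ι → R) :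
    ∑ l ∈ s, p l * ∑ i ∈ s.erase l, q i * ∏ j ∈ (s.erase l).erase i, p j =
      (s.card - 1) • ∑ i ∈ s, q i * ∏ j ∈ s.erase i, p j := by
  have h1 : ∀ l ∈ s, p l * ∑ i ∈ s.erase l, q i * ∏ j ∈ (s.erase l).erase i, p j =
      ∑ i ∈ s.erase l, q i * ∏ j ∈ s.erase i, p j := by
    intro l hl
    rw [Finset.mul_sum]
    refine Finset.sum_congr rfl fun i hi => ?_
    rw [mul_left_comm, Finset.erase_right_comm, Finset.mul_prod_erase]
    simpa [hl] using (Finset.ne_of_mem_erase hi).symm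
  rw [Finset.sum_congr rfl h1, Finset.smul_sum, Finset.sum_comm' (s' := fun i => s.erase i) (t' := s)]
  · refine Finset.sum_congr rfl fun i hi => ?_
    rw [Finset.sum_const, Finset.card_erase_of_mem hi]
  · intro x y
    simp only [Finset.mem_erase]
    tauto

lemma Fin.sum_mul_prod_erase_succAbove {k : ℕ} (l : Fin (k + 1)) (p q : Fin (k + 1) → R) :
    ∑ i, q (l.succAbove i) * ∏ j ∈ Finset.univ.erase i, p (l.succAbove j) =
      ∑ i ∈ Finset.univ.erase l, q i * ∏ j ∈ (Finset.univ.erase l).erase i, p j := by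
  have h : Finset.univ.erase l = Finset.univ.map l.succAboveEmb := by
    ext i
    simp only [Finset.mem_erase, Finset.mem_univ, and_true, Finset.mem_map, true_and]
    exact (Fin.exists_succAbove_eq_iff (x := l) (y := i)).symm
  rw [h, Finset.sum_map]
  refine Finset.sum_congr rfl fun i _ => ?_
  rw [← Finset.map_erase, Finset.prod_map]
  rfl

section DiagonalCommutators

/-- The `m`-fold commutator of a map with the multiplication by `f`. -/
def diagComm {A : Type*} [AddCommGroup A] [Module R A] (f : R) : ℕ → (S → A) → S → A
  | 0, T => T
  | m + 1, T => fun s => diagComm f m T (f • s) - f • diagComm f m T s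

variable {A B : Type*} [AddCommGroup A] [Module R A] [AddCommGroup B] [Module R B]

lemma diagComm_succ_eq_zero (f : R) (m : ℕ) (T : S → A) (hT : ∀ s, T (f • s) = f • T s) (s : S) :
    diagComm f (m + 1) T s = 0 := by
  induction m generalizing s with
  | zero => simp [diagComm, hT]
  | succ m ih =>
    change diagComm f (m + 1) T (f • s) - f • diagComm f (m + 1) T s = 0
    rw [ih, ih, smul_zero, sub_zero]

/-- The commutator of `E` with `f` is `μ`, which itself commutes with `f`. In the Leibniz expansion
of `ad_f^{m+1}(E T)` only the terms with at most one commutator on `E` survive. -/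
lemma diagComm_succ_comp (f : R) (m : ℕ) (E : A →+ B) (μ : A →ₗ[R] B)
    (hE : ∀ a, E (f • a) = f • E a + μ a) (T : S → A) (s : S) :
    diagComm f (m + 1) (fun s => E (T s)) s =
      E (diagComm f (m + 1) T s) + (m + 1) • μ (diagComm f m T s) := by
  induction m generalizing s with
  | zero =>
    simp only [diagComm, map_sub, hE, zero_add, one_smul]
    abel
  | succ m ih =>
    change diagComm f (m + 1) (fun s => E (T s)) (f • s) -
      f • diagComm f (m + 1) (fun s => E (T s)) s =
      E (diagComm f (m + 1) T (f • s) - f • diagComm f (m + 1) T s) + (m + 1 + 1) • μ _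
    have h : μ (diagComm f (m + 1) T s) = μ (diagComm f m T (f • s)) - f • μ (diagComm f m T s) := by
      rw [← map_smul, ← map_sub]; rfl
    rw [ih, ih, map_sub, hE, add_smul (m + 1) 1, one_smul, smul_add, smul_comm f (m + 1)]
    rw [h]
    simp only [smul_sub]
    abel

end DiagonalCommutators

namespace KoszulConnection

variable {δ : 𝔛 → R → R} (W : KoszulConnection 𝔛 δ) (D : KoszulConnection S δ) (f : R)
  (df : 𝔛 →ₗ[R] R) (hf : ∀ X, df X = δ X f)
include hf

lemma diagComm_symIter_succ (k m : ℕ) (s : S) :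
    diagComm f (m + 1) (fun s => W.symIter D s (k + 1)) s =
      W.symCovDeriv D (diagComm f (m + 1) (fun s => W.symIter D s k) s) +
        (m + 1) • symMul df (diagComm f m (fun s => W.symIter D s k) s) :=
  diagComm_succ_comp f m (W.symCovDeriv D) (symMul df) (W.symCovDeriv_smul D f df hf) _ s

/-- That is, `(d^s)^k` has order at most `k`. -/
lemma diagComm_symIter_eq_zero (k m : ℕ) (s : S) :
    diagComm f (k + m + 1) (fun s => W.symIter D s k) s = 0 := by
  induction k generalizing m with
  | zero => exact diagComm_succ_eq_zero f _ _ (fun s => by ext; rfl) s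
  | succ k ih =>
    rw [W.diagComm_symIter_succ D f df hf, show k + 1 + m = k + m + 1 by omega, ih,
      show k + m + 1 + 1 = k + (m + 1) + 1 by omega, ih]
    simp

/-- Each step contributes `(k + 1)^2`: one factor `k + 1` from the choice of the `d^s` that is
commuted with `f`, another from the `k + 1` equal terms of the symmetric product. -/
lemma diagComm_symIter_self (k : ℕ) (s : S) (X : Fin k → 𝔛) :
    diagComm f k (fun s => W.symIter D s k) s X =
      (k.factorial * k.factorial) • (∏ i, df (X i)) • s := by
  induction k with
  | zero => simp [diagComm, symIter]
  | succ k ih =>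
    rw [W.diagComm_symIter_succ D f df hf, W.diagComm_symIter_eq_zero D f df hf k 0, map_zero,
      zero_add, smul_apply, symMul_apply]
    have : ∀ i : Fin (k + 1), df (X i) • diagComm f k (fun s => W.symIter D s k) s
        (i.removeNth X) = (k.factorial * k.factorial) • (∏ i, df (X i)) • s := by
      intro i
      rw [ih, smul_comm, smul_smul, Fin.prod_univ_succAbove _ i]
      rfl
    rw [Finset.sum_congr rfl fun i _ => this i, Finset.sum_const, Finset.card_univ, Fintype.card_fin,
      smul_smul, smul_smul, Nat.factorial_succ]
    congr 1
    ring

/-- One commutator fewer than the order is the level at which the connection becomes visible. In the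
recursion `η` either enters through the newest factor `d^s`, multiplying a leading commutator, or
was already present and is multiplied by `df`. -/
lemma diagComm_symIter_addForm (η : 𝔛 →ₗ[R] R) (k : ℕ) (s : S) (X : Fin (k + 1) → 𝔛) :
    diagComm f k (fun s => W.symIter (D.addForm η) s (k + 1)) s X =
      diagComm f k (fun s => W.symIter D s (k + 1)) s X + ((k + 1).factorial * k.factorial) •
        (∑ i, η (X i) * ∏ j ∈ Finset.univ.erase i, df (X j)) • s := by
  induction k with
  | zero =>
    change W.symCovDeriv (D.addForm η) _ X = W.symCovDeriv D _ X + _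
    rw [symCovDeriv_addForm, add_apply, symMul_apply]
    simp [symIter]
  | succ k ih =>
    -- Leading commutators do not depend on the connection.
    have h0 : diagComm f (k + 1) (fun s => W.symIter (D.addForm η) s (k + 1)) s =
        diagComm f (k + 1) (fun s => W.symIter D s (k + 1)) s := by
      ext X
      rw [W.diagComm_symIter_self D f df hf, W.diagComm_symIter_self _ f df hf]
    rw [W.diagComm_symIter_succ D f df hf, W.diagComm_symIter_succ _ f df hf, h0,
      symCovDeriv_addForm, add_apply, add_apply, add_apply, smul_apply, smul_apply,
      symMul_apply, symMul_apply, symMul_apply]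
    have h1 : ∀ l, η (X l) • diagComm f (k + 1) (fun s => W.symIter D s (k + 1)) s (l.removeNth X) =
        ((k + 1).factorial * (k + 1).factorial) •
          (η (X l) * ∏ j ∈ Finset.univ.erase l, df (X j)) • s := by
      intro l
      rw [W.diagComm_symIter_self D f df hf, smul_comm, smul_smul]
      have h := Fin.prod_univ_succAbove (fun j => Function.update (fun j => df (X j)) l 1 j) l
      rw [Finset.prod_update_of_mem (Finset.mem_univ l), ← Finset.erase_eq] at h
      simp only [Function.update_self, one_mul, Function.update_of_ne (Fin.succAbove_ne _ _)] at h
      rw [h]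
      rfl
    have h2 : ∀ l, df (X l) •
        ((k + 1).factorial * k.factorial) • (∑ i, η (l.removeNth X i) *
          ∏ j ∈ Finset.univ.erase i, df (l.removeNth X j)) • s =
        ((k + 1).factorial * k.factorial) • (df (X l) *
          ∑ i ∈ Finset.univ.erase l, η (X i) *
            ∏ j ∈ (Finset.univ.erase l).erase i, df (X j)) • s := by
      intro l
      rw [smul_comm, smul_smul, ← Fin.sum_mul_prod_erase_succAbove l (fun i => df (X i))
        (fun i => η (X i))]
      rfl
    simp only [ih, h1, smul_add, h2, Finset.sum_add_distrib]
    simp only [← Finset.smul_sum, ← Finset.sum_smul]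
    rw [Finset.sum_sum_erase_mul_prod, Finset.card_univ, Fintype.card_fin]
    -- The first summand collects the terms with `df` in front, the second the terms with `η` in
    -- front.
    have h3 : (k + 1 + 1).factorial * (k + 1).factorial =
        (k + 1) * ((k + 1).factorial * k.factorial * (k + 1)) +
          (k + 1).factorial * (k + 1).factorial := by
      rw [Nat.factorial_succ (k + 1), Nat.factorial_succ k]
      ring
    rw [h3, add_smul (_ * _) (_ * _)]
    simp only [Nat.add_sub_cancel, smul_assoc, smul_smul]
    abel

end KoszulConnection

end Koszul

/-! ### Existence of smooth connections. -/

section Connections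

open Filter Topology

variable {n : ℕ} {M : Type*} [TopologicalSpace M] [ChartedSpace (EuclideanSpace ℝ (Fin n)) M]
  [IsManifold (𝓡 n) ∞ M]
  {F : Type*} [NormedAddCommGroup F] [NormedSpace ℝ F] [FiniteDimensional ℝ F]
  {V : M → Type*} [TopologicalSpace (TotalSpace F V)]
  [∀ x, AddCommGroup (V x)] [∀ x, Module ℝ (V x)] [∀ x, TopologicalSpace (V x)]
  [∀ x, IsTopologicalAddGroup (V x)] [∀ x, ContinuousSMul ℝ (V x)]
  [FiberBundle F V] [VectorBundle ℝ F V] [ContMDiffVectorBundle ∞ F V (𝓡 n)]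

instance contMDiffVectorBundle_one : ContMDiffVectorBundle 1 F V (𝓡 n) :=
  ContMDiffVectorBundle.of_le (n := ∞) (by norm_num)

section Local

variable (n) {ι : Type*} [Fintype ι] (e : Trivialization F (TotalSpace.proj : TotalSpace F V → M))
  [MemTrivializationAtlas e] (b : Module.Basis ι ℝ F)

/-- The flat connection of a local frame. -/
def frameConnection (s : Π x, V x) (y : M) : TangentSpace (𝓡 n) y →L[ℝ] V y :=
  ∑ i, (mvfderiv (𝓡 n) ((LinearMap.piApply (e.localFrameCoeff (𝓡 n) b i)) s) y).smulRight
    (e.localFrame b i y)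

lemma isCovariantDerivativeOn_frameConnection :
    IsCovariantDerivativeOn (I := 𝓡 n) F (frameConnection n e b) e.baseSet where
  add {s s' x} hs hs' hx := by
    simp only [frameConnection, map_add, ← Finset.sum_add_distrib]
    refine Finset.sum_congr rfl fun i _ => ?_
    rw [mvfderiv_add (mdifferentiableAt_localFrameCoeff b hx hs i)
      (mdifferentiableAt_localFrameCoeff b hx hs' i)]
    ext v
    simp [add_smul]
  leibniz {s g x} hs hg hx := by
    simp only [frameConnection]
    have h1 : ∀ i, LinearMap.piApply (e.localFrameCoeff (𝓡 n) b i) (g • s) =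
        g • LinearMap.piApply (e.localFrameCoeff (𝓡 n) b i) s := fun i => by
      ext y
      simp
    have h2 := e.eq_sum_localFrameCoeff_smul (I := 𝓡 n) (b := b) (s := s) hx
    conv_rhs => rw [h2]
    rw [Finset.smul_sum]
    have h3 : ∀ i, mvfderiv (𝓡 n) (g • LinearMap.piApply (e.localFrameCoeff (𝓡 n) b i) s) x =
        g x • mvfderiv (𝓡 n) (LinearMap.piApply (e.localFrameCoeff (𝓡 n) b i) s) x +
        e.localFrameCoeff (𝓡 n) b i x (s x) • mvfderiv (𝓡 n) g x := fun i => by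
      have := mvfderiv_smul hg (mdifferentiableAt_localFrameCoeff b hx hs i)
      rw [this]
      ext v
      simp [mul_comm]
    ext v
    simp only [h1, h3]
    simp [add_smul, Finset.sum_add_distrib, Finset.smul_sum, smul_smul, mul_comm]

lemma contMDiffOn_frameConnection [T2Space M] (s : ContMDiffSection (𝓡 n) F ∞ V)
    (Y : VectorFields n M) :
    ContMDiffOn (𝓡 n) ((𝓡 n).prod 𝓘(ℝ, F)) ∞
      (fun y => TotalSpace.mk' F y (frameConnection n e b s y (Y y))) e.baseSet := by
  intro x hx
  refine ContMDiffAt.contMDiffWithinAt ?_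
  have h1 : ∀ i, ∃ f : C^∞⟮𝓡 n, M; ℝ⟯, ∀ᶠ y in 𝓝 x,
      f y = LinearMap.piApply (e.localFrameCoeff (𝓡 n) b i) s y := fun i =>
    exists_function_eventuallyEq (e.open_baseSet.mem_nhds hx)
      (contMDiffOn_localFrameCoeff (I := 𝓡 n) (e := e) b e.open_baseSet le_rfl
        (s.contMDiff.contMDiffOn (s := e.baseSet)) i)
  choose f hf using h1
  have h2 : ContMDiffAt (𝓡 n) ((𝓡 n).prod 𝓘(ℝ, F)) ∞ (fun y => TotalSpace.mk' F y
      (∑ i, mvfderiv (𝓡 n) (f i) y (Y y) • e.localFrame b i y)) x := by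
    refine ContMDiffAt.sum_section fun i _ => ContMDiffAt.smul_section
      (contMDiffAt_mvfderiv_apply (f i) (Y.contMDiff x)) ?_
    exact contMDiffAt_localFrame_of_mem ∞ e b i hx
  refine h2.congr_of_eventuallyEq ?_
  filter_upwards [(Filter.eventually_all.2 hf).eventually_nhds] with y hy
  congr 1
  simp only [frameConnection, sum_apply, ContinuousLinearMap.smulRight_apply]
  refine Finset.sum_congr rfl fun i _ => ?_
  have : (f i : M → ℝ) =ᶠ[𝓝 y] LinearMap.piApply (e.localFrameCoeff (𝓡 n) b i) s := by
    filter_upwards [hy] with z hz using hz i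
  rw [mvfderiv, mvfderiv, this.mfderiv_eq]
  rfl

end Local

variable (n V) in
/-- Every smooth vector bundle has a smooth connection. -/
theorem exists_contMDiff_connection [T2Space M] [SecondCountableTopology M] :
    ∃ D : CovariantDerivative (𝓡 n) F V, D.ContMDiffCovariantDerivative ∞ := by
  have : LocallyCompactSpace M := ChartedSpace.locallyCompactSpace (EuclideanSpace ℝ (Fin n)) M
  let U : M → Set M := fun x => (trivializationAt F V x).baseSet
  obtain ⟨ρ, hρ⟩ := SmoothPartitionOfUnity.exists_isSubordinate (𝓡 n) isClosed_univ U
    (fun x => (trivializationAt F V x).open_baseSet)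
    (fun x _ => Set.mem_iUnion.2 ⟨x, FiberBundle.mem_baseSet_trivializationAt' x⟩)
  let b := Module.finBasis ℝ F
  let c : M → (Π x, V x) → (y : M) → TangentSpace (𝓡 n) y →L[ℝ] V y :=
    fun i => frameConnection n (trivializationAt F V i) b
  have hc : ∀ i, IsCovariantDerivativeOn (I := 𝓡 n) F (c i) (U i) := fun i =>
    isCovariantDerivativeOn_frameConnection n _ b
  have hU : ∀ i y, ρ i y ≠ 0 → y ∈ U i := fun i y h => hρ i (subset_tsupport _ h)
  have hfin : ∀ (y : M), (Function.support fun i => ρ i y).Finite := fun y =>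
    ρ.locallyFinite.point_finite y
  have hfin' : ∀ (y : M) (u : M → (TangentSpace (𝓡 n) y →L[ℝ] V y)),
      (Function.support fun i => ρ i y • u i).Finite := fun y u =>
    (hfin y).subset fun i hi h0 => hi (by
      change ρ i y = 0 at h0
      change ρ i y • u i = 0
      rw [h0, zero_smul])
  have h1 : ∀ y, ∑ᶠ i, ρ i y = 1 := fun y => ρ.sum_eq_one (Set.mem_univ y)
  let D : CovariantDerivative (𝓡 n) F V :=
    { toFun := fun s y => ∑ᶠ i, ρ i y • c i s y
      isCovariantDerivativeOnUniv :=
        { add := fun {s s' x} hs hs' _ => by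
            rw [← finsum_add_distrib (hfin' x _) (hfin' x _)]
            refine finsum_congr fun i => ?_
            by_cases hi : ρ i x = 0
            · simp [hi]
            · rw [(hc i).add hs hs' (hU i x hi), smul_add]
          leibniz := fun {s g x} hs hg _ => by
            -- The weights sum to one, so the inhomogeneous Leibniz term survives averaging with
            -- coefficient one.
            have h2 : (mvfderiv (𝓡 n) g x).smulRight (s x) =
                ∑ᶠ i, ρ i x • (mvfderiv (𝓡 n) g x).smulRight (s x) := by
              rw [← finsum_smul (fun i => ρ i x), h1, one_smul]
            rw [h2, smul_finsum' _ (hfin' x _), ← finsum_add_distrib _ (hfin' x _)]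
            · refine finsum_congr fun i => ?_
              by_cases hi : ρ i x = 0
              · simp [hi]
              · rw [(hc i).leibniz hs hg (hU i x hi), smul_add, smul_comm]
            · refine (hfin x).subset fun i hi => ?_
              contrapose! hi
              simp only [Function.mem_support, not_not] at hi ⊢
              simp [hi] } }
  refine ⟨D, ⟨⟨fun {s} hs => ?_⟩⟩⟩
  rw [contMDiffOn_univ] at hs ⊢
  refine contMDiff_hom_of_apply _ fun Y => ?_
  have h3 : ∀ y, D s y (Y y) = ∑ᶠ i, ρ i y • c i s y (Y y) := by
    intro y
    let ev : (TangentSpace (𝓡 n) y →L[ℝ] V y) →+ V y :=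
      { toFun := fun L => L (Y y), map_zero' := rfl, map_add' := fun _ _ => rfl }
    exact ev.map_finsum (hfin' y _)
  simp only [h3]
  refine ContMDiff.finsum_section_of_locallyFinite ?_ fun i => ?_
  · refine ρ.locallyFinite.subset fun i y hy => ?_
    contrapose! hy
    simp only [Function.mem_support, not_not] at hy
    simp [hy]
  · exact ContMDiffOn.smul_section_of_tsupport (ρ i).contMDiff.contMDiffOn
      (trivializationAt F V i).open_baseSet (hρ i)
      (contMDiffOn_frameConnection n _ b ⟨s, by simpa using hs⟩ Y)

end Connections

/-! ### Regular forms have trivial infinitesimal isotropy. -/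

section Forms

open Filter Topology

variable {V : Type*} [NormedAddCommGroup V] [NormedSpace ℝ V] [FiniteDimensional ℝ V]

lemma MultilinearMap.continuous_of_finiteDim {k : ℕ}
    (T : MultilinearMap ℝ (fun _ : Fin k => V) ℝ) : Continuous T := by
  let b := Module.finBasis ℝ V
  have h : ∀ v, T v = ∑ I : Fin k → Fin (Module.finrank ℝ V),
      (∏ m, b.repr (v m) (I m)) * T fun m => b (I m) := by
    intro v
    conv_lhs => rw [show v = fun m => ∑ j, b.repr (v m) j • b j from
      funext fun m => (b.sum_repr _).symm]
    rw [T.map_sum]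
    exact Finset.sum_congr rfl fun I _ => by rw [T.map_smul_univ]; rfl
  have h' : ∀ j, Continuous fun v : V => b.repr v j := fun j =>
    (b.coord j).continuous_of_finiteDimensional
  rw [show (T : (Fin k → V) → ℝ) = _ from funext h]
  refine continuous_finsetSum _ fun I _ => Continuous.mul ?_ continuous_const
  exact continuous_finsetProd _ fun m _ => (h' _).comp (continuous_apply m)

/-- A multilinear form on a finite-dimensional space as a continuous one. -/
def MultilinearMap.toContinuousOfFiniteDim {k : ℕ}
    (T : MultilinearMap ℝ (fun _ : Fin k => V) ℝ) :
    ContinuousMultilinearMap ℝ (fun _ : Fin k => V) ℝ :=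
  ⟨T, T.continuous_of_finiteDim⟩

lemma MultilinearMap.hasFDerivAt_of_finiteDim {k : ℕ}
    (T : MultilinearMap ℝ (fun _ : Fin k => V) ℝ) (v : Fin k → V) :
    HasFDerivAt T (T.toContinuousOfFiniteDim.linearDeriv v) v :=
  T.toContinuousOfFiniteDim.hasFDerivAt v

lemma MultilinearMap.hasFDerivAt_diag {k : ℕ} (T : MultilinearMap ℝ (fun _ : Fin k => V) ℝ)
    (v : V) : HasFDerivAt (fun v => T fun _ => v)
      (T.toContinuousOfFiniteDim.linearDeriv (fun _ => v) ∘L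
        ContinuousLinearMap.pi fun _ => ContinuousLinearMap.id ℝ V) v :=
  (T.hasFDerivAt_of_finiteDim fun _ => v).comp v
    (ContinuousLinearMap.pi fun _ => ContinuousLinearMap.id ℝ V).hasFDerivAt

lemma MultilinearMap.fderiv_diag_apply {k : ℕ} (T : MultilinearMap ℝ (fun _ : Fin k => V) ℝ)
    (v w : V) : fderiv ℝ (fun v => T fun _ => v) v w =
      ∑ m, T (Function.update (fun _ => v) m w) := by
  rw [(T.hasFDerivAt_diag v).fderiv, ContinuousLinearMap.comp_apply,
    ContinuousMultilinearMap.linearDeriv_apply]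
  rfl

lemma IsForm.contDiff {k : ℕ} {h : V → ℝ} (hh : IsForm k h) : ContDiff ℝ ∞ h := by
  obtain ⟨T, hT⟩ := hh
  rw [show h = fun v => T fun _ => v from funext hT]
  exact T.toContinuousOfFiniteDim.contDiff.comp (contDiff_pi.2 fun _ => contDiff_id)

lemma finiteDimensional_continuousMultilinearMap (l : ℕ) :
    FiniteDimensional ℝ (ContinuousMultilinearMap ℝ (fun _ : Fin l => V) ℝ) :=
  FiniteDimensional.of_injective
    (ContinuousMultilinearMap.toMultilinearMapLinear :
      ContinuousMultilinearMap ℝ (fun _ : Fin l => V) ℝ →ₗ[ℝ]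
        MultilinearMap ℝ (fun _ : Fin l => V) ℝ) ContinuousMultilinearMap.toMultilinearMap_injective

lemma IsPolynomialFun.contDiff {W : Type*} [NormedAddCommGroup W] [NormedSpace ℝ W]
    [FiniteDimensional ℝ W] {P : W → ℝ} (hP : IsPolynomialFun P) : ContDiff ℝ ∞ P := by
  induction hP using Algebra.adjoin_induction with
  | mem x hx =>
    obtain ⟨l, rfl⟩ := hx
    exact (LinearMap.toContinuousLinearMap l).contDiff
  | algebraMap r => exact contDiff_const
  | add x y _ _ hx hy => exact hx.add hy
  | mul x y _ _ hx hy => exact hx.mul hy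

lemma contDiff_jet3 {h : V → ℝ} (hh : ContDiff ℝ ∞ h) : ContDiff ℝ ∞ (jet3 h) :=
  contDiff_id.prodMk (contDiff_pi.2 fun l => hh.iteratedFDeriv_right (by
    rw [← WithTop.coe_natCast]; exact le_rfl))

/-- The linear isotropy algebra of the form `h` is trivial. -/
def HasTrivialIsotropy (h : V → ℝ) : Prop :=
  ∀ L : V →L[ℝ] V, (∀ w, fderiv ℝ h w (L w) = 0) → L = 0

lemma HasTrivialIsotropy.comp {V' : Type*} [NormedAddCommGroup V'] [NormedSpace ℝ V']
    {h : V → ℝ} (hh : HasTrivialIsotropy h) (hd : Differentiable ℝ h) (g : V' ≃L[ℝ] V) :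
    HasTrivialIsotropy (h ∘ g) := by
  intro L hL
  have h1 := hh ((g : V' →L[ℝ] V) ∘L L ∘L (g.symm : V →L[ℝ] V')) fun w => by
    have := hL (g.symm w)
    rw [fderiv_comp _ hd.differentiableAt g.differentiableAt, g.fderiv] at this
    simpa using this
  ext v
  have h2 := congrArg (fun T => g.symm (T (g v))) h1
  simpa using h2

/-- As many independent covectors as the dimension span the dual space, and they separate vectors.
-/
lemma linearIndependent_dual_eq_zero {m : ℕ} {φ : Fin m → (V →L[ℝ] ℝ)}
    (hφ : LinearIndependent ℝ φ) (hm : m = Module.finrank ℝ V) {v : V} (hv : ∀ i, φ i v = 0) :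
    v = 0 := by
  have h1 : LinearIndependent ℝ fun i => (φ i : Module.Dual ℝ V) :=
    hφ.map' (ContinuousLinearMap.coeLM ℝ) (LinearMap.ker_eq_bot.2 ContinuousLinearMap.coe_injective)
  have h2 := h1.span_eq_top_of_card_eq_finrank' (by
    rw [Fintype.card_fin, Subspace.dual_finrank_eq, hm])
  rw [← Module.forall_dual_apply_eq_zero_iff ℝ]
  intro ψ
  have h3 : ψ ∈ Submodule.span ℝ (Set.range fun i => (φ i : Module.Dual ℝ V)) := h2 ▸ trivial
  induction h3 using Submodule.span_induction with
  | mem x hx => obtain ⟨i, rfl⟩ := hx; exact hv i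
  | zero => rfl
  | add x y _ _ hx hy => simp [hx, hy]
  | smul a x _ hx => simp [hx]

/-- A flow preserving `h` preserves rational invariants of its jets. -/
lemma fderiv_invariant_eq_zero {k : ℕ} {h : V → ℝ} (hh : IsForm k h) {L : V →L[ℝ] V}
    (hL : ∀ w, fderiv ℝ h w (L w) = 0) {P Q : Jet3 V → ℝ} (hPQ : IsRationalInvariant k P Q)
    {w : V} (hw : w ≠ 0) (hQ : Q (jet3 h w) ≠ 0) :
    fderiv ℝ (fun w => P (jet3 h w) / Q (jet3 h w)) w (L w) = 0 := by
  have := fun l : ℕ => finiteDimensional_continuousMultilinearMap (V := V) l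
  have hs := hh.contDiff
  have hd : Differentiable ℝ h := hs.differentiable (by simp)
  have hPc : ContDiff ℝ ∞ fun w => P (jet3 h w) := hPQ.1.contDiff.comp (contDiff_jet3 hs)
  have hQc : ContDiff ℝ ∞ fun w => Q (jet3 h w) := hPQ.2.1.contDiff.comp (contDiff_jet3 hs)
  have hexp : ∀ (w : V) (t : ℝ), HasDerivAt (fun t : ℝ => NormedSpace.exp (t • L) w)
      (L (NormedSpace.exp (t • L) w)) t := fun w t =>
    ((ContinuousLinearMap.apply ℝ V w).hasFDerivAt.comp_hasDerivAt t
      (hasDerivAt_exp_smul_const' (𝕂 := ℝ) L t) :)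
  have hconst : ∀ (w : V) (t : ℝ), h (NormedSpace.exp (t • L) w) = h w := by
    intro w t
    have h1 : ∀ t, HasDerivAt (fun t : ℝ => h (NormedSpace.exp (t • L) w)) 0 t := fun t => by
      have := (hd (NormedSpace.exp (t • L) w)).hasFDerivAt.comp_hasDerivAt t (hexp w t)
      rwa [hL] at this
    have h2 := is_const_of_deriv_eq_zero (fun t => (h1 t).differentiableAt) (fun t => (h1 t).deriv)
      t 0
    simpa using h2
  have hinv : ∀ᶠ t : ℝ in 𝓝 0, P (jet3 h (NormedSpace.exp (t • L) w)) /
      Q (jet3 h (NormedSpace.exp (t • L) w)) = P (jet3 h w) / Q (jet3 h w) := by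
    have h1 : ContinuousAt (fun t : ℝ => Q (jet3 h (NormedSpace.exp (t • L) w))) 0 :=
      hQc.continuous.continuousAt.comp (hexp w 0).continuousAt
    have h2 : Q (jet3 h (NormedSpace.exp ((0 : ℝ) • L) w)) ≠ 0 := by simpa using hQ
    filter_upwards [h1.eventually_ne h2] with t ht
    -- The flow is invertible, so invariance under the general linear group applies to it.
    obtain ⟨u, hu⟩ := NormedSpace.isUnit_exp_of_mem_ball (𝕂 := ℝ) (x := t • L)
      (by rw [NormedSpace.expSeries_radius_eq_top ℝ (V →L[ℝ] V)]; exact edist_lt_top _ _)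
    let g := ContinuousLinearEquiv.ofUnit u
    have hg : ∀ v, g v = NormedSpace.exp (t • L) v := fun v => by rw [← hu]; rfl
    have hg' : h ∘ g = h := by
      ext v
      rw [Function.comp_apply, hg, hconst]
    have h3 := hPQ.2.2 h g w hh hw (by rwa [hg']) (by rwa [hg])
    rw [hg', hg] at h3
    exact h3.symm
  have hdiff : DifferentiableAt ℝ (fun w => P (jet3 h w) / Q (jet3 h w)) w :=
    (hPc.contDiffAt.div hQc.contDiffAt hQ).differentiableAt (by simp)
  have h4 : HasDerivAt (fun t : ℝ => P (jet3 h (NormedSpace.exp (t • L) w)) /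
      Q (jet3 h (NormedSpace.exp (t • L) w)))
      (fderiv ℝ (fun w => P (jet3 h w) / Q (jet3 h w)) w (L w)) 0 := by
    have h5 := hexp w 0
    have h6 : NormedSpace.exp ((0 : ℝ) • L) w = w := by simp
    have h7 : HasFDerivAt (fun w => P (jet3 h w) / Q (jet3 h w))
        (fderiv ℝ (fun w => P (jet3 h w) / Q (jet3 h w)) w)
        (NormedSpace.exp ((0 : ℝ) • L) w) := by rw [h6]; exact hdiff.hasFDerivAt
    have h8 := h7.comp_hasDerivAt 0 h5
    rwa [h6] at h8
  have h5 : HasDerivAt (fun t : ℝ => P (jet3 h (NormedSpace.exp (t • L) w)) /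
      Q (jet3 h (NormedSpace.exp (t • L) w))) 0 0 :=
    (hasDerivAt_const (0 : ℝ) (P (jet3 h w) / Q (jet3 h w))).congr_of_eventuallyEq hinv
  exact h4.unique h5

/-- A symmetry field `w ↦ L w` is killed by `dh` and by the differentials of the invariants. These
remain independent near the regular point, so `L` vanishes on an open set and hence everywhere. -/
theorem IsRegularForm.hasTrivialIsotropy {k : ℕ} (hk : k ≠ 0) {h : V → ℝ}
    (hreg : IsRegularForm k h) : HasTrivialIsotropy h := by
  obtain ⟨hh, v, hv3, P, Q, hPQ, hlin⟩ := hreg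
  intro L hL
  have := fun l : ℕ => finiteDimensional_continuousMultilinearMap (V := V) l
  have hs := hh.contDiff
  -- A form of positive degree vanishes at the origin, while `h v ≠ 0`.
  have hv : v ≠ 0 := by
    rintro rfl
    refine hv3.1.1 ?_
    obtain ⟨T, hT⟩ := hh
    rw [hT]
    exact T.map_coord_zero ⟨0, Nat.pos_of_ne_zero hk⟩ rfl
  have hrank : Module.finrank ℝ V - 1 + 1 = Module.finrank ℝ V := by
    have : Nontrivial V := ⟨v, 0, hv⟩
    have := Module.finrank_pos (R := ℝ) (M := V)
    omega
  have hPc : ∀ i, ContDiff ℝ ∞ fun w => P i (jet3 h w) := fun i =>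
    (hPQ i).1.1.contDiff.comp (contDiff_jet3 hs)
  have hQc : ∀ i, ContDiff ℝ ∞ fun w => Q i (jet3 h w) := fun i =>
    (hPQ i).1.2.1.contDiff.comp (contDiff_jet3 hs)
  let φ : V → Fin (Module.finrank ℝ V - 1 + 1) → (V →L[ℝ] ℝ) := fun w =>
    Fin.cons (fderiv ℝ h w) fun i => fderiv ℝ (fun w => P i (jet3 h w) / Q i (jet3 h w)) w
  have hφ : ContinuousAt φ v := by
    refine continuousAt_pi.2 fun i => ?_
    refine Fin.cases ?_ (fun i => ?_) i
    · exact (hs.continuous_fderiv (by simp)).continuousAt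
    · have : ContDiffAt ℝ ∞ (fun w => P i (jet3 h w) / Q i (jet3 h w)) v :=
        (hPc i).contDiffAt.div (hQc i).contDiffAt (hPQ i).2
      exact (this.fderiv_right (m := 0) (by simp)).continuousAt
  have hzero : ∀ᶠ w in 𝓝 v, L w = 0 := by
    have h1 : ∀ᶠ w in 𝓝 v, LinearIndependent ℝ (φ w) :=
      hφ.eventually (isOpen_setOfPred_linearIndependent.eventually_mem hlin)
    have h2 : ∀ᶠ w in 𝓝 v, ∀ i, Q i (jet3 h w) ≠ 0 := Filter.eventually_all.2 fun i =>
      (hQc i).continuous.continuousAt.eventually_ne (hPQ i).2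
    filter_upwards [h1, h2, isOpen_ne.mem_nhds hv] with w hw1 hw2 hw3
    refine linearIndependent_dual_eq_zero hw1 hrank fun i => ?_
    refine Fin.cases (hL w) (fun i => ?_) i
    exact fderiv_invariant_eq_zero hh hL (hPQ i).1 hw3 (hw2 i)
  have h1 : (L : V → V) =ᶠ[𝓝 v] fun _ => 0 := hzero
  have h2 := h1.fderiv_eq (𝕜 := ℝ)
  simpa using h2

end Forms

/-! ### Injective linear systems depending on parameters. -/

section SmoothLinearSystems

open Filter Topology

variable {E F : Type*} [NormedAddCommGroup E] [NormedSpace ℝ E] [FiniteDimensional ℝ E]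
  [NormedAddCommGroup F] [NormedSpace ℝ F] [FiniteDimensional ℝ F]

/-- An injective operator has a left inverse which depends smoothly on the operator. -/
lemma exists_contDiffAt_leftInverse {R₀ : E →L[ℝ] F} (h : Function.Injective R₀) :
    ∃ S : (E →L[ℝ] F) → (F →L[ℝ] E), ContDiffAt ℝ ∞ S R₀ ∧
      ∀ᶠ R in 𝓝 R₀, ∀ B, S R (R B) = B := by
  obtain ⟨g, hg⟩ := (R₀ : E →ₗ[ℝ] F).exists_leftInverse_of_injective (LinearMap.ker_eq_bot.2 h)
  let L : F →L[ℝ] E := LinearMap.toContinuousLinearMap g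
  have hL : L ∘L R₀ = ((1 : (E →L[ℝ] E)ˣ) : E →L[ℝ] E) := by
    ext v
    exact LinearMap.congr_fun hg v
  have hK : ContDiff ℝ ∞ fun R : E →L[ℝ] F => L ∘L R := contDiff_const.clm_comp contDiff_id
  -- Here `L` is a fixed left inverse of `R₀`; for `R` near `R₀` the endomorphism `L ∘ R` is still
  -- invertible.
  refine ⟨fun R => Ring.inverse (L ∘L R) ∘L L, ?_, ?_⟩
  · have h1 := contDiffAt_ringInverse ℝ (n := ∞) (1 : (E →L[ℝ] E)ˣ)
    rw [← hL] at h1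
    exact (ContDiffAt.comp R₀ (g := Ring.inverse) h1 hK.contDiffAt).clm_comp contDiffAt_const
  · have h1 : ∀ᶠ K in 𝓝 (L ∘L R₀), IsUnit K := by
      rw [hL]
      exact Units.isOpen.mem_nhds (Units.isUnit _)
    filter_upwards [hK.continuous.continuousAt.eventually h1] with R hR B
    have := Ring.inverse_mul_cancel _ hR
    exact congrArg (fun T : E →L[ℝ] E => T B) this

/-- With a continuous left inverse `S`, membership in the range forces `R S b = b`. Both sides are
continuous, so the identity passes to the limit point. -/
lemma mem_range_of_frequently {X : Type*} [TopologicalSpace X] {x : X} {R : X → E →L[ℝ] F}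
    {b : X → F} (hR : ContinuousAt R x) (hb : ContinuousAt b x) (hx : Function.Injective (R x))
    (h : ∃ᶠ y in 𝓝 x, b y ∈ Set.range (R y)) : b x ∈ Set.range (R x) := by
  obtain ⟨S, hS, hSR⟩ := exists_contDiffAt_leftInverse hx
  have hSc : ContinuousAt (fun y => S (R y)) x := hS.continuousAt.comp hR
  have h1 : ContinuousAt (fun y => R y (S (R y) (b y))) x := hR.clm_apply (hSc.clm_apply hb)
  have h2 : ∃ᶠ y in 𝓝 x, R y (S (R y) (b y)) = b y := by
    refine (h.and_eventually (hR.eventually hSR)).mono ?_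
    rintro y ⟨⟨B, hB⟩, hy⟩
    rw [← hB, hy]
  have : R x (S (R x) (b x)) = b x := by
    by_contra hne
    exact h2 ((h1.ne_iff_eventually_ne hb).1 hne)
  exact ⟨_, this⟩

end SmoothLinearSystems

/-! ### Tensors in coordinates and the infinitesimal action of matrices. -/

section Tensors

open Filter Topology

variable {n k : ℕ}

/-- The `k`-tensor with given coordinates. -/
def tensorOf : ((Fin k → Fin n) → ℝ) →ₗ[ℝ] MultilinearMap ℝ (fun _ : Fin k => Fin n → ℝ) ℝ :=
  ∑ I, LinearMap.smulRight (LinearMap.proj I)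
    ((MultilinearMap.mkPiAlgebra ℝ (Fin k) ℝ).compLinearMap fun m => LinearMap.proj (I m))

lemma tensorOf_apply (c : (Fin k → Fin n) → ℝ) (w : Fin k → Fin n → ℝ) :
    tensorOf c w = ∑ I, c I * ∏ m, w m (I m) := by
  simp [tensorOf]

lemma tensorOf_apply_single (c : (Fin k → Fin n) → ℝ) (I : Fin k → Fin n) :
    tensorOf c (fun m => Pi.single (I m) 1) = c I := by
  rw [tensorOf_apply, Finset.sum_eq_single I]
  · simp
  · intro J _ hJ
    obtain ⟨m, hm⟩ := Function.ne_iff.1 hJ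
    rw [Finset.prod_eq_zero (Finset.mem_univ m) (Pi.single_eq_of_ne hm 1), mul_zero]
  · simp

lemma multilinear_ext_single {T T' : MultilinearMap ℝ (fun _ : Fin k => Fin n → ℝ) ℝ}
    (h : ∀ I : Fin k → Fin n, T (fun m => Pi.single (I m) 1) = T' fun m => Pi.single (I m) 1) :
    T = T' :=
  Module.Basis.ext_multilinear (fun _ => Pi.basisFun ℝ (Fin n)) fun I => by
    simpa only [Pi.basisFun_apply] using h I

lemma eq_tensorOf (T : MultilinearMap ℝ (fun _ : Fin k => Fin n → ℝ) ℝ) :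
    T = tensorOf fun I => T fun m => Pi.single (I m) 1 :=
  multilinear_ext_single fun I => by rw [tensorOf_apply_single]

set_option synthInstance.maxHeartbeats 400000 in
/-- The infinitesimal action of linear operators on tensors. -/
def tensorAction : ((Fin k → Fin n) → ℝ) →L[ℝ]
    ((Fin n → ℝ) →L[ℝ] (Fin n → ℝ)) →L[ℝ] ((Fin k → Fin n) → ℝ) :=
  LinearMap.toContinuousLinearMap <|
    LinearMap.toContinuousLinearMap.toLinearMap ∘ₗ
      LinearMap.mk₂ ℝ (fun c B I => ∑ m, tensorOf c
        (Function.update (fun m' => Pi.single (I m') 1) m (B (Pi.single (I m) 1))))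
      (fun c c' B => by ext I; simp [Finset.sum_add_distrib])
      (fun a c B => by ext I; simp [Finset.mul_sum])
      (fun c B B' => by ext I; simp [Finset.sum_add_distrib])
      (fun a c B => by ext I; simp [Finset.mul_sum])

lemma tensorAction_apply (c : (Fin k → Fin n) → ℝ) (B : (Fin n → ℝ) →L[ℝ] (Fin n → ℝ))
    (I : Fin k → Fin n) : tensorAction c B I = ∑ m, tensorOf c
      (Function.update (fun m' => Pi.single (I m') 1) m (B (Pi.single (I m) 1))) := rfl

lemma sum_update_eq_tensorOf (c : (Fin k → Fin n) → ℝ) (B : (Fin n → ℝ) →L[ℝ] (Fin n → ℝ))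
    (w : Fin k → Fin n → ℝ) :
    ∑ m, tensorOf c (Function.update w m (B (w m))) = tensorOf (tensorAction c B) w := by
  obtain ⟨T, hT⟩ := (tensorOf c).exists_sum_update (B : (Fin n → ℝ) →ₗ[ℝ] (Fin n → ℝ))
  have h : T = tensorOf (tensorAction c B) := multilinear_ext_single fun I => by
    rw [hT, tensorOf_apply_single, tensorAction_apply]
    rfl
  rw [← h, hT]
  rfl

/-- On the diagonal the infinitesimal action is `dh_w(Bw)` for the polynomial `h` of the tensor, so
a matrix in the kernel is an infinitesimal symmetry of `h`. -/
lemma injective_tensorAction {c : (Fin k → Fin n) → ℝ}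
    (hc : HasTrivialIsotropy fun w => tensorOf c fun _ => w) :
    Function.Injective (tensorAction c) := by
  rw [injective_iff_map_eq_zero]
  intro B hB
  refine hc B fun w => ?_
  rw [MultilinearMap.fderiv_diag_apply, sum_update_eq_tensorOf, hB, map_zero]
  rfl

/-- The infinitesimal action is the derivative at the identity of the action by substitution. -/
lemma hasFDerivAt_tensorOf_single (c : (Fin k → Fin n) → ℝ) :
    HasFDerivAt (fun (U : (Fin n → ℝ) →L[ℝ] (Fin n → ℝ)) (I : Fin k → Fin n) =>
      tensorOf c fun m => U (Pi.single (I m) 1)) (tensorAction c) 1 := by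
  refine hasFDerivAt_pi'.2 fun I => ?_
  have h1 := ((tensorOf c).hasFDerivAt_of_finiteDim fun m => Pi.single (I m) 1)
  let ev : ((Fin n → ℝ) →L[ℝ] (Fin n → ℝ)) →L[ℝ] (Fin k → Fin n → ℝ) :=
    ContinuousLinearMap.pi fun m => ContinuousLinearMap.apply ℝ (Fin n → ℝ) (Pi.single (I m) 1)
  have h2 := HasFDerivAt.comp (f := ev) (g := tensorOf c) (1 : (Fin n → ℝ) →L[ℝ] (Fin n → ℝ))
    h1 ev.hasFDerivAt
  refine h2.congr_fderiv ?_
  ext B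
  simp only [ContinuousLinearMap.comp_apply, ContinuousMultilinearMap.linearDeriv_apply,
    ContinuousLinearMap.proj_apply, tensorAction_apply]
  rfl

/-- Polarization lifts an equality of polynomials to one of symmetric tensors. -/
lemma tensorOf_symm_of_eq {c c' : (Fin k → Fin n) → ℝ}
    (hc : ∀ (τ : Equiv.Perm (Fin k)) w, tensorOf c (w ∘ τ) = tensorOf c w)
    (hc' : ∀ (τ : Equiv.Perm (Fin k)) w, tensorOf c' (w ∘ τ) = tensorOf c' w)
    (U : (Fin n → ℝ) →L[ℝ] (Fin n → ℝ))
    (h : ∀ w, tensorOf c' (fun _ => w) = tensorOf c fun _ => U w) :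
    c' = fun I => tensorOf c fun m => U (Pi.single (I m) 1) := by
  have h1 : tensorOf c' = (tensorOf c).compLinearMap
      fun _ => (U : (Fin n → ℝ) →ₗ[ℝ] (Fin n → ℝ)) := by
    refine MultilinearMap.eq_of_diag _ _ hc' (fun τ w => ?_) fun w => by rw [h]; rfl
    exact hc τ fun m => U (w m)
  ext I
  rw [← tensorOf_apply_single c' I, h1]
  rfl

end Tensors

/-! ### Velocities of curves in an orbit. -/

section Orbits

open Filter Topology Asymptotics

variable {n k : ℕ}

/-- An injective map into a second countable space from an interval has an accumulation point. -/
lemma exists_accumulation {X : Type*} [TopologicalSpace X] [SecondCountableTopology X] {ε : ℝ}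
    (hε : 0 < ε) (G : ℝ → X) : ∃ (t₀ : ℝ) (l : Filter ℝ), |t₀| < ε ∧ l.NeBot ∧
      Tendsto id l (𝓝 t₀) ∧ Tendsto G l (𝓝 (G t₀)) ∧ (∀ᶠ t in l, t ≠ t₀) ∧ ∀ᶠ t in l, |t| < ε := by
  let ι := {t : ℝ // |t| < ε}
  let f : ι → ℝ × X := fun t => (t, G t)
  -- The interval carries the topology of the graph of `G`. It is second countable and the interval
  -- is uncountable, so it is not discrete; any non-isolated time will do.
  let _ : TopologicalSpace ι := TopologicalSpace.induced f inferInstance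
  have h2 : SecondCountableTopology ι := TopologicalSpace.secondCountableTopology_induced ι (ℝ × X) f
  have hunc : ¬ Countable ι := by
    intro h
    have h3 : (Set.Ioo (-ε) ε).Countable := by
      rw [← Set.countable_coe_iff]
      refine Function.Injective.countable (f := fun t : Set.Ioo (-ε) ε => (⟨t, abs_lt.2 t.2⟩ : ι))
        fun s t h => Subtype.ext (congrArg (fun x : ι => x.1) h)
    have h4 := Cardinal.mk_Ioo_real (show -ε < ε by linarith)
    have h5 := (Cardinal.le_aleph0_iff_set_countable.2 h3)
    rw [h4] at h5
    exact absurd h5 (not_le.2 Cardinal.aleph0_lt_continuum)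
  obtain ⟨t₀, ht₀⟩ : ∃ t₀ : ι, (𝓝[≠] t₀).NeBot := by
    by_contra! h
    have : DiscreteTopology ι := discreteTopology_iff_isOpen_singleton.2 fun t => by
      rw [isOpen_singleton_iff_punctured_nhds]
      exact h t
    exact hunc (TopologicalSpace.separableSpace_iff_countable.1 inferInstance)
  have hf : Tendsto f (𝓝[≠] t₀) (𝓝 (f t₀)) := continuous_induced_dom.continuousAt.mono_left inf_le_left
  refine ⟨t₀, map (fun t : ι => (t : ℝ)) (𝓝[≠] t₀), t₀.2, ht₀.map _, ?_, ?_, ?_, ?_⟩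
  · exact tendsto_map'_iff.2 ((continuous_fst.tendsto _).comp hf)
  · exact tendsto_map'_iff.2 ((continuous_snd.tendsto _).comp hf)
  · rw [eventually_map]
    filter_upwards [self_mem_nhdsWithin] with t ht h
    exact ht (Subtype.ext h)
  · rw [eventually_map]
    exact .of_forall fun t => t.2

/-- Injectivity of `ρ` bounds `u t - e` by `c t - c t₀`, hence by a multiple of `t - t₀`. Then `ρ`
applied to the difference quotients of `u` tends to `c'`, although the quotients are not known in
advance to converge, and the range of `ρ` is closed. -/
lemma mem_range_of_hasFDerivAt {E F : Type*} [NormedAddCommGroup E] [NormedSpace ℝ E]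
    [FiniteDimensional ℝ E] [NormedAddCommGroup F] [NormedSpace ℝ F] [FiniteDimensional ℝ F]
    {Φ : E → F} {ρ : E →L[ℝ] F} {e : E} (hΦ : HasFDerivAt Φ ρ e) (hρ : Function.Injective ρ)
    {c : ℝ → F} {c' : F} {t₀ : ℝ} (hc : HasDerivAt c c' t₀) {l : Filter ℝ} [l.NeBot]
    (ht : Tendsto id l (𝓝 t₀)) (hne : ∀ᶠ t in l, t ≠ t₀) {u : ℝ → E} (hu : Tendsto u l (𝓝 e))
    (h : ∀ᶠ t in l, c t = Φ (u t)) (h₀ : c t₀ = Φ e) : c' ∈ Set.range ρ := by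
  obtain ⟨K, -, hK⟩ := LinearMap.exists_antilipschitzWith (ρ : E →ₗ[ℝ] F) (LinearMap.ker_eq_bot.2 hρ)
  have h1 : (fun t => u t - e) =O[l] fun t => ρ (u t - e) :=
    IsBigO.of_bound K (.of_forall fun t => ContinuousLinearMap.bound_of_antilipschitz ρ hK _)
  have h2 : (fun t => Φ (u t) - Φ e - ρ (u t - e)) =o[l] fun t => u t - e :=
    hΦ.isLittleO.comp_tendsto hu
  have h3 : (fun t => ρ (u t - e)) =O[l] fun t => c t - c t₀ := by
    refine ((h2.trans_isBigO h1).right_isBigO_add).congr' .rfl ?_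
    filter_upwards [h] with t ht
    rw [ht, h₀]
    abel
  have h4 : (fun t => c t - c t₀) =O[l] fun t => t - t₀ := hc.isBigO_sub.comp_tendsto ht
  have h5 : (fun t => Φ (u t) - Φ e - ρ (u t - e)) =o[l] fun t => t - t₀ :=
    h2.trans_isBigO (h1.trans (h3.trans h4))
  have h6 : (fun t => c t - c t₀ - (t - t₀) • c') =o[l] fun t => t - t₀ :=
    hc.isLittleO.comp_tendsto ht
  have h7 : (fun t => (t - t₀) • c' - ρ (u t - e)) =o[l] fun t => t - t₀ := by
    refine (h5.sub h6).congr' ?_ .rfl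
    filter_upwards [h] with t ht
    rw [ht, h₀]
    abel
  have h8 : Tendsto (fun t => (t - t₀)⁻¹ • ((t - t₀) • c' - ρ (u t - e))) l (𝓝 0) := by
    have := h7.norm_left.tendsto_div_nhds_zero
    rw [tendsto_zero_iff_norm_tendsto_zero]
    rw [tendsto_zero_iff_norm_tendsto_zero] at this
    refine this.congr fun t => ?_
    rw [norm_smul, norm_div, norm_norm, norm_inv, div_eq_inv_mul]
  have h9 : Tendsto (fun t => ρ ((t - t₀)⁻¹ • (u t - e))) l (𝓝 c') := by
    have h10 := (tendsto_const_nhds (x := c')).sub h8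
    rw [sub_zero] at h10
    refine h10.congr' ?_
    filter_upwards [hne] with t ht
    rw [smul_sub, inv_smul_smul₀ (sub_ne_zero.2 ht), map_smul, sub_sub_cancel]
  have hcl : IsClosed (Set.range ρ) := (LinearMap.range (ρ : E →ₗ[ℝ] F)).closed_of_finiteDimensional
  exact hcl.mem_of_tendsto h9 (.of_forall fun t => ⟨_, rfl⟩)

/-- The velocity of a curve in an orbit is tangent to the orbit. -/
theorem exists_tensorAction_eq_of_orbit {c c' : ℝ → (Fin k → Fin n) → ℝ}
    (hc : ∀ᶠ t in 𝓝 0, HasDerivAt c (c' t) t) (hc' : ContinuousAt c' 0)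
    (hsymm : ∀ᶠ t in 𝓝 0, ∀ (τ : Equiv.Perm (Fin k)) w, tensorOf (c t) (w ∘ τ) = tensorOf (c t) w)
    {h : (Fin n → ℝ) → ℝ} (hd : Differentiable ℝ h) (hiso : HasTrivialIsotropy h)
    (horb : ∀ᶠ t in 𝓝 0, ∃ G : (Fin n → ℝ) ≃L[ℝ] (Fin n → ℝ),
      ∀ w, tensorOf (c t) (fun _ => w) = h (G w)) :
    ∃ B, tensorAction (c 0) B = c' 0 := by
  have hinj : ∀ᶠ t in 𝓝 0, Function.Injective (tensorAction (c t)) := by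
    filter_upwards [horb] with t ⟨G, hG⟩
    refine injective_tensorAction ?_
    rw [show (fun w => tensorOf (c t) fun _ => w) = h ∘ G from funext hG]
    exact hiso.comp hd G
  refine mem_range_of_frequently (R := fun t => tensorAction (c t)) (b := c')
    -- It suffices to prove tangency at times arbitrarily close to `0`.
    (tensorAction.continuous.continuousAt.comp hc.self_of_nhds.continuousAt) hc'
    hinj.self_of_nhds ?_
  rw [Metric.nhds_basis_ball.frequently_iff]
  intro ε₀ hε₀
  have hall := (((hc.and hsymm).and horb).and hinj).and (Metric.ball_mem_nhds (0 : ℝ) hε₀)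
  obtain ⟨ε, hε, hball⟩ := Metric.eventually_nhds_iff_ball.1 hall
  have hball' : ∀ t : ℝ, |t| < ε → _ := fun t ht => hball t (by simpa using ht)
  choose! G hG using fun (t : ℝ) (ht : |t| < ε) => (hball' t ht).1.1.2
  obtain ⟨t₀, l, ht₀, hl, hid, hGl, hne, hlε⟩ := exists_accumulation hε
    fun t => (G t : (Fin n → ℝ) →L[ℝ] (Fin n → ℝ))
  refine ⟨t₀, (hball' t₀ ht₀).2, ?_⟩
  -- The element `G(t₀)⁻¹ G(t)` carries the tensor at `t₀` to the one at `t` and tends to the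
  -- identity along `l`.
  let u : ℝ → (Fin n → ℝ) →L[ℝ] (Fin n → ℝ) := fun t =>
    ((G t₀).symm : (Fin n → ℝ) →L[ℝ] (Fin n → ℝ)) ∘L (G t : (Fin n → ℝ) →L[ℝ] (Fin n → ℝ))
  have hu₀ : u t₀ = 1 := by ext1 w; simp [u]
  have hu : Tendsto u l (𝓝 1) := by
    rw [← hu₀]
    exact ((continuous_const.clm_comp continuous_id).tendsto _).comp hGl
  have key : ∀ t, |t| < ε → c t = fun I => tensorOf (c t₀) fun m => u t (Pi.single (I m) 1) := by
    intro t ht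
    refine tensorOf_symm_of_eq (hball' t₀ ht₀).1.1.1.2 (hball' t ht).1.1.1.2 (u t) fun w => ?_
    rw [hG t ht, hG t₀ ht₀]
    simp [u]
  refine mem_range_of_hasFDerivAt (hasFDerivAt_tensorOf_single (c t₀)) (hball' t₀ ht₀).1.2
    (hball' t₀ ht₀).1.1.1.1 hid hne hu ?_ ?_
  · filter_upwards [hlε] with t ht using key t ht
  · rw [← hu₀]
    exact key t₀ ht₀

end Orbits

/-! ### Function-linear maps act pointwise. -/

section FrameExpansion

open Filter Topology

variable {n : ℕ} {M : Type*} [TopologicalSpace M] [ChartedSpace (EuclideanSpace ℝ (Fin n)) M]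
  [IsManifold (𝓡 n) ∞ M]

instance (x : M) : T2Space (TangentSpace (𝓡 n) x) :=
  inferInstanceAs (T2Space (EuclideanSpace ℝ (Fin n)))

@[simp] lemma ContMDiffMap.sub_apply_real (f g : C^∞⟮𝓡 n, M; ℝ⟯) (x : M) :
    (f - g) x = f x - g x := rfl

@[simp] lemma ContMDiffMap.prod_apply_real {ι : Type*} (t : Finset ι) (g : ι → C^∞⟮𝓡 n, M; ℝ⟯)
    (x : M) : (∏ i ∈ t, g i) x = ∏ i ∈ t, g i x := by
  classical
  induction t using Finset.induction_on with
  | empty => simp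
  | insert i t hi ih => rw [Finset.prod_insert hi, Finset.prod_insert hi, ← ih]; rfl

/-- The derivative of a function along a vector field. -/
def lieDeriv (X : VectorFields n M) (f : C^∞⟮𝓡 n, M; ℝ⟯) : C^∞⟮𝓡 n, M; ℝ⟯ := (dForm f).pair X

@[simp] lemma lieDeriv_apply (X : VectorFields n M) (f : C^∞⟮𝓡 n, M; ℝ⟯) (x : M) :
    lieDeriv X f x = mvfderiv (𝓡 n) f x (X x) := rfl

/-- The functions, as a module with connection. -/
def functionConnection : KoszulConnection (𝔛 := VectorFields n M) C^∞⟮𝓡 n, M; ℝ⟯ lieDeriv where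
  toHom :=
    { toFun := fun X =>
        { toFun := lieDeriv X
          map_zero' := by
            ext x
            have := congrArg (fun α : Cotangent n x => α (X x)) (diffAt (n := n) x).map_zero
            exact this
          map_add' := fun f g => by
            ext x
            have := congrArg (fun α : Cotangent n x => α (X x)) ((diffAt (n := n) x).map_add f g)
            exact this }
      map_add' := fun X Y => by
        ext f x
        exact map_add (mvfderiv (𝓡 n) f x) (X x) (Y x)
      map_smul' := fun g X => by
        ext f x
        exact map_smul (mvfderiv (𝓡 n) f x) (g x) (X x) }
  leibniz X f g := by
    ext x
    change mvfderiv (𝓡 n) (f * g : C^∞⟮𝓡 n, M; ℝ⟯) x (X x) = f x * mvfderiv (𝓡 n) g x (X x) +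
      mvfderiv (𝓡 n) f x (X x) * g x
    rw [mvfderiv_fn_mul]
    simp [mul_comm]

namespace IsDualFrame

variable [T2Space M] {f : Fin n → C^∞⟮𝓡 n, M; ℝ⟯} {Z : Fin n → VectorFields n M} {x : M}

lemma exists_vectorField_expansion (h : ∀ᶠ y in 𝓝 x, IsDualFrame f Z y) :
    ∃ χ : C^∞⟮𝓡 n, M; ℝ⟯, χ x = 1 ∧
      ∀ Y : VectorFields n M, χ • Y = ∑ a, (χ * (dForm (f a)).pair Y) • Z a := by
  obtain ⟨χ, h1, h2⟩ := exists_bump (n := n) h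
  refine ⟨χ, h1.self_of_nhds, fun Y => ?_⟩
  ext1 y
  rw [ContMDiffSection.sum_apply]
  change χ y • Y y = ∑ a, (χ y * mvfderiv (𝓡 n) (f a) y (Y y)) • Z a y
  simp only [mul_smul, ← Finset.smul_sum]
  by_cases hy : y ∈ tsupport χ
  · rw [← (h2 hy : IsDualFrame f Z y).sum_smul (Y y)]
  · rw [image_eq_zero_of_notMem_tsupport hy, zero_smul, zero_smul]

lemma exists_oneForm_expansion (h : ∀ᶠ y in 𝓝 x, IsDualFrame f Z y) :
    ∃ χ : C^∞⟮𝓡 n, M; ℝ⟯, χ x = 1 ∧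
      ∀ θ : OneForms n M, χ • θ = ∑ a, (χ * θ.pair (Z a)) • dForm (f a) := by
  obtain ⟨χ, h1, h2⟩ := exists_bump (n := n) h
  refine ⟨χ, h1.self_of_nhds, fun θ => ?_⟩
  ext1 y
  rw [ContMDiffSection.sum_apply]
  change χ y • θ y = ∑ a, (χ y * θ y (Z a y)) • mvfderiv (𝓡 n) (f a) y
  simp only [mul_smul, ← Finset.smul_sum]
  by_cases hy : y ∈ tsupport χ
  · rw [← (h2 hy : IsDualFrame f Z y).sum_smul_dual (θ y)]
  · rw [image_eq_zero_of_notMem_tsupport hy, zero_smul, zero_smul]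

/-- Maps which are linear over the functions act pointwise. -/
lemma linearMap_apply {S N : Type*} [AddCommGroup S] [Module C^∞⟮𝓡 n, M; ℝ⟯ S] [AddCommGroup N]
    [Module ℝ N] (h : ∀ᶠ y in 𝓝 x, IsDualFrame f Z y) (ev : S →+ N)
    (hev : ∀ (g : C^∞⟮𝓡 n, M; ℝ⟯) s, ev (g • s) = g x • ev s)
    (T : VectorFields n M →ₗ[C^∞⟮𝓡 n, M; ℝ⟯] S) (Y : VectorFields n M) :
    ev (T Y) = ∑ a, mvfderiv (𝓡 n) (f a) x (Y x) • ev (T (Z a)) := by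
  obtain ⟨χ, h1, h2⟩ := exists_vectorField_expansion h
  have := congrArg (fun Y => ev (T Y)) (h2 Y)
  simp only [map_smul, map_sum, hev, h1, one_smul, ContMDiffMap.mul_apply_real, one_mul] at this
  exact this

/-- Multilinear maps over the functions act pointwise. -/
lemma multilinearMap_apply {S N : Type*} [AddCommGroup S] [Module C^∞⟮𝓡 n, M; ℝ⟯ S]
    [AddCommGroup N] [Module ℝ N] {k : ℕ} (h : ∀ᶠ y in 𝓝 x, IsDualFrame f Z y) (ev : S →+ N)
    (hev : ∀ (g : C^∞⟮𝓡 n, M; ℝ⟯) s, ev (g • s) = g x • ev s)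
    (T : MultilinearMap C^∞⟮𝓡 n, M; ℝ⟯ (fun _ : Fin k => VectorFields n M) S)
    (Y : Fin k → VectorFields n M) :
    ev (T Y) = ∑ I : Fin k → Fin n, (∏ m, mvfderiv (𝓡 n) (f (I m)) x (Y m x)) •
      ev (T fun m => Z (I m)) := by
  obtain ⟨χ, h1, h2⟩ := exists_vectorField_expansion h
  have := congrArg (fun Y => ev (T Y)) (funext fun m => h2 (Y m))
  simp only [T.map_sum, T.map_smul_univ, map_sum, hev, ContMDiffMap.prod_apply_real,
    ContMDiffMap.mul_apply_real] at this
  simpa [h1] using this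

/-- Multilinear maps over the functions act pointwise. -/
lemma multilinearMap_apply_oneForms {k : ℕ} (h : ∀ᶠ y in 𝓝 x, IsDualFrame f Z y)
    (T : MultilinearMap C^∞⟮𝓡 n, M; ℝ⟯ (fun _ : Fin k => OneForms n M) C^∞⟮𝓡 n, M; ℝ⟯)
    (θ : Fin k → OneForms n M) :
    T θ x = ∑ I : Fin k → Fin n, (∏ m, θ m x (Z (I m) x)) * T (fun m => dForm (f (I m))) x := by
  obtain ⟨χ, h1, h2⟩ := exists_oneForm_expansion h
  have := congrArg (fun Y => T Y x) (funext fun m => h2 (θ m))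
  simp only [T.map_sum, T.map_smul_univ, ContMDiffMap.sum_apply_real, smul_eq_mul,
    ContMDiffMap.mul_apply_real, ContMDiffMap.prod_apply_real] at this
  simpa [h1] using this

/-- A multilinear form on covectors in terms of a frame. -/
lemma tensor_apply {k : ℕ} (h : IsDualFrame f Z x)
    (τ : MultilinearMap ℝ (fun _ : Fin k => Cotangent n x) ℝ) (α : Fin k → Cotangent n x) :
    τ α = ∑ I : Fin k → Fin n, (∏ m, α m (Z (I m) x)) *
      τ fun m => mvfderiv (𝓡 n) (f (I m)) x := by
  conv_lhs => rw [show α = fun m => ∑ a, α m (Z a x) • mvfderiv (𝓡 n) (f a) x from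
    funext fun m => h.sum_smul_dual (α m)]
  rw [τ.map_sum]
  exact Finset.sum_congr rfl fun I _ => by rw [τ.map_smul_univ]; rfl

end IsDualFrame

variable [T2Space M]

lemma exists_vectorField_eq {x : M} (v : TangentSpace (𝓡 n) x) : ∃ Y : VectorFields n M, Y x = v := by
  obtain ⟨f, Z, h⟩ := exists_isDualFrame (n := n) x
  refine ⟨∑ a, mvfderiv (𝓡 n) (f a) x v • Z a, ?_⟩
  rw [ContMDiffSection.sum_apply]
  exact (h.self_of_nhds.sum_smul v).symm

lemma exists_oneForm_eq {x : M} (α : Cotangent n x) : ∃ θ : OneForms n M, θ x = α := by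
  obtain ⟨L, hL⟩ := exists_diffAt_rightInverse (n := n) x
  exact ⟨dForm (L α), hL α⟩

lemma OneForms.ext_pair {θ θ' : OneForms n M} (h : ∀ Y : VectorFields n M, θ.pair Y = θ'.pair Y) :
    θ = θ' := by
  ext x v
  obtain ⟨Y, rfl⟩ := exists_vectorField_eq v
  exact congrArg (fun f : C^∞⟮𝓡 n, M; ℝ⟯ => f x) (h Y)

/-- Linearity over functions makes the value at a point depend only on the vector there, and
smoothness is tested on vector fields. -/
lemma exists_oneForm_of_linearMap (T : VectorFields n M →ₗ[C^∞⟮𝓡 n, M; ℝ⟯] C^∞⟮𝓡 n, M; ℝ⟯) :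
    ∃ θ : OneForms n M, ∀ Y, θ.pair Y = T Y := by
  have key : ∀ x : M, ∃ η : Cotangent n x, ∀ Y, η (Y x) = T Y x := by
    intro x
    obtain ⟨f, Z, h⟩ := exists_isDualFrame (n := n) x
    let ev : C^∞⟮𝓡 n, M; ℝ⟯ →+ ℝ :=
      { toFun := fun g => g x, map_zero' := rfl, map_add' := fun _ _ => rfl }
    refine ⟨∑ a, T (Z a) x • mvfderiv (𝓡 n) (f a) x, fun Y => ?_⟩
    have := IsDualFrame.linearMap_apply h ev (fun _ _ => rfl) T Y
    change T Y x = _ at this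
    rw [this, sum_apply]
    exact Finset.sum_congr rfl fun a _ => mul_comm _ _
  choose η hη using key
  refine ⟨⟨η, contMDiff_oneForm_of_apply η fun Y => ?_⟩, fun Y => ?_⟩
  · simp only [hη]
    exact (T Y).contMDiff
  · ext x
    exact hη x Y

end FrameExpansion

/-! ### Smooth connections as algebraic ones, and the dual connection. -/

section CovariantDerivatives

open Filter Topology

variable {n : ℕ} {M : Type*} [TopologicalSpace M] [ChartedSpace (EuclideanSpace ℝ (Fin n)) M]
  [IsManifold (𝓡 n) ∞ M]
  {F : Type*} [NormedAddCommGroup F] [NormedSpace ℝ F]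
  {V : M → Type*} [TopologicalSpace (TotalSpace F V)]
  [∀ x, AddCommGroup (V x)] [∀ x, Module ℝ (V x)] [∀ x, TopologicalSpace (V x)]
  [∀ x, IsTopologicalAddGroup (V x)] [∀ x, ContinuousSMul ℝ (V x)]
  [FiberBundle F V] [VectorBundle ℝ F V] [ContMDiffVectorBundle ∞ F V (𝓡 n)]

lemma ContMDiffSection.mdiffAt (s : ContMDiffSection (𝓡 n) F ∞ V) (x : M) :
    MDifferentiableAt (𝓡 n) ((𝓡 n).prod 𝓘(ℝ, F)) (fun y => TotalSpace.mk' F y (s y)) x :=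
  (s.contMDiff x).mdifferentiableAt (by simp)

namespace CovariantDerivative

variable (D : CovariantDerivative (𝓡 n) F V) (hD : D.ContMDiffCovariantDerivative ∞)

/-- The covariant derivative of a smooth section along a smooth vector field. -/
def applySection (X : VectorFields n M) (s : ContMDiffSection (𝓡 n) F ∞ V) :
    ContMDiffSection (𝓡 n) F ∞ V where
  toFun y := D s y (X y)
  contMDiff_toFun := by
    have h : ContMDiffOn (𝓡 n) ((𝓡 n).prod 𝓘(ℝ, EuclideanSpace ℝ (Fin n) →L[ℝ] F)) ∞
      (fun x => TotalSpace.mk' (EuclideanSpace ℝ (Fin n) →L[ℝ] F)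
        (E := fun x : M => TangentSpace (𝓡 n) x →L[ℝ] V x) x (D s x)) Set.univ :=
      hD.contMDiff.contMDiff (by rw [contMDiffOn_univ]; simpa using s.contMDiff)
    rw [contMDiffOn_univ] at h
    exact h.clm_bundle_apply X.contMDiff

/-- A smooth covariant derivative as a connection in the module of smooth sections. -/
def koszul : KoszulConnection (𝔛 := VectorFields n M) (ContMDiffSection (𝓡 n) F ∞ V) lieDeriv where
  toHom :=
    { toFun := fun X => AddMonoidHom.mk' (D.applySection hD X) fun s t => by
        ext x
        have := D.isCovariantDerivativeOnUniv.add (s.mdiffAt x) (t.mdiffAt x)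
        exact congrArg (fun T => T (X x)) this
      map_add' := fun X Y => by
        ext s x
        exact map_add (D s x) (X x) (Y x)
      map_smul' := fun g X => by
        ext s x
        exact map_smul (D s x) (g x) (X x) }
  leibniz X f s := by
    ext x
    have := D.isCovariantDerivativeOnUniv.leibniz (s.mdiffAt x) (f.mdifferentiableAt (x := x))
    exact congrArg (fun T => T (X x)) this

lemma koszul_apply (X : VectorFields n M) (s : ContMDiffSection (𝓡 n) F ∞ V) (x : M) :
    (D.koszul hD).toHom X s x = D s x (X x) := rfl

end CovariantDerivative

variable [T2Space M] (W : AffineConnection n M) (hW : W.ContMDiffCovariantDerivative ∞)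

/-- The two Leibniz terms cancel, so the right-hand side is linear over functions in `Y`. -/
lemma AffineConnection.exists_isCovDerivForm (X : VectorFields n M) (θ : OneForms n M) :
    ∃ η : OneForms n M, ∀ Y, η.pair Y = lieDeriv X (θ.pair Y) - θ.pair (W.applySection hW X Y) := by
  refine exists_oneForm_of_linearMap
    { toFun := fun Y => lieDeriv X (θ.pair Y) - θ.pair (W.applySection hW X Y)
      map_add' := fun Y Y' => ?_
      map_smul' := fun g Y => ?_ }
  · have h1 := ((W.koszul hW).toHom X).map_add Y Y'
    have h2 := (functionConnection.toHom X).map_add (θ.pair Y) (θ.pair Y')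
    change W.applySection hW X (Y + Y') = _ at h1
    have h3 : ∀ Y Y' : VectorFields n M, θ.pair (Y + Y') = θ.pair Y + θ.pair Y' := fun Y Y' => by
      ext x; exact map_add (θ x) _ _
    rw [h1, h3, h3]
    change functionConnection.toHom X _ - _ = _
    rw [h2]
    change _ - (_ + θ.pair _) = (functionConnection.toHom X _ - _) + (functionConnection.toHom X _ - _)
    abel
  · have h1 := (W.koszul hW).leibniz X g Y
    have h2 := functionConnection.leibniz X g (θ.pair Y)
    change W.applySection hW X (g • Y) = g • W.applySection hW X Y + _ at h1
    change lieDeriv X _ = g • lieDeriv X _ + _ at h2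
    have h3 : ∀ Y Y' : VectorFields n M, θ.pair (Y + Y') = θ.pair Y + θ.pair Y' := fun Y Y' => by
      ext x; exact map_add (θ x) _ _
    have h4 : ∀ (g : C^∞⟮𝓡 n, M; ℝ⟯) (Y : VectorFields n M), θ.pair (g • Y) = g • θ.pair Y :=
      fun g Y => by ext x; exact map_smul (θ x) (g x) _
    rw [h1, h3, h4, h4, h4, h2, RingHom.id_apply, smul_sub]
    abel

/-- The dual connection on 1-forms. -/
def AffineConnection.dualDeriv (X : VectorFields n M) (θ : OneForms n M) : OneForms n M :=
  (AffineConnection.exists_isCovDerivForm W hW X θ).choose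

lemma AffineConnection.dualDeriv_pair (X : VectorFields n M) (θ : OneForms n M)
    (Y : VectorFields n M) : (dualDeriv W hW X θ).pair Y =
      lieDeriv X (θ.pair Y) - θ.pair (W.applySection hW X Y) :=
  (AffineConnection.exists_isCovDerivForm W hW X θ).choose_spec Y

lemma AffineConnection.dualDeriv_apply (X : VectorFields n M) (θ : OneForms n M)
    (Y : VectorFields n M) (x : M) : dualDeriv W hW X θ x (Y x) =
      mvfderiv (𝓡 n) (fun y => θ y (Y y)) x (X x) - θ x (W Y x (X x)) :=
  congrArg (fun f : C^∞⟮𝓡 n, M; ℝ⟯ => f x) (dualDeriv_pair W hW X θ Y)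

/-- The dual connection on 1-forms. -/
def AffineConnection.dualKoszul :
    KoszulConnection (𝔛 := VectorFields n M) (OneForms n M) lieDeriv where
  toHom :=
    { toFun := fun X => AddMonoidHom.mk' (dualDeriv W hW X) fun θ θ' => by
        refine OneForms.ext_pair fun Y => ?_
        have h : (dualDeriv W hW X θ + dualDeriv W hW X θ').pair Y =
          (dualDeriv W hW X θ).pair Y + (dualDeriv W hW X θ').pair Y := rfl
        have h' : (θ + θ').pair Y = θ.pair Y + θ'.pair Y := rfl
        have h'' : ∀ Y, (θ + θ').pair Y = θ.pair Y + θ'.pair Y := fun _ => rfl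
        have h2 := (functionConnection.toHom X).map_add (θ.pair Y) (θ'.pair Y)
        change lieDeriv X _ = lieDeriv X _ + lieDeriv X _ at h2
        rw [h, dualDeriv_pair, dualDeriv_pair, dualDeriv_pair, h'', h'', h2]
        abel
      map_add' := fun X X' => by
        ext1 θ
        refine OneForms.ext_pair fun Y => ?_
        ext x
        change dualDeriv W hW (X + X') θ x (Y x) =
          dualDeriv W hW X θ x (Y x) + dualDeriv W hW X' θ x (Y x)
        simp only [dualDeriv_apply, ContMDiffSection.add_apply', map_add]
        ring
      map_smul' := fun g X => by
        ext1 θ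
        refine OneForms.ext_pair fun Y => ?_
        ext x
        change dualDeriv W hW (g • X) θ x (Y x) = g x * dualDeriv W hW X θ x (Y x)
        simp only [dualDeriv_apply, ContMDiffSection.fn_smul_apply, map_smul, smul_eq_mul]
        ring }
  leibniz X g θ := by
    refine OneForms.ext_pair fun Y => ?_
    have h2 := functionConnection.leibniz X g (θ.pair Y)
    change lieDeriv X (g • θ.pair Y) = g • lieDeriv X _ + lieDeriv X g • _ at h2
    have h : (g • dualDeriv W hW X θ + lieDeriv X g • θ).pair Y =
      g • (dualDeriv W hW X θ).pair Y + lieDeriv X g • θ.pair Y := rfl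
    have h' : ∀ Y, (g • θ).pair Y = g • θ.pair Y := fun _ => rfl
    change (dualDeriv W hW X (g • θ)).pair Y = (g • dualDeriv W hW X θ + lieDeriv X g • θ).pair Y
    rw [h, dualDeriv_pair, dualDeriv_pair, h', h', h2, smul_sub]
    abel

end CovariantDerivatives

/-! ### Symbols of constant type in frame coordinates. -/

section SymbolInFrames

open Filter Topology

variable {n k : ℕ} {M : Type*} [TopologicalSpace M] [ChartedSpace (EuclideanSpace ℝ (Fin n)) M]

lemma apply_update_eq {x : M} [IsManifold (𝓡 n) ∞ M] (θ : Fin k → OneForms n M) (i : Fin k)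
    (η : OneForms n M) :
    (fun j => Function.update θ i η j x) = Function.update (fun j => θ j x) i (η x) := by
  ext1 j
  by_cases h : j = i
  · subst h; simp
  · simp [h]

/-- A tensor field whose values on differentials of functions are smooth. -/
def IsSmoothTensor (σ : TensorField n M k) : Prop :=
  ∀ f : Fin k → C^∞⟮𝓡 n, M; ℝ⟯, ContMDiff (𝓡 n) 𝓘(ℝ, ℝ) ∞
    fun y => σ y fun i => mvfderiv (𝓡 n) (f i) y

/-- The coordinates of a tensor field. -/
def frameCoeff (f : Fin n → C^∞⟮𝓡 n, M; ℝ⟯) (σ : TensorField n M k) (y : M) :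
    (Fin k → Fin n) → ℝ :=
  fun I => σ y fun m => mvfderiv (𝓡 n) (f (I m)) y

/-- The linear combinations of differentials of functions. -/
def coframeMap (f : Fin n → C^∞⟮𝓡 n, M; ℝ⟯) (y : M) : (Fin n → ℝ) →ₗ[ℝ] Cotangent n y :=
  ∑ a, (LinearMap.proj a : (Fin n → ℝ) →ₗ[ℝ] ℝ).smulRight (mvfderiv (𝓡 n) (f a) y)

lemma coframeMap_apply (f : Fin n → C^∞⟮𝓡 n, M; ℝ⟯) (y : M) (w : Fin n → ℝ) :
    coframeMap f y w = ∑ a, w a • mvfderiv (𝓡 n) (f a) y := by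
  simp [coframeMap]

@[simp] lemma coframeMap_single (f : Fin n → C^∞⟮𝓡 n, M; ℝ⟯) (y : M) (a : Fin n) :
    coframeMap f y (Pi.single a 1) = mvfderiv (𝓡 n) (f a) y := by
  rw [coframeMap_apply, Finset.sum_eq_single a]
  · simp
  · intro b _ hb
    rw [Pi.single_eq_of_ne hb, zero_smul]
  · simp

lemma tensorOf_frameCoeff (f : Fin n → C^∞⟮𝓡 n, M; ℝ⟯) (σ : TensorField n M k) (y : M)
    (w : Fin k → Fin n → ℝ) :
    tensorOf (frameCoeff f σ y) w = σ y fun m => coframeMap f y (w m) := by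
  have h := eq_tensorOf ((σ y).compLinearMap fun _ => coframeMap f y)
  simp only [MultilinearMap.compLinearMap_apply, coframeMap_single] at h
  change _ = tensorOf (frameCoeff f σ y) at h
  rw [← h]
  rfl

lemma tensorAction_frameCoeff (f : Fin n → C^∞⟮𝓡 n, M; ℝ⟯) (σ : TensorField n M k) (y : M)
    (B : (Fin n → ℝ) →L[ℝ] (Fin n → ℝ)) (I : Fin k → Fin n) :
    tensorAction (frameCoeff f σ y) B I = ∑ m, σ y (Function.update
      (fun j => mvfderiv (𝓡 n) (f (I j)) y) m (coframeMap f y (B (Pi.single (I m) 1)))) := by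
  rw [tensorAction_apply]
  refine Finset.sum_congr rfl fun m _ => ?_
  rw [tensorOf_frameCoeff]
  congr 1
  ext1 j
  by_cases h : j = m
  · subst h; simp
  · simp [h]

lemma contMDiff_frameCoeff {σ : TensorField n M k} (hσ : IsSmoothTensor σ)
    (f : Fin n → C^∞⟮𝓡 n, M; ℝ⟯) :
    ContMDiff (𝓡 n) 𝓘(ℝ, (Fin k → Fin n) → ℝ) ∞ (frameCoeff f σ) :=
  contMDiff_pi_space.2 fun I => hσ fun m => f (I m)

/-- The linear map with given matrix. -/
def rowMap (β : Fin n → Fin n → ℝ) : (Fin n → ℝ) →L[ℝ] (Fin n → ℝ) :=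
  ∑ a, (ContinuousLinearMap.proj a : (Fin n → ℝ) →L[ℝ] ℝ).smulRight (β a)

@[simp] lemma rowMap_single (β : Fin n → Fin n → ℝ) (a : Fin n) :
    rowMap β (Pi.single a 1) = β a := by
  rw [rowMap, sum_apply, Finset.sum_eq_single a]
  · simp
  · intro b _ hb
    simp [Pi.single_eq_of_ne hb]
  · simp

variable [IsManifold (𝓡 n) ∞ M]

lemma IsDualFrame.coframeMap_apply_eq {f : Fin n → C^∞⟮𝓡 n, M; ℝ⟯} {Z : Fin n → VectorFields n M}
    {y : M} (h : IsDualFrame f Z y) (α : Cotangent n y) :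
    coframeMap f y (fun b => α (Z b y)) = α := by
  rw [coframeMap_apply]
  exact (h.sum_smul_dual α).symm

/-- In the coordinates of a frame, the symbols of constant type lie in the orbit of one function
with trivial isotropy. -/
lemma exists_orbit_of_hasConstantType (hk : k ≠ 0) {σ : TensorField n M k}
    {ϖ : Set ((EuclideanSpace ℝ (Fin n) →L[ℝ] ℝ) → ℝ)} (hϖ : IsRegularOrbit k ϖ)
    (hσ : HasConstantType ϖ σ) :
    ∃ h : (Fin n → ℝ) → ℝ, Differentiable ℝ h ∧ HasTrivialIsotropy h ∧
      ∀ (f : Fin n → C^∞⟮𝓡 n, M; ℝ⟯) (Z : Fin n → VectorFields n M) (y : M), IsDualFrame f Z y →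
        ∃ G : (Fin n → ℝ) ≃L[ℝ] (Fin n → ℝ),
          ∀ w, tensorOf (frameCoeff f σ y) (fun _ => w) = h (G w) := by
  obtain ⟨h, hreg, rfl⟩ := hϖ
  have hd : Differentiable ℝ h := hreg.1.contDiff.differentiable (by simp)
  let κ₀ : (Fin n → ℝ) ≃ₗ[ℝ] (EuclideanSpace ℝ (Fin n) →L[ℝ] ℝ) :=
    { toFun := fun w => ∑ a, w a • EuclideanSpace.proj a
      map_add' := fun w w' => by simp [add_smul, Finset.sum_add_distrib]
      map_smul' := fun c w => by simp [mul_smul, Finset.smul_sum]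
      invFun := fun α a => α (EuclideanSpace.single a 1)
      left_inv := fun w => by
        ext a
        simp [sum_apply]
      right_inv := fun α => by
        ext v
        have hv : v = ∑ a, v a • EuclideanSpace.single a (1 : ℝ) := by
          ext b
          simp [Pi.single_apply]
        conv_rhs => rw [hv]
        simp [sum_apply, mul_comm] }
  let κ := κ₀.toContinuousLinearEquiv
  refine ⟨h ∘ κ, hd.comp κ.differentiable,
    (hreg.hasTrivialIsotropy hk).comp hd κ, fun f Z y hy => ?_⟩
  -- The isomorphism given by the frame, for which coordinate covectors pull back to the `df_a`;
  -- constant type is applied to it.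
  let φ₀ : TangentSpace (𝓡 n) y ≃ₗ[ℝ] EuclideanSpace ℝ (Fin n) :=
    { toFun := fun v => WithLp.toLp 2 fun a => mvfderiv (𝓡 n) (f a) y v
      map_add' := fun v w => by ext a; simp
      map_smul' := fun c v => by ext a; simp
      invFun := fun e => ∑ a, e a • Z a y
      left_inv := fun v => (hy.sum_smul v).symm
      right_inv := fun e => by
        ext a
        simp only [map_sum, map_smul, hy.apply]
        simp }
  let φ := φ₀.toContinuousLinearEquiv
  obtain ⟨g, hg⟩ := hσ y φ
  refine ⟨(κ.trans (g.symm.arrowCongr (ContinuousLinearEquiv.refl ℝ ℝ))).trans κ.symm, fun w => ?_⟩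
  have h1 := congrFun hg (κ w)
  have h2 : (κ w).comp (φ : TangentSpace (𝓡 n) y →L[ℝ] EuclideanSpace ℝ (Fin n)) =
      coframeMap f y w := by
    ext v
    rw [coframeMap_apply]
    change (∑ a, w a • EuclideanSpace.proj a : EuclideanSpace ℝ (Fin n) →L[ℝ] ℝ) (φ₀ v) = _
    rw [sum_apply, sum_apply]
    rfl
  rw [tensorOf_frameCoeff]
  change σ y (fun _ => (κ w).comp (φ : TangentSpace (𝓡 n) y →L[ℝ] EuclideanSpace ℝ (Fin n))) =
    h ((κ w).comp (g : EuclideanSpace ℝ (Fin n) →L[ℝ] EuclideanSpace ℝ (Fin n))) at h1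
  rw [h2] at h1
  rw [h1]
  simp only [Function.comp_apply, ContinuousLinearEquiv.trans_apply,
    ContinuousLinearEquiv.apply_symm_apply]
  congr 1

lemma injective_tensorAction_frameCoeff (hk : k ≠ 0) {σ : TensorField n M k}
    {ϖ : Set ((EuclideanSpace ℝ (Fin n) →L[ℝ] ℝ) → ℝ)} (hϖ : IsRegularOrbit k ϖ)
    (hσ : HasConstantType ϖ σ) {f : Fin n → C^∞⟮𝓡 n, M; ℝ⟯} {Z : Fin n → VectorFields n M} {y : M}
    (hy : IsDualFrame f Z y) : Function.Injective (tensorAction (frameCoeff f σ y)) := by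
  obtain ⟨h, hd, hiso, horb⟩ := exists_orbit_of_hasConstantType hk hϖ hσ
  obtain ⟨G, hG⟩ := horb f Z y hy
  refine injective_tensorAction ?_
  rw [show (fun w => tensorOf (frameCoeff f σ y) fun _ => w) = h ∘ G from funext hG]
  exact hiso.comp hd G

/-- The derivatives of a symbol of constant type are tangent to the orbit. -/
lemma exists_tensorAction_eq_mvfderiv (hk : k ≠ 0) {σ : TensorField n M k}
    (hsm : IsSmoothTensor σ)
    (hsymm : ∀ x (τ : Equiv.Perm (Fin k)) (α : Fin k → Cotangent n x), σ x (α ∘ τ) = σ x α)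
    {ϖ : Set ((EuclideanSpace ℝ (Fin n) →L[ℝ] ℝ) → ℝ)} (hϖ : IsRegularOrbit k ϖ)
    (hσ : HasConstantType ϖ σ) {f : Fin n → C^∞⟮𝓡 n, M; ℝ⟯} {Z : Fin n → VectorFields n M} {x : M}
    (hx : ∀ᶠ y in 𝓝 x, IsDualFrame f Z y) (v : TangentSpace (𝓡 n) x) :
    ∃ B, tensorAction (frameCoeff f σ x) B =
      fun I => mvfderiv (𝓡 n) (fun y => frameCoeff f σ y I) x v := by
  obtain ⟨h, hd, hiso, horb⟩ := exists_orbit_of_hasConstantType hk hϖ hσ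
  let e := extChartAt (𝓡 n) x
  let v' : EuclideanSpace ℝ (Fin n) := v
  -- The curve through `x` is a straight line in the chart centred at `x`, in which the tangent
  -- vector `v` is its own coordinate vector.
  let ℓ : ℝ → EuclideanSpace ℝ (Fin n) := fun t => e x + t • v'
  let γ : ℝ → M := fun t => e.symm (ℓ t)
  have hℓ : ContDiff ℝ ∞ ℓ := contDiff_const.add (ContDiff.smul (f := fun t : ℝ => t) contDiff_id contDiff_const)
  have hℓ0 : ℓ 0 = e x := by simp [ℓ]
  have hγ0 : γ 0 = x := by
    change e.symm (ℓ 0) = x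
    rw [hℓ0]
    exact extChartAt_to_inv x
  have hγ : ContinuousAt γ 0 := by
    refine ContinuousAt.comp (f := ℓ) (g := e.symm) ?_ hℓ.continuous.continuousAt
    rw [hℓ0]
    exact continuousAt_extChartAt_symm x
  have hγx : Tendsto γ (𝓝 0) (𝓝 x) := by rw [← hγ0]; exact hγ
  let c : ℝ → (Fin k → Fin n) → ℝ := fun t => frameCoeff f σ (γ t)
  have hsmI : ∀ I, ContDiffAt ℝ ∞ ((fun y => frameCoeff f σ y I) ∘ e.symm) (e x) := by
    intro I
    have h1 : ContMDiff (𝓡 n) 𝓘(ℝ, ℝ) ∞ fun y => frameCoeff f σ y I := hsm fun m => f (I m)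
    have h2 := (contMDiffAt_iff_of_mem_source (mem_chart_source _ x) (mem_chart_source _ _)).1 (h1 x)
    have h3 := h2.2
    simp only [modelWithCornersSelf_coe, Set.range_id, contDiffWithinAt_univ] at h3
    exact h3
  have hc : ContDiffAt ℝ ∞ c 0 := by
    refine contDiffAt_pi.2 fun I => ?_
    refine ContDiffAt.comp (0 : ℝ) (f := ℓ) (g := (fun y => frameCoeff f σ y I) ∘ e.symm) ?_
      hℓ.contDiffAt
    rw [hℓ0]
    exact hsmI I
  have hc1 : ∀ᶠ t in 𝓝 0, HasDerivAt c (deriv c t) t := by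
    have h1 : ContDiffAt ℝ 1 c 0 := hc.of_le (by norm_num)
    filter_upwards [h1.eventually (by simp)] with t ht
    exact (ht.differentiableAt (by simp)).hasDerivAt
  have hc2 : ContinuousAt (deriv c) 0 := by
    have h1 : ContinuousAt (fun t => fderiv ℝ c t 1) 0 :=
      (hc.continuousAt_fderiv (by simp)).clm_apply continuousAt_const
    exact h1
  have key := exists_tensorAction_eq_of_orbit hc1 hc2 (.of_forall fun t τ w => by
    rw [tensorOf_frameCoeff, tensorOf_frameCoeff]
    exact hsymm _ τ fun m => coframeMap f (γ t) (w m)) hd hiso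
    ((hγx.eventually hx).mono fun t ht => horb f Z _ ht)
  obtain ⟨B, hB⟩ := key
  refine ⟨B, ?_⟩
  change tensorAction (frameCoeff f σ (γ 0)) B = _ at hB
  rw [hγ0] at hB
  rw [hB]
  ext I
  have h1 : HasFDerivAt ((fun y => frameCoeff f σ y I) ∘ e.symm)
      (fderiv ℝ ((fun y => frameCoeff f σ y I) ∘ e.symm) (e x)) (ℓ 0) := by
    rw [hℓ0]
    exact ((hsmI I).differentiableAt (by simp)).hasFDerivAt
  have h2 : HasDerivAt ℓ v' 0 := by
    simpa [ℓ] using ((hasDerivAt_id (0 : ℝ)).smul_const v').const_add (e x)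
  have h3 := h1.comp_hasDerivAt 0 h2
  have h4 : deriv c 0 I = fderiv ℝ ((fun y => frameCoeff f σ y I) ∘ e.symm) (e x) v' := by
    have h5 := hasDerivAt_pi.1 hc1.self_of_nhds I
    exact h5.unique h3
  rw [h4]
  have h6 : MDifferentiableAt (𝓡 n) 𝓘(ℝ, ℝ) (fun y => frameCoeff f σ y I) x :=
    ((hsm fun m => f (I m)) x).mdifferentiableAt (by simp)
  have h7 : (mfderiv (𝓡 n) 𝓘(ℝ, ℝ) (fun y => frameCoeff f σ y I) x :
      EuclideanSpace ℝ (Fin n) →L[ℝ] ℝ) = fderiv ℝ ((fun y => frameCoeff f σ y I) ∘ e.symm) (e x) := by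
    refine h6.mfderiv.trans ?_
    simp only [modelWithCornersSelf_coe, Set.range_id, fderivWithin_univ]
    rfl
  exact (congrArg (fun T : EuclideanSpace ℝ (Fin n) →L[ℝ] ℝ => T v') h7).symm

end SymbolInFrames

/-! ### Perturbing a connection by an endomorphism-valued form. -/

section AddOneForm

variable {n : ℕ} {M : Type*} [TopologicalSpace M] [ChartedSpace (EuclideanSpace ℝ (Fin n)) M]
  [IsManifold (𝓡 n) ∞ M] [T2Space M]
  {F : Type*} [NormedAddCommGroup F] [NormedSpace ℝ F]
  {V : M → Type*} [TopologicalSpace (TotalSpace F V)]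
  [∀ x, AddCommGroup (V x)] [∀ x, Module ℝ (V x)] [∀ x, TopologicalSpace (V x)]
  [∀ x, IsTopologicalAddGroup (V x)] [∀ x, ContinuousSMul ℝ (V x)]
  [FiberBundle F V] [VectorBundle ℝ F V] [ContMDiffVectorBundle ∞ F V (𝓡 n)]

lemma CovariantDerivative.contMDiff_addOneForm {D : CovariantDerivative (𝓡 n) F V}
    (hD : D.ContMDiffCovariantDerivative ∞)
    {A : (x : M) → V x →L[ℝ] TangentSpace (𝓡 n) x →L[ℝ] V x}
    (hA : ∀ (s : ContMDiffSection (𝓡 n) F ∞ V) (X : VectorFields n M),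
      ContMDiff (𝓡 n) ((𝓡 n).prod 𝓘(ℝ, F)) ∞
        (fun y => TotalSpace.mk' F y (A y (s y) (X y)))) :
    (D.addOneForm A).ContMDiffCovariantDerivative ∞ := by
  refine ⟨⟨fun {s} hs => ?_⟩⟩
  have h1 := hD.contMDiff.contMDiff hs
  rw [contMDiffOn_univ] at hs h1 ⊢
  have h2 := contMDiff_hom_of_apply (n := n) (fun x => A x (s x)) fun Y =>
    hA ⟨s, by simpa using hs⟩ Y
  exact h1.add_section h2

end AddOneForm

/-! ### Existence and uniqueness of the Wagner connection. -/

section Wagner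

open Filter Topology

/-- A smooth left inverse applied to `b` gives a smooth candidate, and any solution must equal it.
Solvability is not claimed, only smoothness of solutions known to exist. -/
lemma ContMDiffAt.exists_solution {H M : Type*} [NormedAddCommGroup H] [NormedSpace ℝ H]
    [TopologicalSpace M] [ChartedSpace H M]
    {E F G : Type*} [NormedAddCommGroup E] [NormedSpace ℝ E]
    [FiniteDimensional ℝ E] [NormedAddCommGroup F] [NormedSpace ℝ F] [FiniteDimensional ℝ F]
    [NormedAddCommGroup G] [NormedSpace ℝ G] (T : G →L[ℝ] E →L[ℝ] F) {c : M → G} {b : M → F} {x : M}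
    (hc : ContMDiffAt 𝓘(ℝ, H) 𝓘(ℝ, G) ∞ c x) (hb : ContMDiffAt 𝓘(ℝ, H) 𝓘(ℝ, F) ∞ b x)
    (hx : Function.Injective (T (c x))) :
    ∃ B : M → E, ContMDiffAt 𝓘(ℝ, H) 𝓘(ℝ, E) ∞ B x ∧
      ∀ᶠ y in 𝓝 x, ∀ v, T (c y) v = b y → v = B y := by
  obtain ⟨S, hS, hS'⟩ := exists_contDiffAt_leftInverse hx
  have hR : ContMDiffAt 𝓘(ℝ, H) 𝓘(ℝ, E →L[ℝ] F) ∞ (fun y => T (c y)) x :=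
    (T.contDiff.contMDiff _).comp x hc
  refine ⟨fun y => S (T (c y)) (b y), (hS.contMDiffAt.comp x hR).clm_apply hb, ?_⟩
  filter_upwards [hR.continuousAt.eventually hS'] with y hy v hv
  rw [← hv, hy]

variable {n k : ℕ} {M : Type*} [TopologicalSpace M] [ChartedSpace (EuclideanSpace ℝ (Fin n)) M]
  [IsManifold (𝓡 n) ∞ M] [T2Space M]

lemma contMDiff_tensor_apply {σ : TensorField n M k} (hσ : IsSmoothTensor σ)
    (θ : Fin k → OneForms n M) :
    ContMDiff (𝓡 n) 𝓘(ℝ, ℝ) ∞ fun y => σ y fun i => θ i y := by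
  intro x
  obtain ⟨f, Z, h⟩ := exists_isDualFrame (n := n) x
  have h1 : ContMDiffAt (𝓡 n) 𝓘(ℝ, ℝ) ∞ (fun y => ∑ I : Fin k → Fin n,
      (∏ m, (θ m).pair (Z (I m)) y) * σ y fun m => mvfderiv (𝓡 n) (f (I m)) y) x := by
    refine ContMDiffAt.sum fun I _ => ContMDiffAt.mul ?_ (hσ _ x)
    exact ContMDiffAt.prod fun m _ => ((θ m).pair (Z (I m))).contMDiff x
  refine h1.congr_of_eventuallyEq ?_
  filter_upwards [h] with y hy
  exact hy.tensor_apply (σ y) fun i => θ i y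

/-- A smooth tensor field as a multilinear map of 1-forms. -/
def tensorMap (σ : TensorField n M k) (hσ : IsSmoothTensor σ) :
    MultilinearMap C^∞⟮𝓡 n, M; ℝ⟯ (fun _ : Fin k => OneForms n M) C^∞⟮𝓡 n, M; ℝ⟯ :=
  MultilinearMap.mk' (fun θ => ⟨_, contMDiff_tensor_apply hσ θ⟩)
    (fun θ i η η' => by
      ext y
      change σ y (fun j => Function.update θ i (η + η') j y) =
        σ y (fun j => Function.update θ i η j y) + σ y (fun j => Function.update θ i η' j y)
      rw [apply_update_eq, apply_update_eq, apply_update_eq]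
      exact (σ y).map_update_add _ _ _ _)
    (fun θ i c η => by
      ext y
      change σ y (fun j => Function.update θ i (c • η) j y) =
        c y * σ y (fun j => Function.update θ i η j y)
      rw [apply_update_eq, apply_update_eq]
      exact (σ y).map_update_smul _ _ _ _)

lemma tensorMap_apply (σ : TensorField n M k) (hσ : IsSmoothTensor σ) (θ : Fin k → OneForms n M)
    (x : M) : tensorMap σ hσ θ x = σ x fun i => θ i x := rfl

/-- The covariant derivative of a tensor field. -/
def tensorCovDeriv (W : AffineConnection n M) (hW : W.ContMDiffCovariantDerivative ∞)
    (σ : TensorField n M k) (hσ : IsSmoothTensor σ) : VectorFields n M →ₗ[C^∞⟮𝓡 n, M; ℝ⟯]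
      MultilinearMap C^∞⟮𝓡 n, M; ℝ⟯ (fun _ : Fin k => OneForms n M) C^∞⟮𝓡 n, M; ℝ⟯ :=
  (AffineConnection.dualKoszul W hW).covDeriv functionConnection (tensorMap σ hσ)

lemma tensorCovDeriv_apply (W : AffineConnection n M) (hW : W.ContMDiffCovariantDerivative ∞)
    (σ : TensorField n M k) (hσ : IsSmoothTensor σ) (X : VectorFields n M)
    (θ : Fin k → OneForms n M) (x : M) : tensorCovDeriv W hW σ hσ X θ x =
      mvfderiv (𝓡 n) (fun y => σ y fun j => θ j y) x (X x) -
        ∑ i, σ x (Function.update (fun j => θ j x) i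
          (AffineConnection.dualDeriv W hW X (θ i) x)) := by
  rw [tensorCovDeriv, KoszulConnection.covDeriv_apply, ContMDiffMap.sub_apply_real,
    ContMDiffMap.sum_apply_real]
  refine congrArg₂ _ rfl (Finset.sum_congr rfl fun i _ => ?_)
  rw [tensorMap_apply, apply_update_eq]
  rfl

/-- The matrix of an endomorphism of the tangent space, acting on covectors. -/
def frameMatrix (f : Fin n → C^∞⟮𝓡 n, M; ℝ⟯) (Z : Fin n → VectorFields n M) (x : M)
    (L : TangentSpace (𝓡 n) x →L[ℝ] TangentSpace (𝓡 n) x) : (Fin n → ℝ) →L[ℝ] (Fin n → ℝ) :=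
  rowMap fun a b => mvfderiv (𝓡 n) (f a) x (L (Z b x))

namespace IsDualFrame

variable {f : Fin n → C^∞⟮𝓡 n, M; ℝ⟯} {Z : Fin n → VectorFields n M} {x : M}

lemma tensorAction_frameMatrix (h : IsDualFrame f Z x) (σ : TensorField n M k)
    (L : TangentSpace (𝓡 n) x →L[ℝ] TangentSpace (𝓡 n) x) (I : Fin k → Fin n) :
    tensorAction (frameCoeff f σ x) (frameMatrix f Z x L) I = ∑ m, σ x (Function.update
      (fun j => mvfderiv (𝓡 n) (f (I j)) x) m ((mvfderiv (𝓡 n) (f (I m)) x).comp L)) := by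
  rw [tensorAction_frameCoeff]
  refine Finset.sum_congr rfl fun m _ => ?_
  rw [frameMatrix, rowMap_single]
  have := h.coframeMap_apply_eq ((mvfderiv (𝓡 n) (f (I m)) x).comp L)
  simp only [ContinuousLinearMap.comp_apply] at this
  rw [this]

lemma exists_frameMatrix_eq (h : IsDualFrame f Z x) (B : (Fin n → ℝ) →L[ℝ] (Fin n → ℝ)) :
    ∃ L, frameMatrix f Z x L = B := by
  refine ⟨∑ a, ((coframeMap f x (B (Pi.single a 1))).smulRight (Z a x)), ?_⟩
  refine ContinuousLinearMap.coe_injective (LinearMap.pi_ext' fun a => LinearMap.ext_ring ?_)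
  change rowMap _ (Pi.single a 1) = B (Pi.single a 1)
  rw [rowMap_single]
  ext b
  have h1 : ∀ w, coframeMap f x w (Z b x) = w b := fun w => by
    simp [coframeMap_apply, sum_apply, h.apply]
  simp [sum_apply, h.apply, h1]

lemma apply_eq_sum_frameMatrix (h : IsDualFrame f Z x)
    (L : TangentSpace (𝓡 n) x →L[ℝ] TangentSpace (𝓡 n) x) (v : TangentSpace (𝓡 n) x) :
    L v = ∑ a, ∑ b, (mvfderiv (𝓡 n) (f b) x v * frameMatrix f Z x L (Pi.single a 1) b) •
      Z a x := by
  conv_lhs => rw [h.sum_smul (L v)]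
  refine Finset.sum_congr rfl fun a _ => ?_
  rw [← Finset.sum_smul, frameMatrix, rowMap_single]
  conv_lhs => rw [h.sum_smul v]
  simp

end IsDualFrame

/-- The derivation of the tensor algebra induced by an endomorphism. -/
def tensorDer {x : M} (τ : MultilinearMap ℝ (fun _ : Fin k => Cotangent n x) ℝ)
    (L : TangentSpace (𝓡 n) x →L[ℝ] TangentSpace (𝓡 n) x) (α : Fin k → Cotangent n x) : ℝ :=
  ∑ i, τ (Function.update α i ((α i).comp L))

/-- Both sides are multilinear at `x`, so comparison on the coframe suffices. -/
lemma tensorDer_eq_iff {x : M} {f : Fin n → C^∞⟮𝓡 n, M; ℝ⟯} {Z : Fin n → VectorFields n M}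
    (h : ∀ᶠ y in 𝓝 x, IsDualFrame f Z y) (τ : MultilinearMap ℝ (fun _ : Fin k => Cotangent n x) ℝ)
    (L : TangentSpace (𝓡 n) x →L[ℝ] TangentSpace (𝓡 n) x)
    (T : MultilinearMap C^∞⟮𝓡 n, M; ℝ⟯ (fun _ : Fin k => OneForms n M) C^∞⟮𝓡 n, M; ℝ⟯)
    (hT : ∀ I : Fin k → Fin n, tensorDer τ L (fun m => mvfderiv (𝓡 n) (f (I m)) x) =
      T (fun m => dForm (f (I m))) x) (θ : Fin k → OneForms n M) :
    tensorDer τ L (fun i => θ i x) = T θ x := by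
  obtain ⟨T', hT'⟩ := τ.exists_sum_update
    { toFun := fun α : Cotangent n x => α.comp L
      map_add' := fun _ _ => rfl
      map_smul' := fun _ _ => rfl }
  have h1 : ∀ α, tensorDer τ L α = T' α := fun α => (hT' α).symm
  rw [h1, h.self_of_nhds.tensor_apply T', IsDualFrame.multilinearMap_apply_oneForms h T]
  exact Finset.sum_congr rfl fun I _ => by rw [← hT, h1]

variable {σ : TensorField n M k} {ϖ : Set ((EuclideanSpace ℝ (Fin n) →L[ℝ] ℝ) → ℝ)}

/-- This is trivial isotropy, transported from coordinates to the tangent space. It gives uniqueness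
of the Wagner connection. -/
lemma eq_of_tensorDer_eq (hk : k ≠ 0) (hϖ : IsRegularOrbit k ϖ) (hc : HasConstantType ϖ σ) {x : M}
    {L L' : TangentSpace (𝓡 n) x →L[ℝ] TangentSpace (𝓡 n) x}
    (h : ∀ α, tensorDer (σ x) L α = tensorDer (σ x) L' α) : L = L' := by
  obtain ⟨f, Z, hf⟩ := exists_isDualFrame (n := n) x
  have hx := hf.self_of_nhds
  have h1 : frameMatrix f Z x L = frameMatrix f Z x L' := by
    refine injective_tensorAction_frameCoeff hk hϖ hc hx ?_
    ext I
    rw [hx.tensorAction_frameMatrix, hx.tensorAction_frameMatrix]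
    exact h _
  ext1 v
  rw [hx.apply_eq_sum_frameMatrix L, hx.apply_eq_sum_frameMatrix L', h1]

variable (hk : k ≠ 0) (hsm : IsSmoothTensor σ)
  (hsymm : ∀ x (τ : Equiv.Perm (Fin k)) (α : Fin k → Cotangent n x), σ x (α ∘ τ) = σ x α)
  (hϖ : IsRegularOrbit k ϖ) (hc : HasConstantType ϖ σ)
  (W : AffineConnection n M) (hW : W.ContMDiffCovariantDerivative ∞)

-- In a frame, `∇_X σ` is the derivative of the coefficients minus an infinitesimal action by the
-- matrix of `∇_X df_a`. The first term is tangent to the orbit and the second visibly so, hence the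
-- sum is again an infinitesimal action.
include hk hsymm hϖ hc in
lemma exists_tensorDer_eq (X : VectorFields n M) (x : M) :
    ∃ L, ∀ θ : Fin k → OneForms n M,
      tensorDer (σ x) L (fun i => θ i x) = -tensorCovDeriv W hW σ hsm X θ x := by
  obtain ⟨f, Z, hf⟩ := exists_isDualFrame (n := n) x
  have hx := hf.self_of_nhds
  obtain ⟨B₁, hB₁⟩ := exists_tensorAction_eq_mvfderiv hk hsm hsymm hϖ hc hf (X x)
  obtain ⟨L, hL⟩ := hx.exists_frameMatrix_eq
    (rowMap (fun a b => AffineConnection.dualDeriv W hW X (dForm (f a)) x (Z b x)) - B₁)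
  refine ⟨L, tensorDer_eq_iff hf (σ x) L (-tensorCovDeriv W hW σ hsm X) fun I => ?_⟩
  change _ = -tensorCovDeriv W hW σ hsm X _ x
  rw [tensorCovDeriv_apply, tensorDer, ← hx.tensorAction_frameMatrix σ L I, hL, map_sub, hB₁,
    Pi.sub_apply, tensorAction_frameCoeff, neg_sub]
  refine congrArg₂ _ (Finset.sum_congr rfl fun m _ => ?_) rfl
  rw [rowMap_single]
  exact congrArg (fun η => σ x (Function.update _ m η))
    (hx.coframeMap_apply_eq (AffineConnection.dualDeriv W hW X (dForm (f (I m))) x))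

include hk hsymm hϖ hc in
/-- The difference of the Wagner connection and the given one. -/
lemma exists_tensorDer_eq_linear (x : M) :
    ∃ U : TangentSpace (𝓡 n) x →ₗ[ℝ] TangentSpace (𝓡 n) x →L[ℝ] TangentSpace (𝓡 n) x,
      ∀ (X : VectorFields n M) (θ : Fin k → OneForms n M),
        tensorDer (σ x) (U (X x)) (fun i => θ i x) = -tensorCovDeriv W hW σ hsm X θ x := by
  obtain ⟨f, Z, hf⟩ := exists_isDualFrame (n := n) x
  choose L hL using fun a => exists_tensorDer_eq hk hsm hsymm hϖ hc W hW (Z a) x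
  refine ⟨∑ a, (mvfderiv (𝓡 n) (f a) x).toLinearMap.smulRight (L a), fun X θ => ?_⟩
  have h1 : ∀ (c : Fin n → ℝ) (α : Fin k → Cotangent n x),
      tensorDer (σ x) (∑ a, c a • L a) α = ∑ a, c a * tensorDer (σ x) (L a) α := by
    intro c α
    simp only [tensorDer, Finset.mul_sum]
    rw [Finset.sum_comm]
    refine Finset.sum_congr rfl fun i _ => ?_
    have h2 : (α i).comp (∑ a, c a • L a) = ∑ a, c a • (α i).comp (L a) := by
      ext v
      simp [sum_apply]
    rw [h2, MultilinearMap.map_update_sum]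
    exact Finset.sum_congr rfl fun a _ => (σ x).map_update_smul _ _ _ _
  have h2 := IsDualFrame.linearMap_apply hf
    (AddMonoidHom.mk' (fun T : MultilinearMap C^∞⟮𝓡 n, M; ℝ⟯ (fun _ : Fin k => OneForms n M)
      C^∞⟮𝓡 n, M; ℝ⟯ => T θ x) fun _ _ => rfl) (fun _ _ => rfl) (tensorCovDeriv W hW σ hsm) X
  simp only [AddMonoidHom.mk'_apply, smul_eq_mul] at h2
  simp only [LinearMap.sum_apply, LinearMap.smulRight_apply, ContinuousLinearMap.coe_coe]
  rw [h1, h2, ← Finset.sum_neg_distrib]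
  exact Finset.sum_congr rfl fun a _ => by rw [hL, mul_neg]

-- In a frame, `U` solves an injective linear system whose matrix and right-hand side are smooth.
include hk hϖ hc in
lemma contMDiff_of_tensorDer_eq
    {U : (x : M) → TangentSpace (𝓡 n) x →ₗ[ℝ] TangentSpace (𝓡 n) x →L[ℝ] TangentSpace (𝓡 n) x}
    (hU : ∀ (x : M) (X : VectorFields n M) (θ : Fin k → OneForms n M),
      tensorDer (σ x) (U x (X x)) (fun i => θ i x) = -tensorCovDeriv W hW σ hsm X θ x)
    (X Y : VectorFields n M) :
    ContMDiff (𝓡 n) ((𝓡 n).prod 𝓘(ℝ, EuclideanSpace ℝ (Fin n))) ∞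
      (fun y => TotalSpace.mk' (EuclideanSpace ℝ (Fin n)) y (U y (X y) (Y y))) := by
  intro x
  obtain ⟨f, Z, hf⟩ := exists_isDualFrame (n := n) x
  let b : M → (Fin k → Fin n) → ℝ := fun y I =>
    -tensorCovDeriv W hW σ hsm X (fun m => dForm (f (I m))) y
  have hb : ContMDiffAt (𝓡 n) 𝓘(ℝ, (Fin k → Fin n) → ℝ) ∞ b x :=
    contMDiffAt_pi_space.2 fun I => (-tensorCovDeriv W hW σ hsm X
      (fun m => dForm (f (I m)))).contMDiff x
  obtain ⟨B, hB, hB'⟩ := ContMDiffAt.exists_solution tensorAction (contMDiff_frameCoeff hsm f x) hb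
    (injective_tensorAction_frameCoeff hk hϖ hc hf.self_of_nhds)
  have hBab : ∀ a c : Fin n, ContMDiffAt (𝓡 n) 𝓘(ℝ, ℝ) ∞
      (fun y => B y (Pi.single a 1) c) x := fun a c =>
    contMDiffAt_pi_space.1 (hB.clm_apply contMDiffAt_const) c
  have h1 : ContMDiffAt (𝓡 n) ((𝓡 n).prod 𝓘(ℝ, EuclideanSpace ℝ (Fin n))) ∞
      (fun y => TotalSpace.mk' (EuclideanSpace ℝ (Fin n)) y (∑ a, ∑ c,
        (mvfderiv (𝓡 n) (f c) y (Y y) *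
          B y (Pi.single a 1) c) • Z a y)) x := by
    refine ContMDiffAt.sum_section fun a _ => ContMDiffAt.sum_section fun c _ => ?_
    exact (((lieDeriv Y (f c)).contMDiff x).mul (hBab a c)).smul_section ((Z a).contMDiff x)
  refine h1.congr_of_eventuallyEq ?_
  filter_upwards [hf, hB'] with y hy hSy
  have h2 : tensorAction (frameCoeff f σ y) (frameMatrix f Z y (U y (X y))) = b y := by
    ext I
    rw [hy.tensorAction_frameMatrix]
    exact hU y X fun m => dForm (f (I m))
  rw [hy.apply_eq_sum_frameMatrix (U y (X y)), hSy _ h2]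

variable [SecondCountableTopology M]

-- Adding `U` to the connection subtracts the transpose of `U_X` on 1-forms and so adds `U_X · σ` to
-- `∇_X σ`; `U` was chosen to cancel it.
include hk hsm hsymm hϖ hc in
theorem exists_isWagnerConnection : ∃ W : AffineConnection n M, IsWagnerConnection σ W := by
  obtain ⟨W, hW⟩ := exists_contMDiff_connection n (F := EuclideanSpace ℝ (Fin n))
    (V := (TangentSpace (𝓡 n) : M → Type _))
  choose U hU using exists_tensorDer_eq_linear hk hsm hsymm hϖ hc W hW
  -- The arguments of `U` are exchanged: `addOneForm` takes the differentiated vector first and the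
  -- direction second.
  let A : (x : M) → TangentSpace (𝓡 n) x →L[ℝ] TangentSpace (𝓡 n) x →L[ℝ] TangentSpace (𝓡 n) x :=
    fun x => LinearMap.toContinuousLinearMap
      { toFun := fun v => LinearMap.toContinuousLinearMap
          { toFun := fun u => U x u v
            map_add' := fun u u' => by simp
            map_smul' := fun c u => by simp }
        map_add' := fun v v' => by ext u; exact map_add (U x u) v v'
        map_smul' := fun c v => by ext u; exact map_smul (U x u) c v }
  have hA : ∀ x v u, A x v u = U x u v := fun _ _ _ => rfl
  refine ⟨W.addOneForm A, CovariantDerivative.contMDiff_addOneForm (n := n) (F := EuclideanSpace ℝ (Fin n))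
    (V := (TangentSpace (𝓡 n) : M → Type _)) hW fun s X => ?_, ?_⟩
  · simp only [hA]
    exact contMDiff_of_tensorDer_eq hk hsm hϖ hc W hW hU X s
  · intro X θ η hη x
    have h1 : ∀ i, η i x = AffineConnection.dualDeriv W hW X (θ i) x - (θ i x).comp (U x (X x)) := by
      intro i
      ext v
      obtain ⟨Y, rfl⟩ := exists_vectorField_eq v
      rw [hη i Y x]
      change _ - θ i x (W Y x (X x) + U x (X x) (Y x)) =
        AffineConnection.dualDeriv W hW X (θ i) x (Y x) - θ i x (U x (X x) (Y x))
      rw [AffineConnection.dualDeriv_apply, map_add, sub_add_eq_sub_sub]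
    have h2 := hU x X θ
    rw [tensorCovDeriv_apply, neg_sub, tensorDer] at h2
    simp only [h1, MultilinearMap.map_update_sub, Finset.sum_sub_distrib, h2]
    ring

-- The difference of two connections preserving `σ`, in a fixed direction, is an endomorphism which
-- annihilates `σ` as a derivation.
omit [SecondCountableTopology M] in
include hk hϖ hc in
theorem IsWagnerConnection.sameConnection {W W' : AffineConnection n M}
    (hW : IsWagnerConnection σ W) (hW' : IsWagnerConnection σ W') : SameConnection W' W := by
  intro s x hs
  have hΔ := fun {s} => W'.isCovariantDerivativeOnUniv.difference_apply
    W.isCovariantDerivativeOnUniv (x := x) (σ := s)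
  set Δ := W'.isCovariantDerivativeOnUniv.difference W.isCovariantDerivativeOnUniv x
  rw [← sub_eq_zero, ← hΔ hs]
  ext u
  obtain ⟨X, rfl⟩ := exists_vectorField_eq u
  let L : TangentSpace (𝓡 n) x →L[ℝ] TangentSpace (𝓡 n) x := LinearMap.toContinuousLinearMap
    { toFun := fun v => Δ v (X x)
      map_add' := fun v v' => by simp
      map_smul' := fun c v => by simp }
  suffices hL : L = 0 from congrArg (fun L => L (s x)) hL
  refine eq_of_tensorDer_eq hk hϖ hc fun α => ?_
  choose θ hθ using fun i => exists_oneForm_eq (α i)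
  have h1 := hW.2 X θ (fun i => AffineConnection.dualDeriv W hW.1 X (θ i))
    (fun i Y x => AffineConnection.dualDeriv_apply W hW.1 X (θ i) Y x) x
  have h2 := hW'.2 X θ (fun i => AffineConnection.dualDeriv W' hW'.1 X (θ i))
    (fun i Y x => AffineConnection.dualDeriv_apply W' hW'.1 X (θ i) Y x) x
  have h3 : ∀ i, (θ i x).comp L = AffineConnection.dualDeriv W hW.1 X (θ i) x -
      AffineConnection.dualDeriv W' hW'.1 X (θ i) x := by
    intro i
    ext v
    obtain ⟨Y, rfl⟩ := exists_vectorField_eq v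
    change θ i x (Δ (Y x) (X x)) = AffineConnection.dualDeriv W hW.1 X (θ i) x (Y x) -
      AffineConnection.dualDeriv W' hW'.1 X (θ i) x (Y x)
    rw [AffineConnection.dualDeriv_apply, AffineConnection.dualDeriv_apply,
      hΔ (Y.mdiffAt x)]
    change θ i x (W' Y x (X x) - W Y x (X x)) = _
    rw [map_sub]
    ring
  have h4 : α = fun i => θ i x := funext fun i => (hθ i).symm
  have h5 : tensorDer (σ x) L α = 0 := by
    rw [h4, tensorDer]
    simp only [h3, MultilinearMap.map_update_sub, Finset.sum_sub_distrib]
    rw [← h1, ← h2, sub_self]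
  rw [h5, tensorDer]
  refine (Finset.sum_eq_zero fun i _ => (σ x).map_coord_zero i ?_).symm
  simp

end Wagner

/-! ### Real linearity of the iterated symmetrized derivative. -/

namespace KoszulConnection

variable {R 𝔛 S : Type*} [CommRing R] [AddCommGroup 𝔛] [Module R 𝔛] [AddCommGroup S] [Module R S]
  {δ : 𝔛 → R → R}

lemma symIter_add (W : KoszulConnection 𝔛 δ) (D : KoszulConnection S δ) (s s' : S) (k : ℕ) :
    W.symIter D (s + s') k = W.symIter D s k + W.symIter D s' k := by
  induction k with
  | zero => rfl
  | succ k ih => simp only [symIter, ih, map_add]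

lemma symIter_smul_of_const (W : KoszulConnection 𝔛 δ) (D : KoszulConnection S δ) {f : R}
    (hf : ∀ X, δ X f = 0) (s : S) (k : ℕ) : W.symIter D (f • s) k = f • W.symIter D s k := by
  induction k with
  | zero => rfl
  | succ k ih =>
    rw [symIter, ih, W.symCovDeriv_smul D f 0 fun X => (hf X).symm]
    ext X
    simp [symMul_apply, symIter]

end KoszulConnection

/-! ### The quantization and its leading symbol. -/

section Quantization

open Filter Topology

variable {n : ℕ} {M : Type*} [TopologicalSpace M] [ChartedSpace (EuclideanSpace ℝ (Fin n)) M]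
  {ξ : M → Type*} [TopologicalSpace (TotalSpace ℝ ξ)]
  [∀ x, AddCommGroup (ξ x)] [∀ x, Module ℝ (ξ x)] [∀ x, TopologicalSpace (ξ x)]
  [∀ x, IsTopologicalAddGroup (ξ x)] [∀ x, ContinuousSMul ℝ (ξ x)]
  [FiberBundle ℝ ξ] [VectorBundle ℝ ℝ ξ] [IsManifold (𝓡 n) ∞ M]
  [ContMDiffVectorBundle ∞ ℝ ξ (𝓡 n)]
  {W : AffineConnection n M} (hW : W.ContMDiffCovariantDerivative ∞)
  {D : CovariantDerivative (𝓡 n) ℝ ξ} (hD : D.ContMDiffCovariantDerivative ∞)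

lemma CovariantDerivative.congr_section {F : Type*} [NormedAddCommGroup F] [NormedSpace ℝ F]
    {V : M → Type*} [TopologicalSpace (TotalSpace F V)]
    [∀ x, AddCommGroup (V x)] [∀ x, Module ℝ (V x)] [∀ x, TopologicalSpace (V x)]
    [∀ x, IsTopologicalAddGroup (V x)] [∀ x, ContinuousSMul ℝ (V x)]
    [FiberBundle F V] [VectorBundle ℝ F V] [T2Space M] [ContMDiffVectorBundle ∞ F V (𝓡 n)]
    (D : CovariantDerivative (𝓡 n) F V) {x : M} {s : Π x, V x} (S : ContMDiffSection (𝓡 n) F ∞ V)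
    (h : ∀ᶠ y in 𝓝 x, s y = S y) : D s x = D S x := by
  refine D.isCovariantDerivativeOnUniv.congr_of_eventuallyEq ?_ (S.mdiffAt x) univ_mem h
  refine (S.mdiffAt x).congr_of_eventuallyEq ?_
  filter_upwards [h] with y hy
  rw [hy]

variable [T2Space M]

/-- On fields which are locally smooth, the iterated derivation only depends on germs and is computed
in the module of global sections. -/
lemma symDerivIter_eventuallyEq (s : Sections n ξ) (k : ℕ) {x : M}
    {X : Fin k → (x : M) → TangentSpace (𝓡 n) x} {Y : Fin k → VectorFields n M}
    (h : ∀ j, ∀ᶠ y in 𝓝 x, X j y = Y j y) :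
    ∀ᶠ y in 𝓝 x, symDerivIter W D s k X y = (W.koszul hW).symIter (D.koszul hD) s k Y y := by
  induction k generalizing x with
  | zero => exact .of_forall fun y => rfl
  | succ k ih =>
    have h' : ∀ᶠ y in 𝓝 x, ∀ j, ∀ᶠ z in 𝓝 y, X j z = Y j z :=
      eventually_all.2 fun j => (h j).eventually_nhds
    filter_upwards [h'] with y hy
    change symDeriv W D _ X y = (W.koszul hW).symCovDeriv (D.koszul hD) _ Y y
    rw [KoszulConnection.symCovDeriv_apply, ContMDiffSection.sum_apply]
    refine Finset.sum_congr rfl fun i _ => ?_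
    rw [ContMDiffSection.sub_apply', ContMDiffSection.sum_apply]
    congr 1
    · refine (congrArg (fun T => T (X i y)) (D.congr_section (n := n) _
        (ih (X := i.removeNth X) (Y := i.removeNth Y) fun j => hy _))).trans ?_
      rw [(hy i).self_of_nhds]
      rfl
    · refine Finset.sum_congr rfl fun j _ => (ih fun l => ?_).self_of_nhds
      by_cases hl : l = j
      · subst hl
        simp only [Function.update_self]
        filter_upwards [(hy (i.succAbove l)).eventually_nhds, hy i] with z hz hzi
        rw [hzi, CovariantDerivative.koszul_apply]
        exact congrArg (fun T => T (Y i z)) (W.congr_section (n := n) _ hz)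
      · simp only [Function.update_of_ne hl]
        exact hy _

variable {k : ℕ} {σ : TensorField n M k}

/-- The iterated derivative is multilinear over functions, so the contraction may be computed in any
dual frame instead of the coordinate basis and its local extensions. -/
lemma pairing_symDerivIter {x : M} (τ : MultilinearMap ℝ (fun _ : Fin k => Cotangent n x) ℝ)
    {f : Fin n → C^∞⟮𝓡 n, M; ℝ⟯} {Z : Fin n → VectorFields n M}
    (h : ∀ᶠ y in 𝓝 x, IsDualFrame f Z y) (s : Sections n ξ) :
    pairing x τ (symDerivIter W D s k) = ∑ J : Fin k → Fin n,
      τ (fun m => mvfderiv (𝓡 n) (f (J m)) x) •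
        (W.koszul hW).symIter (D.koszul hD) s k (fun m => Z (J m)) x := by
  have hE : ∀ i : Fin n, ∃ E : VectorFields n M, ∀ᶠ y in 𝓝 x, E y =
      FiberBundle.extend (EuclideanSpace ℝ (Fin n)) (x := x)
        (EuclideanSpace.single i (1 : ℝ) : TangentSpace (𝓡 n) x) y := fun i => by
    obtain ⟨u, hu, hs⟩ := FiberBundle.exists_contMDiffOn_extend (k := ∞) (x₀ := x) (𝓡 n)
      (EuclideanSpace ℝ (Fin n)) (V := (TangentSpace (𝓡 n) : M → Type _))
      (EuclideanSpace.single i (1 : ℝ) : TangentSpace (𝓡 n) x)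
    exact exists_section_eventuallyEq hu hs
  choose E hE using hE
  have hEx : ∀ i, E i x = (EuclideanSpace.single i (1 : ℝ) : TangentSpace (𝓡 n) x) := fun i =>
    (hE i).self_of_nhds.trans (FiberBundle.extend_apply_self _ _)
  have h1 : ∀ I : Fin k → Fin n, symDerivIter W D s k (fun j =>
      FiberBundle.extend (EuclideanSpace ℝ (Fin n)) (x := x)
        (EuclideanSpace.single (I j) (1 : ℝ) : TangentSpace (𝓡 n) x)) x =
      ∑ J : Fin k → Fin n, (∏ m, mvfderiv (𝓡 n) (f (J m)) x (E (I m) x)) •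
        (W.koszul hW).symIter (D.koszul hD) s k (fun m => Z (J m)) x := fun I => by
    rw [(symDerivIter_eventuallyEq hW hD s k (Y := fun j => E (I j)) fun j =>
      (hE (I j)).mono fun y hy => hy.symm).self_of_nhds]
    exact IsDualFrame.multilinearMap_apply h (ContMDiffSection.evalAddHom x) (fun _ _ => rfl) _ _
  simp only [pairing, h1, Finset.smul_sum, smul_smul]
  rw [Finset.sum_comm]
  refine Finset.sum_congr rfl fun J _ => ?_
  rw [← Finset.sum_smul]
  congr 1
  have h2 : ∀ α : Cotangent n x, α = ∑ i, α (E i x) •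
      (EuclideanSpace.proj i : EuclideanSpace ℝ (Fin n) →L[ℝ] ℝ) := fun α => by
    let α' : EuclideanSpace ℝ (Fin n) →L[ℝ] ℝ := α
    have h3 : α' = ∑ i, α' (EuclideanSpace.single i 1) •
        (EuclideanSpace.proj i : EuclideanSpace ℝ (Fin n) →L[ℝ] ℝ) := by
      ext v
      have hv : v = ∑ a, v a • EuclideanSpace.single a (1 : ℝ) := by
        ext b
        simp [Pi.single_apply]
      conv_lhs => rw [hv]
      simp [sum_apply, mul_comm]
    simp only [hEx]
    exact h3
  have h3 : ∀ (p : Fin n → Cotangent n x) (c : Fin k → Fin n → ℝ),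
      ∑ I : Fin k → Fin n, τ (fun j => p (I j)) * ∏ m, c m (I m) =
        τ fun m => ∑ i, c m i • p i := fun p c => by
    rw [τ.map_sum]
    refine Finset.sum_congr rfl fun I _ => ?_
    rw [τ.map_smul_univ, smul_eq_mul, mul_comm]
  exact (h3 _ _).trans (congrArg τ (funext fun m => (h2 _).symm))

lemma quantization_apply {x : M} {f : Fin n → C^∞⟮𝓡 n, M; ℝ⟯} {Z : Fin n → VectorFields n M}
    (h : ∀ᶠ y in 𝓝 x, IsDualFrame f Z y) (s : Sections n ξ) :
    quantization W D σ s x = (1 / (k.factorial : ℝ)) • ∑ J : Fin k → Fin n,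
      σ x (fun m => mvfderiv (𝓡 n) (f (J m)) x) •
        (W.koszul hW).symIter (D.koszul hD) s k (fun m => Z (J m)) x := by
  rw [quantization, pairing_symDerivIter hW hD (σ x) h]

/-- The quantization as an operator on smooth sections. -/
def quantOp (hσ : IsSmoothTensor σ) : Module.End ℝ (Sections n ξ) where
  toFun s := ⟨quantization W D σ s, fun x => by
    obtain ⟨f, Z, h⟩ := exists_isDualFrame (n := n) x
    have h1 : ContMDiffAt (𝓡 n) ((𝓡 n).prod 𝓘(ℝ, ℝ)) ∞ (fun y => TotalSpace.mk' ℝ y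
        ((1 / (k.factorial : ℝ)) • ∑ J : Fin k → Fin n,
          σ y (fun m => mvfderiv (𝓡 n) (f (J m)) y) •
            (W.koszul hW).symIter (D.koszul hD) s k (fun m => Z (J m)) y)) x := by
      refine ContMDiffAt.smul_section (f := fun _ => 1 / (k.factorial : ℝ)) contMDiffAt_const
        (ContMDiffAt.sum_section fun J _ => ?_)
      exact (hσ _ x).smul_section (ContMDiffSection.contMDiff _ x)
    refine h1.congr_of_eventuallyEq ?_
    filter_upwards [h.eventually_nhds] with y hy
    rw [quantization_apply hW hD hy]⟩
  map_add' s t := by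
    ext x
    obtain ⟨f, Z, h⟩ := exists_isDualFrame (n := n) x
    change quantization W D σ (s + t : Sections n ξ) x =
      quantization W D σ s x + quantization W D σ t x
    simp only [quantization_apply hW hD h, KoszulConnection.symIter_add, add_apply,
      ContMDiffSection.add_apply', smul_add, Finset.sum_add_distrib]
  map_smul' c s := by
    ext x
    obtain ⟨f, Z, h⟩ := exists_isDualFrame (n := n) x
    let g : C^∞⟮𝓡 n, M; ℝ⟯ := ⟨fun _ => c, contMDiff_const⟩
    have hg : ∀ X : VectorFields n M, lieDeriv X g = 0 := fun X => by
      ext y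
      rw [lieDeriv_apply]
      change mvfderiv (𝓡 n) (fun _ : M => c) y (X y) = 0
      rw [mvfderiv_const]
      rfl
    change quantization W D σ (g • s : Sections n ξ) x = c • quantization W D σ s x
    simp only [quantization_apply hW hD h, KoszulConnection.symIter_smul_of_const _ _ hg,
      smul_apply, ContMDiffSection.fn_smul_apply]
    change _ • ∑ J, _ • c • _ = _
    simp only [Finset.smul_sum, smul_comm c]

/-- Contraction with `σ` is pointwise, so commutators with `g` pass through it. -/
lemma commMap_quantOp_diag (hσ : IsSmoothTensor σ) {x : M} {f : Fin n → C^∞⟮𝓡 n, M; ℝ⟯}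
    {Z : Fin n → VectorFields n M} (h : ∀ᶠ y in 𝓝 x, IsDualFrame f Z y) (j : ℕ)
    (g : C^∞⟮𝓡 n, M; ℝ⟯) (s : Sections n ξ) :
    commMap j (quantOp hW hD hσ) (fun _ => g) s x =
      (1 / (k.factorial : ℝ)) • ∑ J : Fin k → Fin n,
        σ x (fun m => mvfderiv (𝓡 n) (f (J m)) x) •
          diagComm g j (fun s => (W.koszul hW).symIter (D.koszul hD) s k) s (fun m => Z (J m)) x := by
  induction j generalizing s with
  | zero => exact quantization_apply hW hD h s
  | succ j ih =>
    rw [commMap_diag_succ, ContMDiffSection.sub_apply', ContMDiffSection.fn_smul_apply, ih, ih,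
      smul_comm (g x), Finset.smul_sum (r := g x), ← smul_sub, ← Finset.sum_sub_distrib]
    refine congrArg _ (Finset.sum_congr rfl fun J _ => ?_)
    rw [smul_comm (g x), ← smul_sub]
    rfl

/-- A 1-form as a linear form on vector fields. -/
def OneForms.pairLinear (θ : OneForms n M) : VectorFields n M →ₗ[C^∞⟮𝓡 n, M; ℝ⟯] C^∞⟮𝓡 n, M; ℝ⟯ where
  toFun Y := θ.pair Y
  map_add' Y Y' := by ext x; exact map_add (θ x) _ _
  map_smul' c Y := by ext x; exact map_smul (θ x) (c x) (Y x)

/-- The factor `1/k!` of the quantization turns the `(k!)^2` of `diagComm_symIter_self` into the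
`k!` of the symbol convention. -/
lemma commMap_quantOp_self (hσ : IsSmoothTensor σ) (g : C^∞⟮𝓡 n, M; ℝ⟯) (s : Sections n ξ) (x : M) :
    commMap k (quantOp hW hD hσ) (fun _ => g) s x =
      ((k.factorial : ℝ) * σ x fun _ => mvfderiv (𝓡 n) g x) • s x := by
  obtain ⟨f, Z, h⟩ := exists_isDualFrame (n := n) x
  rw [commMap_quantOp_diag hW hD hσ h]
  have h1 : ∀ J : Fin k → Fin n, diagComm g k (fun s => (W.koszul hW).symIter (D.koszul hD) s k) s
      (fun m => Z (J m)) x = ((k.factorial * k.factorial : ℝ) *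
        ∏ m, mvfderiv (𝓡 n) g x (Z (J m) x)) • s x := by
    intro J
    rw [KoszulConnection.diagComm_symIter_self _ _ g (dForm g).pairLinear fun _ => rfl]
    change (ContMDiffSection.evalAddHom x) (_ • _) = _
    rw [map_nsmul, ← Nat.cast_smul_eq_nsmul ℝ, Nat.cast_mul,
      mul_smul ((k.factorial : ℝ) * k.factorial)]
    congr 1
    change (∏ i, (dForm g).pairLinear (Z (J i)) : C^∞⟮𝓡 n, M; ℝ⟯) x • s x = _
    rw [ContMDiffMap.prod_apply_real]
    rfl
  have hk : (k.factorial : ℝ) ≠ 0 := by positivity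
  simp only [h1]
  rw [h.self_of_nhds.tensor_apply (σ x), Finset.mul_sum, Finset.sum_smul, Finset.smul_sum]
  refine Finset.sum_congr rfl fun J _ => ?_
  rw [smul_smul, smul_smul]
  congr 1
  field_simp

/-- An operator and the quantization of its symbol have the same symbol. -/
lemma commMap_sub_quantOp_eq_zero {A : Module.End ℝ (Sections n ξ)}
    (hA : IsSymbolOf k (fun s => A s) σ) (hσ : IsSmoothTensor σ) :
    commMap (R := C^∞⟮𝓡 n, M; ℝ⟯) k (A - quantOp hW hD hσ) = 0 := by
  rw [map_sub, sub_eq_zero]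
  refine commMap_eq_of_diag fun g => ?_
  ext s x
  rw [commMap_quantOp_self, ← iterCommutator_eq_commMap]
  exact hA _ s x

end Quantization

/-! ### Smoothness of the torsion form. -/

section Torsion

open Filter Topology

variable {n : ℕ} {M : Type*} [TopologicalSpace M] [ChartedSpace (EuclideanSpace ℝ (Fin n)) M]
  [IsManifold (𝓡 n) ∞ M]

lemma IsDualFrame.trace_eq {f : Fin n → C^∞⟮𝓡 n, M; ℝ⟯} {Z : Fin n → VectorFields n M} {x : M}
    (h : IsDualFrame f Z x) (L : TangentSpace (𝓡 n) x →ₗ[ℝ] TangentSpace (𝓡 n) x) :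
    LinearMap.trace ℝ _ L = ∑ a, mvfderiv (𝓡 n) (f a) x (L (Z a x)) := by
  have h1 : L = ∑ a, dualTensorHom ℝ _ _ ((mvfderiv (𝓡 n) (f a) x).toLinearMap ⊗ₜ L (Z a x)) := by
    ext v
    conv_lhs => rw [h.sum_smul v]
    simp [LinearMap.sum_apply, dualTensorHom_apply]
  conv_lhs => rw [h1]
  simp [LinearMap.trace_eq_contract_apply]

variable [T2Space M]

/-- In a dual frame the trace is `∑ df_a(∇_X Z_a - ∇_{Z_a} X - [X, Z_a])`. -/
lemma contMDiff_torsionForm {W : AffineConnection n M} (hW : W.ContMDiffCovariantDerivative ∞) :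
    ContMDiff (𝓡 n) ((𝓡 n).prod 𝓘(ℝ, EuclideanSpace ℝ (Fin n) →L[ℝ] ℝ)) ∞
      (fun x => TotalSpace.mk' (EuclideanSpace ℝ (Fin n) →L[ℝ] ℝ)
        (E := fun x : M => TangentSpace (𝓡 n) x →L[ℝ] Bundle.Trivial M ℝ x) x
          (torsionForm W x)) := by
  refine contMDiff_oneForm_of_apply _ fun X x => ?_
  obtain ⟨f, Z, h⟩ := exists_isDualFrame (n := n) x
  have : IsManifold (𝓡 n) (((⊤ : ℕ∞) : ℕ∞ω) + 1) M := by simpa using ‹IsManifold (𝓡 n) ∞ M›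
  have : IsManifold (𝓡 n) (minSmoothness ℝ 2) M := by
    rw [minSmoothness_of_isRCLikeNormedField]
    infer_instance
  have hT : ∀ a, ContMDiffAt (𝓡 n) ((𝓡 n).prod 𝓘(ℝ, EuclideanSpace ℝ (Fin n))) ∞
      (fun y => TotalSpace.mk' (EuclideanSpace ℝ (Fin n)) y
        (W (Z a) y (X y) - W X y (Z a y) - VectorField.mlieBracket (𝓡 n) X (Z a) y)) x := fun a =>
    (((W.applySection hW X (Z a)).contMDiff x).sub_section
      ((W.applySection hW (Z a) X).contMDiff x)).sub_section
      (ContMDiffAt.mlieBracket_vectorField (m := ⊤) (n := ⊤) (X.contMDiff x) ((Z a).contMDiff x)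
        (by simp))
  have h1 : ContMDiffAt (𝓡 n) 𝓘(ℝ, ℝ) ∞ (fun y => ∑ a, mvfderiv (𝓡 n) (f a) y
      (W (Z a) y (X y) - W X y (Z a y) - VectorField.mlieBracket (𝓡 n) X (Z a) y)) x :=
    ContMDiffAt.sum fun a _ => contMDiffAt_mvfderiv_apply (f a) (hT a)
  refine h1.congr_of_eventuallyEq ?_
  filter_upwards [h] with y hy
  change LinearMap.trace ℝ (TangentSpace (𝓡 n) y) (W.torsion y (X y)).toLinearMap = _
  rw [hy.trace_eq]
  refine Finset.sum_congr rfl fun a _ => congrArg _ ?_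
  exact W.torsion_apply (X.mdiffAt y) ((Z a).mdiffAt y)

end Torsion

/-! ### Connections in a line bundle as an affine space over 1-forms. -/

section LineBundleConnections

open Filter Topology

variable {n : ℕ} {M : Type*} [TopologicalSpace M] [ChartedSpace (EuclideanSpace ℝ (Fin n)) M]
  {ξ : M → Type*} [TopologicalSpace (TotalSpace ℝ ξ)]
  [∀ x, AddCommGroup (ξ x)] [∀ x, Module ℝ (ξ x)] [∀ x, TopologicalSpace (ξ x)]
  [∀ x, IsTopologicalAddGroup (ξ x)] [∀ x, ContinuousSMul ℝ (ξ x)]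
  [FiberBundle ℝ ξ] [VectorBundle ℝ ℝ ξ] [IsManifold (𝓡 n) ∞ M]
  [ContMDiffVectorBundle ∞ ℝ ξ (𝓡 n)] [T2Space M]
  {D D' : CovariantDerivative (𝓡 n) ℝ ξ} (hD : D.ContMDiffCovariantDerivative ∞)
  (hD' : D'.ContMDiffCovariantDerivative ∞)

/-- Connections in a line bundle which agree on smooth sections are the same. -/
lemma sameConnection_of_forall_section (h : ∀ (s : Sections n ξ) (X : VectorFields n M) (x : M),
    D' s x (X x) = D s x (X x)) : SameConnection D' D := by
  intro s x hs
  have hΔ := fun {s} => D'.isCovariantDerivativeOnUniv.difference_apply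
    D.isCovariantDerivativeOnUniv (x := x) (σ := s)
  obtain ⟨e, -, -, he, -⟩ := exists_section_ne_zero (n := n) (ξ := ξ) x
  obtain ⟨c, hc⟩ := exists_fiber_eq_smul he.self_of_nhds (s x)
  -- The section `s` is only differentiable at `x`; tensoriality of the difference replaces it by a
  -- multiple of a smooth section.
  rw [← sub_eq_zero, ← hΔ hs, hc, map_smul, hΔ (e.mdiffAt x)]
  ext u
  obtain ⟨X, rfl⟩ := exists_vectorField_eq u
  change c • (D' e x (X x) - D e x (X x)) = 0
  rw [h, sub_self, smul_zero]

include hD hD' in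
/-- The difference of connections in a line bundle is a 1-form. -/
lemma exists_oneForm_difference : ∃ η : OneForms n M, ∀ (X : VectorFields n M) (s : Sections n ξ) x,
    D' s x (X x) = D s x (X x) + η x (X x) • s x := by
  have hΔ := fun {x} {s} => D'.isCovariantDerivativeOnUniv.difference_apply
    D.isCovariantDerivativeOnUniv (x := x) (σ := s)
  set Δ := D'.isCovariantDerivativeOnUniv.difference D.isCovariantDerivativeOnUniv
  have key : ∀ X : VectorFields n M, ∃ g : C^∞⟮𝓡 n, M; ℝ⟯, ∀ (s : Sections n ξ) x,
      D' s x (X x) - D s x (X x) = g x • s x := by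
    intro X
    have hB : ∀ (s : Sections n ξ) x, (D'.applySection hD' X s - D.applySection hD X s) x =
        Δ x (s x) (X x) := fun s x => by
      rw [hΔ (s.mdiffAt x)]
      rfl
    let B : Module.End ℝ (Sections n ξ) :=
      { toFun := fun s => D'.applySection hD' X s - D.applySection hD X s
        map_add' := fun s t => by
          ext x
          rw [ContMDiffSection.add_apply', hB, hB, hB, ContMDiffSection.add_apply', map_add]
          rfl
        map_smul' := fun c s => by
          ext x
          change _ = c • (D'.applySection hD' X s - D.applySection hD X s) x
          rw [hB, hB]
          exact congrArg (fun T => T (X x)) (map_smul (Δ x) c (s x)) }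
    have hB1 : commMap (R := C^∞⟮𝓡 n, M; ℝ⟯) 1 B = 0 := by
      ext f s x
      change (B (f 0 • s) - f 0 • B s) x = 0
      rw [ContMDiffSection.sub_apply', ContMDiffSection.fn_smul_apply, sub_eq_zero]
      change (D'.applySection hD' X _ - D.applySection hD X _) x = f 0 x •
        (D'.applySection hD' X s - D.applySection hD X s) x
      rw [hB, hB]
      exact congrArg (fun T => T (X x)) (map_smul (Δ x) (f 0 x) (s x))
    -- An operator of order zero is multiplication by its symbol, which is a smooth function.
    obtain ⟨τ, hτ⟩ := exists_isSymbolOf 0 B hB1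
    refine ⟨⟨_, hτ.contMDiff Fin.elim0⟩, fun s x => ?_⟩
    have := hτ Fin.elim0 s x
    rw [Nat.factorial_zero, Nat.cast_one, one_mul] at this
    exact this
  choose g hg using key
  have hext : ∀ {u v : C^∞⟮𝓡 n, M; ℝ⟯},
      (∀ (e : Sections n ξ) x, u x • e x = v x • e x) → u = v := by
    intro u v h
    ext x
    obtain ⟨e, -, -, he, -⟩ := exists_section_ne_zero (n := n) (ξ := ξ) x
    exact smul_left_injective ℝ he.self_of_nhds (h e x)
  obtain ⟨η, hη⟩ := exists_oneForm_of_linearMap (n := n) (M := M)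
    { toFun := g
      map_add' := fun X Y => hext fun e x => by
        rw [ContMDiffMap.add_apply_real, add_smul, ← hg, ← hg, ← hg, ContMDiffSection.add_apply',
          map_add, map_add]
        abel
      map_smul' := fun c X => hext fun e x => by
        change _ = (c x * g X x) • e x
        rw [mul_smul, ← hg, ← hg, ContMDiffSection.fn_smul_apply, map_smul, map_smul, smul_sub] }
  refine ⟨η, fun X s x => ?_⟩
  have h1 : η x (X x) = g X x := congrArg (fun u : C^∞⟮𝓡 n, M; ℝ⟯ => u x) (hη X)
  rw [h1, ← hg]
  abel

lemma koszul_eq_addForm {η : OneForms n M} (hη : ∀ (X : VectorFields n M) (s : Sections n ξ) x,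
    D' s x (X x) = D s x (X x) + η x (X x) • s x) :
    D'.koszul hD' = (D.koszul hD).addForm η.pairLinear := by
  have h : (D'.koszul hD').toHom = ((D.koszul hD).addForm η.pairLinear).toHom := by
    ext X s x
    exact hη X s x
  revert h
  cases D'.koszul hD'
  cases (D.koszul hD).addForm η.pairLinear
  rintro rfl
  rfl

end LineBundleConnections

/-! ### Dependence of the subsymbol on the connection in the line bundle. -/

section Subsymbol

open Filter Topology

variable {n : ℕ} {M : Type*} [TopologicalSpace M] [ChartedSpace (EuclideanSpace ℝ (Fin n)) M]
  {ξ : M → Type*} [TopologicalSpace (TotalSpace ℝ ξ)]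
  [∀ x, AddCommGroup (ξ x)] [∀ x, Module ℝ (ξ x)] [∀ x, TopologicalSpace (ξ x)]
  [∀ x, IsTopologicalAddGroup (ξ x)] [∀ x, ContinuousSMul ℝ (ξ x)]
  [FiberBundle ℝ ξ] [VectorBundle ℝ ℝ ξ] [IsManifold (𝓡 n) ∞ M]
  [ContMDiffVectorBundle ∞ ℝ ξ (𝓡 n)] [T2Space M]
  {W : AffineConnection n M} (hW : W.ContMDiffCovariantDerivative ∞)
  {D D' : CovariantDerivative (𝓡 n) ℝ ξ} (hD : D.ContMDiffCovariantDerivative ∞)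
  (hD' : D'.ContMDiffCovariantDerivative ∞) {m : ℕ}

lemma MultilinearMap.sum_update_const {V : Type*} [AddCommGroup V] [Module ℝ V]
    (τ : MultilinearMap ℝ (fun _ : Fin (m + 1) => V) ℝ)
    (hτ : ∀ (e : Equiv.Perm (Fin (m + 1))) v, τ (v ∘ e) = τ v) (v w : V) :
    ∑ i, τ (Function.update (fun _ => v) i w) = (m + 1) * τ (Fin.cons w fun _ => v) := by
  have h : ∀ i : Fin (m + 1), τ (Function.update (fun _ => v) i w) = τ (Fin.cons w fun _ => v) := by
    intro i
    rw [← hτ (Equiv.swap 0 i)]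
    congr 1
    ext j
    by_cases hj : j = 0
    · subst hj
      simp
    · obtain ⟨l, rfl⟩ := Fin.exists_succ_eq.2 hj
      have : Equiv.swap 0 i l.succ ≠ i := fun h => by
        have := (Equiv.swap 0 i).injective (h.trans (Equiv.swap_apply_left 0 i).symm)
        exact hj this
      simp [this]
  simp [h]

/-- The constant `(m+1)! m!` of `diagComm_symIter_addForm` is divided by `(m+1)!`, and by symmetry
the `m + 1` positions of `η` contribute equally. -/
lemma commMap_quantOp_add {σ : TensorField n M (m + 1)} (hσ : IsSmoothTensor σ)
    (hsymm : ∀ x (τ : Equiv.Perm (Fin (m + 1))) (α : Fin (m + 1) → Cotangent n x),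
      σ x (α ∘ τ) = σ x α)
    {η : OneForms n M} (hη : ∀ (X : VectorFields n M) (s : Sections n ξ) x,
      D' s x (X x) = D s x (X x) + η x (X x) • s x)
    (g : C^∞⟮𝓡 n, M; ℝ⟯) (s : Sections n ξ) (x : M) :
    commMap m (quantOp hW hD' hσ) (fun _ => g) s x = commMap m (quantOp hW hD hσ) (fun _ => g) s x +
      ((m.factorial : ℝ) * ((m + 1) *
        σ x (Fin.cons (η x) fun _ => mvfderiv (𝓡 n) g x))) • s x := by
  obtain ⟨f, Z, h⟩ := exists_isDualFrame (n := n) x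
  rw [commMap_quantOp_diag hW hD' hσ h, commMap_quantOp_diag hW hD hσ h,
    koszul_eq_addForm hD hD' hη]
  have h1 : ∀ J : Fin (m + 1) → Fin n,
      diagComm g m (fun s => (W.koszul hW).symIter ((D.koszul hD).addForm η.pairLinear) s (m + 1)) s
        (fun i => Z (J i)) x =
      diagComm g m (fun s => (W.koszul hW).symIter (D.koszul hD) s (m + 1)) s
        (fun i => Z (J i)) x + (((m + 1).factorial * m.factorial : ℝ) *
          ∑ i, ∏ l, (Function.update (fun _ => mvfderiv (𝓡 n) g x) i (η x) : Fin (m + 1) → _) l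
            (Z (J l) x)) • s x := by
    intro J
    rw [KoszulConnection.diagComm_symIter_addForm _ _ g (dForm g).pairLinear fun _ => rfl,
      ContMDiffSection.add_apply']
    congr 1
    change (ContMDiffSection.evalAddHom x) (_ • _) = _
    rw [map_nsmul, ← Nat.cast_smul_eq_nsmul ℝ, Nat.cast_mul,
      mul_smul (((m + 1).factorial : ℝ) * m.factorial)]
    congr 1
    change (∑ i, η.pairLinear (Z (J i)) * ∏ j ∈ Finset.univ.erase i,
      (dForm g).pairLinear (Z (J j)) : C^∞⟮𝓡 n, M; ℝ⟯) x • s x = _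
    rw [ContMDiffMap.sum_apply_real]
    congr 1
    refine Finset.sum_congr rfl fun i _ => ?_
    rw [ContMDiffMap.mul_apply_real, ContMDiffMap.prod_apply_real,
      ← Finset.mul_prod_erase Finset.univ _ (Finset.mem_univ i), Function.update_self]
    refine congrArg₂ _ rfl (Finset.prod_congr rfl fun j hj => ?_)
    rw [Function.update_of_ne (Finset.ne_of_mem_erase hj)]
    rfl
  simp only [h1, smul_add, Finset.sum_add_distrib]
  congr 1
  rw [← (σ x).sum_update_const (hsymm x), Finset.smul_sum, Finset.mul_sum, Finset.sum_smul]
  have h2 : ∀ i : Fin (m + 1), σ x (Function.update (fun _ => mvfderiv (𝓡 n) g x) i (η x)) = _ :=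
    fun i => h.self_of_nhds.tensor_apply (σ x) _
  simp only [h2]
  simp only [smul_smul, ← Finset.sum_smul, Finset.mul_sum]
  rw [Finset.sum_comm]
  congr 1
  refine Finset.sum_congr rfl fun i _ => Finset.sum_congr rfl fun J _ => ?_
  have hk : ((m + 1).factorial : ℝ) ≠ 0 := by positivity
  field_simp

variable {A : Module.End ℝ (Sections n ξ)} (hA : IsDiffOp (m + 1) A)

include hA in
lemma IsDiffOp.isSymbolOf_smbl : IsSymbolOf (m + 1) (fun s => A s) (smbl (m + 1) fun s => A s) :=
  smbl_spec _ A ((isDiffOp_iff _ A).1 hA)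

include hA in
lemma IsDiffOp.isSmoothTensor_smbl : IsSmoothTensor (smbl (m + 1) fun s => A s) :=
  hA.isSymbolOf_smbl.contMDiff

-- Subtracting the quantization lowers the order to `m`, so the symbol chosen in `subsymbol` is a
-- genuine one.
include hD in
lemma isSymbolOf_subsymbol :
    IsSymbolOf m (fun s => (A - quantOp hW hD hA.isSmoothTensor_smbl) s)
      (subsymbol (m + 1) A W D) :=
  smbl_spec m (A - quantOp hW hD hA.isSmoothTensor_smbl)
    (commMap_sub_quantOp_eq_zero hW hD hA.isSymbolOf_smbl _)

include hW hD hD' hA in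
/-- The subsymbols for different connections. -/
lemma subsymbol_sub {η : OneForms n M} (hη : ∀ (X : VectorFields n M) (s : Sections n ξ) x,
      D' s x (X x) = D s x (X x) + η x (X x) • s x) (x : M) (α : Fin m → Cotangent n x) :
    subsymbol (m + 1) A W D' x α = subsymbol (m + 1) A W D x α -
      (m + 1) * smbl (m + 1) (fun s => A s) x (Fin.cons (η x) α) := by
  have hσ := hA.isSymbolOf_smbl
  have hs := isSymbolOf_subsymbol hW hD hA
  have hs' := isSymbolOf_subsymbol hW hD' hA
  set σ := smbl (m + 1) fun s => A s
  let S : MultilinearMap ℝ (fun _ : Fin m => Cotangent n x) ℝ := subsymbol (m + 1) A W D x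
  let τ : MultilinearMap ℝ (fun _ : Fin m => Cotangent n x) ℝ := S - ((m : ℝ) + 1) • (σ x).curryLeft (η x)
  suffices h : (subsymbol (m + 1) A W D' x : MultilinearMap ℝ (fun _ : Fin m => Cotangent n x) ℝ) = τ
    from congrArg (fun T => T α) h
  -- Both sides are symmetric, so it suffices to compare diagonal commutators, where
  -- `commMap_quantOp_add` applies.
  refine MultilinearMap.eq_of_diag _ _ (fun e v => hs'.comp_perm x e v) (fun e v => ?_) fun v => ?_
  · change subsymbol (m + 1) A W D x (v ∘ e) - _ * σ x (Fin.cons (η x) (v ∘ e)) =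
      subsymbol (m + 1) A W D x v - _ * σ x (Fin.cons (η x) v)
    have h1 : (Fin.cons (η x) (v ∘ e) : Fin (m + 1) → Cotangent n x) =
        (Fin.cons (η x) v : Fin (m + 1) → Cotangent n x) ∘ Equiv.Perm.decomposeFin.symm (0, e) := by
      ext1 j
      refine Fin.cases ?_ (fun j => ?_) j
      · simp
      · simp
    rw [h1, hσ.comp_perm]
    congr 1
    exact hs.comp_perm x e v
  · obtain ⟨L, hL⟩ := exists_diffAt_rightInverse (n := n) x
    obtain ⟨e, -, -, he, -⟩ := exists_section_ne_zero (n := n) (ξ := ξ) x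
    have h1 := hs (fun _ => L v) e x
    have h2 := hs' (fun _ => L v) e x
    rw [iterCommutator_eq_commMap, map_sub] at h1 h2
    have h3 := commMap_quantOp_add hW hD hD' hA.isSmoothTensor_smbl hσ.comp_perm hη (L v) e x
    simp only [hL] at h1 h2 h3
    have h4 : ((m.factorial : ℝ) * subsymbol (m + 1) A W D' x fun _ => v) • e x =
        ((m.factorial : ℝ) * τ fun _ => v) • e x := by
      change _ = ((m.factorial : ℝ) * (subsymbol (m + 1) A W D x (fun _ => v) -
        ((m : ℝ) + 1) * σ x (Fin.cons (η x) fun _ => v))) • e x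
      rw [mul_sub, sub_smul]
      refine h2.symm.trans ((congrArg₂ _ h1.symm rfl).trans ?_).symm
      change commMap m A _ e x - commMap m _ _ e x - _ = commMap m A _ e x - commMap m _ _ e x
      rw [h3]
      abel
    have hm : (m.factorial : ℝ) ≠ 0 := by positivity
    exact mul_left_cancel₀ hm (smul_left_injective ℝ he.self_of_nhds h4)

end Subsymbol

/-! ### Raising indices with a nondegenerate bilinear form. -/

section NondegenerateSystems

open Filter Topology

variable {n : ℕ} {M : Type*} [TopologicalSpace M] [ChartedSpace (EuclideanSpace ℝ (Fin n)) M]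
  [IsManifold (𝓡 n) ∞ M] [T2Space M]

/-- `rowMap` as a linear function of the matrix. -/
def rowMapL (n : ℕ) : (Fin n → Fin n → ℝ) →L[ℝ] (Fin n → ℝ) →L[ℝ] (Fin n → ℝ) :=
  LinearMap.toContinuousLinearMap
    { toFun := rowMap
      map_add' := fun β β' => by ext w b; simp [rowMap, Finset.sum_add_distrib]
      map_smul' := fun c β => by ext w b; simp [rowMap, Finset.mul_sum, mul_left_comm] }

lemma rowMapL_apply (β : Fin n → Fin n → ℝ) (w : Fin n → ℝ) (b : Fin n) :
    rowMapL n β w b = ∑ a, w a * β a b := by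
  change rowMap β w b = _
  simp [rowMap]

/-- A nondegenerate smooth bilinear form on covectors identifies linear forms on covectors with
1-forms. -/
lemma exists_oneForm_of_nondegenerate
    {g : (x : M) → Cotangent n x →ₗ[ℝ] Cotangent n x →ₗ[ℝ] ℝ} {l : (x : M) → Cotangent n x →ₗ[ℝ] ℝ}
    (hg : ∀ f f' : C^∞⟮𝓡 n, M; ℝ⟯, ContMDiff (𝓡 n) 𝓘(ℝ, ℝ) ∞
      fun y => g y (mvfderiv (𝓡 n) f y) (mvfderiv (𝓡 n) f' y))
    (hl : ∀ f : C^∞⟮𝓡 n, M; ℝ⟯, ContMDiff (𝓡 n) 𝓘(ℝ, ℝ) ∞ fun y => l y (mvfderiv (𝓡 n) f y))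
    (hnd : ∀ x α, (∀ β, g x α β = 0) → α = 0) :
    ∃ η : OneForms n M, ∀ x α, g x (η x) α = l x α := by
  let c : (Fin n → C^∞⟮𝓡 n, M; ℝ⟯) → M → Fin n → Fin n → ℝ := fun f y a b =>
    g y (mvfderiv (𝓡 n) (f a) y) (mvfderiv (𝓡 n) (f b) y)
  let r : (Fin n → C^∞⟮𝓡 n, M; ℝ⟯) → M → Fin n → ℝ := fun f y b => l y (mvfderiv (𝓡 n) (f b) y)
  have hc : ∀ f y w b, rowMapL n (c f y) w b = g y (coframeMap f y w) (mvfderiv (𝓡 n) (f b) y) := by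
    intro f y w b
    simp [rowMapL_apply, coframeMap_apply, LinearMap.sum_apply, c]
  have hinj : ∀ {f : Fin n → C^∞⟮𝓡 n, M; ℝ⟯} {Z : Fin n → VectorFields n M} {y : M},
      IsDualFrame f Z y → Function.Injective (rowMapL n (c f y)) := by
    intro f Z y hy
    refine (injective_iff_map_eq_zero _).2 fun w hw => ?_
    have h1 : coframeMap f y w = 0 := hnd y _ fun β => by
      rw [hy.sum_smul_dual β, map_sum]
      refine Finset.sum_eq_zero fun b _ => ?_
      rw [map_smul, ← hc, hw, Pi.zero_apply, smul_zero]
    ext b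
    have h2 := congrArg (fun α : Cotangent n y => α (Z b y)) h1
    simpa [coframeMap_apply, sum_apply, hy.apply] using h2
  have key : ∀ x, ∃ η : Cotangent n x, ∀ α, g x η α = l x α := by
    intro x
    obtain ⟨f, Z, h⟩ := exists_isDualFrame (n := n) x
    have hx := h.self_of_nhds
    obtain ⟨w, hw⟩ := (LinearMap.injective_iff_surjective
      (f := (rowMapL n (c f x)).toLinearMap)).1 (hinj hx) (r f x)
    refine ⟨coframeMap f x w, fun α => ?_⟩
    rw [hx.sum_smul_dual α, map_sum, map_sum]
    refine Finset.sum_congr rfl fun b _ => ?_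
    rw [map_smul, map_smul, ← hc]
    exact congrArg _ (congrFun hw b)
  choose η hη using key
  refine ⟨⟨η, contMDiff_oneForm_of_apply η fun Y x => ?_⟩, hη⟩
  obtain ⟨f, Z, h⟩ := exists_isDualFrame (n := n) x
  have hcs : ContMDiffAt (𝓡 n) 𝓘(ℝ, Fin n → Fin n → ℝ) ∞ (c f) x :=
    contMDiffAt_pi_space.2 fun a => contMDiffAt_pi_space.2 fun b => hg (f a) (f b) x
  have hrs : ContMDiffAt (𝓡 n) 𝓘(ℝ, Fin n → ℝ) ∞ (r f) x :=
    contMDiffAt_pi_space.2 fun b => hl (f b) x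
  obtain ⟨B, hB, hB'⟩ := ContMDiffAt.exists_solution (rowMapL n) hcs hrs (hinj h.self_of_nhds)
  have h1 : ContMDiffAt (𝓡 n) 𝓘(ℝ, ℝ) ∞ (fun y => ∑ a, B y a * mvfderiv (𝓡 n) (f a) y (Y y)) x :=
    ContMDiffAt.sum fun a _ => (contMDiffAt_pi_space.1 hB a).mul ((lieDeriv Y (f a)).contMDiff x)
  refine h1.congr_of_eventuallyEq ?_
  filter_upwards [h, hB'] with y hy hyB
  have h2 := hyB (fun a => η y (Z a y)) (by
    ext b
    rw [hc, hy.coframeMap_apply_eq, hη])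
  conv_lhs => rw [hy.sum_smul_dual (η y)]
  rw [← h2]
  simp [sum_apply]

end NondegenerateSystems

/-! ### Contractions with powers of a covector as linear and bilinear forms. -/

section Contractions

variable {n : ℕ} {M : Type*} [TopologicalSpace M] [ChartedSpace (EuclideanSpace ℝ (Fin n)) M]
  {x : M} {m : ℕ}

lemma hookPow_one_eq (θ α : Cotangent n x)
    (τ : MultilinearMap ℝ (fun _ : Fin (m + 1) => Cotangent n x) ℝ) :
    hookPow 1 θ τ ![α] = τ (Function.update (fun _ => θ) 0 α) := by
  refine congrArg τ (funext fun i => ?_)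
  refine Fin.cases (by simp) (fun i => ?_) i
  simp

lemma hookPow_two_eq (θ α β : Cotangent n x)
    (τ : MultilinearMap ℝ (fun _ : Fin (m + 2) => Cotangent n x) ℝ) :
    hookPow 2 θ τ ![α, β] = τ (Function.update (Function.update (fun _ => θ) 1 β) 0 α) := by
  refine congrArg τ (funext fun i => ?_)
  refine Fin.cases (by simp) (fun i => ?_) i
  refine Fin.cases (by simp) (fun i => ?_) i
  have h : (i.succ.succ : Fin (m + 2)) ≠ 1 := fun h => by simp [Fin.ext_iff] at h
  rw [Function.update_of_ne (Fin.succ_ne_zero _), Function.update_of_ne h]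
  simp

/-- The contraction of a `k`-vector with a power of a covector, as a linear form. -/
def hookOne (θ : Cotangent n x) (τ : MultilinearMap ℝ (fun _ : Fin (m + 1) => Cotangent n x) ℝ) :
    Cotangent n x →ₗ[ℝ] ℝ where
  toFun α := hookPow 1 θ τ ![α]
  map_add' α β := by simp only [hookPow_one_eq, τ.map_update_add]
  map_smul' c α := by simp only [hookPow_one_eq, τ.map_update_smul, RingHom.id_apply]

/-- The contraction of a `k`-vector with a power of a covector, as a bilinear form. -/
def hookTwo (θ : Cotangent n x) (τ : MultilinearMap ℝ (fun _ : Fin (m + 2) => Cotangent n x) ℝ) :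
    Cotangent n x →ₗ[ℝ] Cotangent n x →ₗ[ℝ] ℝ :=
  LinearMap.mk₂ ℝ (fun α β => hookPow 2 θ τ ![α, β])
    (fun α α' β => by simp only [hookPow_two_eq, τ.map_update_add])
    (fun c α β => by simp only [hookPow_two_eq, τ.map_update_smul])
    (fun α β β' => by
      simp only [hookPow_two_eq, Function.update_comm (one_ne_zero : (1 : Fin (m + 2)) ≠ 0),
        τ.map_update_add])
    (fun c α β => by
      simp only [hookPow_two_eq, Function.update_comm (one_ne_zero : (1 : Fin (m + 2)) ≠ 0),
        τ.map_update_smul])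

variable [IsManifold (𝓡 n) ∞ M] [T2Space M]

lemma contMDiff_hookOne {σ : TensorField n M (m + 1)} (hσ : IsSmoothTensor σ) (θ : OneForms n M)
    (f : C^∞⟮𝓡 n, M; ℝ⟯) : ContMDiff (𝓡 n) 𝓘(ℝ, ℝ) ∞
      fun y => hookOne (θ y) (σ y) (mvfderiv (𝓡 n) f y) := by
  have h := contMDiff_tensor_apply hσ (Function.update (fun _ => θ) 0 (dForm f))
  simp only [apply_update_eq] at h
  exact h.congr fun y => hookPow_one_eq _ _ _

lemma contMDiff_hookTwo {σ : TensorField n M (m + 2)} (hσ : IsSmoothTensor σ) (θ : OneForms n M)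
    (f f' : C^∞⟮𝓡 n, M; ℝ⟯) : ContMDiff (𝓡 n) 𝓘(ℝ, ℝ) ∞
      fun y => hookTwo (θ y) (σ y) (mvfderiv (𝓡 n) f y) (mvfderiv (𝓡 n) f' y) := by
  have h := contMDiff_tensor_apply hσ
    (Function.update (Function.update (fun _ => θ) 1 (dForm f')) 0 (dForm f))
  simp only [apply_update_eq] at h
  exact h.congr fun y => hookPow_two_eq _ _ _ _

end Contractions

/-! ### The connection determined by the contracted subsymbol. -/

section SubsymbolConnection

variable {n : ℕ} {M : Type*} [TopologicalSpace M] [ChartedSpace (EuclideanSpace ℝ (Fin n)) M]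
  {ξ : M → Type*} [TopologicalSpace (TotalSpace ℝ ξ)]
  [∀ x, AddCommGroup (ξ x)] [∀ x, Module ℝ (ξ x)] [∀ x, TopologicalSpace (ξ x)]
  [∀ x, IsTopologicalAddGroup (ξ x)] [∀ x, ContinuousSMul ℝ (ξ x)]
  [FiberBundle ℝ ξ] [VectorBundle ℝ ℝ ξ] [IsManifold (𝓡 n) ∞ M]
  [ContMDiffVectorBundle ∞ ℝ ξ (𝓡 n)] [T2Space M]
  {W : AffineConnection n M} (hW : W.ContMDiffCovariantDerivative ∞)
  {D D' : CovariantDerivative (𝓡 n) ℝ ξ} (hD : D.ContMDiffCovariantDerivative ∞)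
  (hD' : D'.ContMDiffCovariantDerivative ∞) {m : ℕ}
  {A : Module.End ℝ (Sections n ξ)} (hA : IsDiffOp (m + 2) A)

-- Contracting `subsymbol_sub` with `θ` leaves the quadratic symbol `g_W(η, α)` as the only change,
-- with factor `k = m + 2`. Both existence and uniqueness are read off from this.
include hW hD hD' hA in
lemma hookPow_subsymbol_sub {η : OneForms n M} (hη : ∀ (X : VectorFields n M) (s : Sections n ξ) x,
      D' s x (X x) = D s x (X x) + η x (X x) • s x) (x : M) (θ α : Cotangent n x) :
    hookPow 1 θ (subsymbol (m + 2) A W D' x) ![α] = hookPow 1 θ (subsymbol (m + 2) A W D x) ![α] -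
      (m + 2) * hookPow 2 θ (smbl (m + 2) (fun s => A s) x) ![η x, α] := by
  refine (subsymbol_sub hW hD hD' hA hη x _).trans ?_
  refine congrArg₂ _ rfl (congrArg₂ _ (by push_cast; ring) (congrArg _ (funext fun i => ?_)))
  refine Fin.cases (by simp) (fun i => ?_) i
  refine Fin.cases (by simp) (fun i => ?_) i
  simp

include hW hA in
/-- A connection in a line bundle which annihilates the contracted subsymbol. -/
theorem exists_connection_hookPow_subsymbol_eq_zero [SecondCountableTopology M]
    (hreg : IsWagnerRegular (smbl (m + 2) fun s => A s) W) :
    ∃ D : CovariantDerivative (𝓡 n) ℝ ξ, D.ContMDiffCovariantDerivative ∞ ∧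
      ∀ (x : M) (α : Cotangent n x),
        hookPow 1 (torsionForm W x) (subsymbol (m + 2) A W D x) ![α] = 0 := by
  obtain ⟨D, hD⟩ := exists_contMDiff_connection n (F := ℝ) (V := ξ)
  let θ : OneForms n M := ⟨torsionForm W, contMDiff_torsionForm hW⟩
  let S : TensorField n M (m + 1) := subsymbol (m + 2) A W D
  have hS : IsSmoothTensor S := (isSymbolOf_subsymbol hW hD hA).contMDiff
  obtain ⟨η, hη⟩ := exists_oneForm_of_nondegenerate (n := n) (M := M)
    (g := fun x => hookTwo (θ x) (smbl (m + 2) (fun s => A s) x))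
    -- The equation `k g_W(η, ·) = θ^{k-2} ⌋ σ_{k-1,D}` makes the new contraction vanish.
    (l := fun x => ((m : ℝ) + 2)⁻¹ • hookOne (θ x) (S x))
    (contMDiff_hookTwo hA.isSmoothTensor_smbl θ)
    (fun f => contMDiff_const.mul (contMDiff_hookOne hS θ f)) hreg
  -- The trivializations only supply continuity of the map `v ↦ (u ↦ η(u) v)` in the fibre; its
  -- values do not depend on them.
  let e : (x : M) → ξ x ≃L[ℝ] ℝ := fun x => (trivializationAt ℝ ξ x).continuousLinearEquivAt ℝ x
    (FiberBundle.mem_baseSet_trivializationAt' x)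
  let B : (x : M) → ξ x →L[ℝ] TangentSpace (𝓡 n) x →L[ℝ] ξ x := fun x =>
    (e x : ξ x →L[ℝ] ℝ).smulRight ((η x : Cotangent n x).smulRight ((e x).symm 1))
  have hB : ∀ x v u, B x v u = η x u • v := fun x v u => by
    change e x v • η x u • (e x).symm 1 = _
    rw [smul_comm, ← map_smul, smul_eq_mul, mul_one, ContinuousLinearEquiv.symm_apply_apply]
  have hsm : (D.addOneForm B).ContMDiffCovariantDerivative ∞ :=
    CovariantDerivative.contMDiff_addOneForm hD fun s X => by
      simp only [hB]
      exact (η.pair X).contMDiff.smul_section s.contMDiff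
  refine ⟨D.addOneForm B, hsm, fun x α => ?_⟩
  rw [hookPow_subsymbol_sub hW hD hsm hA (η := η) (fun X s x => by rw [← hB]; rfl)]
  have h1 : hookPow 2 (torsionForm W x) (smbl (m + 2) (fun s => A s) x) ![η x, α] =
    ((m : ℝ) + 2)⁻¹ * hookPow 1 (torsionForm W x) (S x) ![α] := hη x α
  rw [h1, mul_inv_cancel_left₀ (by positivity)]
  exact sub_self _

include hW hD hD' hA in
/-- The contracted subsymbol determines the connection. -/
theorem sameConnection_of_hookPow_subsymbol_eq_zero
    (hreg : IsWagnerRegular (smbl (m + 2) fun s => A s) W)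
    (h : ∀ (x : M) (α : Cotangent n x),
      hookPow 1 (torsionForm W x) (subsymbol (m + 2) A W D x) ![α] = 0)
    (h' : ∀ (x : M) (α : Cotangent n x),
      hookPow 1 (torsionForm W x) (subsymbol (m + 2) A W D' x) ![α] = 0) :
    SameConnection D' D := by
  obtain ⟨η, hη⟩ := exists_oneForm_difference hD hD'
  have h0 : ∀ x, η x = 0 := fun x => hreg x (η x) fun α => by
    have h1 := hookPow_subsymbol_sub hW hD hD' hA hη x (torsionForm W x) α
    rw [h, h', zero_sub, zero_eq_neg] at h1
    exact (mul_eq_zero.1 h1).resolve_left (by positivity)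
  refine sameConnection_of_forall_section fun s X x => ?_
  rw [hη, h0]
  exact (congrArg _ (zero_smul ℝ (s x))).trans (add_zero _)

end SubsymbolConnection

end

theorem mainTheorem8 {n : ℕ} (hn : 2 ≤ n) {k : ℕ} (hk : 3 ≤ k)
    {M : Type*} [TopologicalSpace M] [T2Space M] [SecondCountableTopology M]
    [ChartedSpace (EuclideanSpace ℝ (Fin n)) M] [IsManifold (𝓡 n) ∞ M]
    {ξ : M → Type*} [TopologicalSpace (TotalSpace ℝ ξ)]
    [∀ x, AddCommGroup (ξ x)] [∀ x, Module ℝ (ξ x)] [∀ x, TopologicalSpace (ξ x)]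
    [∀ x, IsTopologicalAddGroup (ξ x)] [∀ x, ContinuousSMul ℝ (ξ x)]
    [FiberBundle ℝ ξ] [VectorBundle ℝ ℝ ξ] [ContMDiffVectorBundle ∞ ℝ ξ (𝓡 n)]
    (A : Sections n ξ →ₗ[ℝ] Sections n ξ) (hA : IsDiffOp k A)
    (ϖ : Set ((EuclideanSpace ℝ (Fin n) →L[ℝ] ℝ) → ℝ)) (hϖ : IsRegularOrbit k ϖ)
    (hconst : HasConstantType ϖ (smbl k fun s => A s)) :
    (∃ W : AffineConnection n M, IsWagnerConnection (smbl k fun s => A s) W ∧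
      ∀ W' : AffineConnection n M, IsWagnerConnection (smbl k fun s => A s) W' →
        SameConnection W' W) ∧
    ∀ W : AffineConnection n M, IsWagnerConnection (smbl k fun s => A s) W →
      IsWagnerRegular (smbl k fun s => A s) W →
      ∃ D : CovariantDerivative (𝓡 n) ℝ ξ,
        (D.ContMDiffCovariantDerivative ∞ ∧
          ∀ (x : M) (α : Cotangent n x),
            hookPow 1 (torsionForm W x) (subsymbol k A W D x) ![α] = 0) ∧
        ∀ D' : CovariantDerivative (𝓡 n) ℝ ξ,
          (D'.ContMDiffCovariantDerivative ∞ ∧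
            ∀ (x : M) (α : Cotangent n x),
              hookPow 1 (torsionForm W x) (subsymbol k A W D' x) ![α] = 0) →
          SameConnection D' D := by
  -- With degree `m + 2`, contraction with `θ^m` leaves two free slots in the symbol and one in the
  -- subsymbol.
  obtain ⟨m, rfl⟩ : ∃ m, k = m + 2 := ⟨k - 2, by omega⟩
  have hσ := hA.isSymbolOf_smbl
  have hk0 : m + 2 ≠ 0 := by omega
  refine ⟨?_, fun W hW hreg => ?_⟩
  · obtain ⟨W, hW⟩ := exists_isWagnerConnection hk0 hA.isSmoothTensor_smbl hσ.comp_perm hϖ hconst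
    exact ⟨W, hW, fun W' hW' => hW.sameConnection hk0 hϖ hconst hW'⟩
  · obtain ⟨D, hD, h⟩ := exists_connection_hookPow_subsymbol_eq_zero hW.1 hA hreg
    exact ⟨D, ⟨hD, h⟩, fun D' hD' =>
      sameConnection_of_hookPow_subsymbol_eq_zero hW.1 hD hD'.1 hA hreg h hD'.2⟩
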